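/- **Setting.** Let $\Lambda^{\rm hom}=\mathsf A\mathbb Z^2$, $\det\mathsf A\neq0$, and let $\Lambda\subset\mathbb R^2$ be such that $\Lambda\cap B_{R_{\rm DEF}}$ is finite and $\Lambda\setminus B_{R_{\rm DEF}}=\Lambda^{\rm hom}\setminus B_{R_{\rm DEF}}$ ($B_r$ is the closed ball of radius $r$ about $0$). For a cut-off $r_{\rm cut}>0$ put $\mathcal R_\ell=\{\rho:0<|\rho|\le r_{\rm cut},\ \ell+\rho\in\Lambda\}$ and $Du(\ell)=(u(\ell+\rho)-u(\ell))_{\rho\in\mathcal R_\ell}$ for $u:\Lambda\to\mathbb R^2$. The site potentials $V_\ell:(\mathbb R^2)^{\mathcal R_\ell}\to\mathbb R$ are $C^2$, $V_\ell(0)=0$, and $V_\ell=V$ for $|\ell|>R_{\rm DEF}+r_{\rm cut}$, with a homogeneous potential $V$ on $(\mathbb R^2)^{\mathcal R}$, where $\mathcal R=\{\rho\in\Lambda^{\rm hom}:0<|\rho|\le r_{\rm cut}\}$. Let $\mathcal T_\Lambda$ be a conforming triangulation of $\mathbb R^2$ with node set exactly $\Lambda$ and bounded triangle diameters, $\zeta_\ell$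 its nodal $\mathcal P_1$ basis, $I_{\rm a}u=\sum_\ell u(\ell)\zeta_\ell$ the nodal interpolant (also for functions $u$ on $\mathbb R^2$), $\|u\|_{\mathscr U^{1,2}}=\|\nabla I_{\rm a}u\|_{L^2(\mathbb R^2)}$, and $\mathscr U^{1,2}$ the set of $u:\Lambda\to\mathbb R^2$ for which this is finite. The energy is $\mathcal E^{\rm a}(u)=\sum_{\ell\in\Lambda}V_\ell(Du(\ell))$, extended from finitely supported displacements to $\mathscr U^{1,2}$ by $$\mathcal E^{\rm a}(u)=\sum_{\ell}\big(V_\ell(Du(\ell))-\langle\delta V_\ell(0),Du(\ell)\rangle\big)+\sum_\ell f_\ell\cdot u(\ell),\qquad f_\ell=\partial_{u(\ell)}\sum_{k}\langle\delta V_k(0),Du(k)\rangle .$$ Put $\mathsf R(u)[v]=\langle\delta\mathcal E^{\rm a}(u),v\rangle$, $\|\mathsf R(u)\|_{(\mathscr U^{1,2})^*}=\sup\{|\mathsf R(u)[v]|:v\in\mathscr U^{1,2},\ \|v\|_{\mathscr U^{1,2}}\le1\}$, $\mathcal F_\ell(u)=\partial_{u(\ell)}\mathcal E^{\rm a}(u)$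 and $\widehat{\mathcal F}(u)=\sum_\ell c_\ell\mathcal F_\ell(u)\zeta_\ell$ with $c_\ell=(\int\zeta_\ell)^{-1}$. A *strongly stable solution* is a local minimizer $u^{\rm a}$ of $\mathcal E^{\rm a}$ in $\mathscr U^{1,2}$ (with respect to $\|\cdot\|_{\mathscr U^{1,2}}$) for which there is $\gamma>0$ with $\langle\delta^2\mathcal E^{\rm a}(u^{\rm a})v,v\rangle\ge\gamma\|v\|^2_{\mathscr U^{1,2}}$ for all $v\in\mathscr U^{1,2}$. **Approximation parameters.** A finite set $\mathcal T_\Omega\subset\mathcal T_\Lambda$, with $\Omega={\rm int}\bigcup\mathcal T_\Omega$ and $B_{R_\Omega}\subset\Omega\subset B_{2R_\Omega}$ for some $R_\Omega>0$; a decomposition $\Omega=\Omega^{\rm a}\cup\Omega^{\rm b}\cup\Omega^{\rm c}$; a blending function $\beta\in C^{2,1}(\mathbb R^2)$ with $\beta=0$ on $\Omega^{\rm a}$, $\beta=1$ on $\Omega^{\rm c}$, ${\rm supp}\nabla\beta\subset\Omega^{\rm b}$; a finite conforming triangulation $\mathcal T_h$ that contains every triangle of $\mathcal T_\Lambda$ whose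 vertices all lie in $\Omega^{\rm a}\cup\Omega^{\rm b}$, with $\Omega_h=\bigcup\mathcal T_h\subset\overline\Omega$; ${\rm DoF}$ is its number of nodes. $\mathscr U_h^{(1)}$ (resp. $\mathscr U_h^{(2)}$) is the space of continuous $u:\mathbb R^2\to\mathbb R^2$ that vanish outside $\Omega_h$ and are affine on each $T\in\mathcal T_h$ (resp. affine on each $T$ on which $\beta<1$ somewhere, and polynomials of degree $\le2$ on the other $T$). $Q_h$ is the midpoint rule on each $T$ for the P1 methods, and a quadrature rule on each $T$ (finitely many points of $T$) that is exact for polynomials of degree $\le2$ for the P2 methods. With $W(\mathsf F)=|\det\mathsf A|^{-1}V(\mathsf F\mathcal R)$, $V''_\ell(g)=V_\ell(g)-\langle\delta V_\ell(0),g\rangle$, $W''(\mathsf F)=W(\mathsf F)-\langle\delta W(0),\mathsf F\rangle$ and $\mathcal E_h^{\rm cb}(u)=\int_{\Omega_h}Q_h[W(\nabla u)]$, a *blended solution* $u_h$ is one of: * BQCE: a local minimizer over $\mathscr U_h^{(1)}$ of $\sum_{\ell\in\Lambda\cap\Omega_h}(1-\beta(\ell))V_\ell(Du(\ell))+\int_{\Omega_h}Q_h[\beta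 W(\nabla u)]$; * P$k$-BQCF ($k=1,2$): $u_h\in\mathscr U_h^{(k)}$ with $\langle\delta\mathcal E^{\rm a}(u_h),(1-\beta)v\rangle+\langle\delta\mathcal E^{\rm cb}_h(u_h),\beta v\rangle=0$ for all $v\in\mathscr U_h^{(k)}$; * P$k$-BGFC ($k=1,2$): a local minimizer over $\mathscr U_h^{(k)}$ of $\sum_{\ell\in\Lambda\cap\Omega_h}(1-\beta(\ell))V''_\ell(Du(\ell))+\int_{\Omega_h}Q_h[\beta W''(\nabla u)]$. (Local minimizers in $\mathscr U_h^{(k)}$ are meant with respect to $\|\nabla\cdot\|_{L^2}$.) It is assumed throughout that $\Omega$ contains all atoms carrying a residual force: $\mathcal F_\ell(I_{\rm a}u_h)=0$ for $\ell\in\Lambda\setminus\overline\Omega$. **Estimator.** Let $\mathscr U^\Omega_{\rm a}$ be the space of continuous functions $\mathbb R^2\to\mathbb R^2$ that are affine on each $T\in\mathcal T_\Omega$ and zero outside $\Omega$, and let $\phi_{\rm a}\in\mathscr U^\Omega_{\rm a}$ solve $$\int_\Omega\nabla\phi_{\rm a}:\nabla v=\int_\Omega\widehat{\mathcal F}(I_{\rm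 a}u_h)\cdot v\qquad\forall v\in\mathscr U^\Omega_{\rm a}.$$ Put $\eta(u_h)=\|\nabla\phi_{\rm a}\|_{L^2(\Omega)}$ and $\rho_{\rm tr}(u_h)=R_\Omega\|\widehat{\mathcal F}(I_{\rm a}u_h)\|_{L^2(\Omega\setminus B_{R_\Omega/2})}+\|\nabla\phi_{\rm a}\|_{L^2(\Omega\setminus B_{R_\Omega/2})}$. **Theorem.** (i) There are constants $c,C>0$, depending only on the atomistic model ($\Lambda$, $\mathcal T_\Lambda$, $r_{\rm cut}$, $V_\ell$) and not on the approximation parameters or the method, such that for every blended solution $u_h$ the function $\phi_{\rm a}$ exists and is unique, and $$c\,\eta(u_h)\le\|\mathsf R(I_{\rm a}u_h)\|_{(\mathscr U^{1,2})^*}\le C\big(\eta(u_h)+\rho_{\rm tr}(u_h)\big).$$ (ii) Let $u^{\rm a}$ be a strongly stable solution and $K\in\mathbb R$. There are $c,C>0$ and $N\in\mathbb N$, depending only on the atomistic model, $u^{\rm a}$ and $K$, such that for every blended solution $u_h$ with ${\rm DoF}\ge N$ that satisfies the a priori error estimate of its method, $\|u^{\rm a}-I_{\rm a}u_h\|_{\mathscr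 U^{1,2}}\le K\,{\rm DoF}^{-s}$, where $s=\tfrac12$ for BQCE, $s=1$ for P1-BQCF and P1-BGFC, and $s=\tfrac32$ for P2-BQCF and P2-BGFC, $$c\,\eta(u_h)\le\|u^{\rm a}-I_{\rm a}u_h\|_{\mathscr U^{1,2}}\le C\big(\eta(u_h)+\rho_{\rm tr}(u_h)\big).$$ -/

import Mathlib

open scoped ENNReal RealInnerProductSpace

noncomputable section

namespace BlendedAC

/-- The plane with its Euclidean norm. -/
abbrev Plane := EuclideanSpace ℝ (Fin 2)

/-- First variation `⟨δJ(u), v⟩` of a functional `J` on a real vector space. -/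
def firstVariation {X : Type*} [AddCommGroup X] [Module ℝ X] (J : X → ℝ) (u v : X) : ℝ :=
  deriv (fun t : ℝ => J (u + t • v)) 0

/-- Second variation `⟨δ²J(u) v, w⟩`. -/
def secondVariation {X : Type*} [AddCommGroup X] [Module ℝ X] (J : X → ℝ) (u v w : X) : ℝ :=
  deriv (fun s : ℝ => firstVariation J (u + s • v) w) 0

/-- `(∇f : ∇g)(x)`, the Frobenius product of the two Jacobians at `x`. -/
def gradInner (f g : Plane → Plane) (x : Plane) : ℝ :=
  ∑ i : Fin 2, ⟪fderiv ℝ f x (EuclideanSpace.single i 1), fderiv ℝ g x (EuclideanSpace.single i 1)⟫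

/-- `‖∇f‖_{L²(S)}`. -/
def gradL2 (S : Set Plane) (f : Plane → Plane) : ℝ :=
  √(∫ x in S, gradInner f f x)

/-- `‖f‖_{L²(S)}`. -/
def normL2 (S : Set Plane) (f : Plane → Plane) : ℝ :=
  √(∫ x in S, ‖f x‖ ^ 2)

/-! ### Triangulations, given by the vertex sets of their (closed) triangles -/

/-- The closed triangle with vertex set `T`. -/
def hull (T : Finset Plane) : Set Plane := convexHull ℝ (T : Set Plane)

/-- A conforming family of nondegenerate triangles: two of them meet in a common face. -/
structure IsTriangulation (𝒯 : Set (Finset Plane)) : Prop where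
  card_eq : ∀ T ∈ 𝒯, T.card = 3
  indep : ∀ T ∈ 𝒯, AffineIndependent ℝ (fun p : T => (p : Plane))
  conforming : ∀ T ∈ 𝒯, ∀ T' ∈ 𝒯,
    hull T ∩ hull T' ⊆ convexHull ℝ ((T : Set Plane) ∩ (T' : Set Plane))

/-- `w` gives the barycentric coordinates of the point `x` of the triangle `T`. -/
def IsBarycentric (T : Finset Plane) (x : Plane) (w : Plane → ℝ) : Prop :=
  (∀ p, 0 ≤ w p) ∧ (∀ p, p ∉ T → w p = 0) ∧ ∑ p ∈ T, w p = 1 ∧ ∑ p ∈ T, w p • p = x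

open Classical in
/-- The nodal `P1` basis function `ζ_p` of the triangulation `𝒯`: in a triangle that contains `x`,
the barycentric coordinate of `x` that belongs to `p` (zero when `p` is not a vertex). For a
conforming family the triangle chosen does not matter. -/
def hat (𝒯 : Set (Finset Plane)) (p x : Plane) : ℝ :=
  if h : ∃ w : Plane → ℝ, ∃ T ∈ 𝒯, IsBarycentric T x w then h.choose p else 0

/-- `f` is (the restriction of) an affine map on `S`. -/
def IsAffineOn (f : Plane → Plane) (S : Set Plane) : Prop :=
  ∃ (c : Plane) (L : Plane →L[ℝ] Plane), ∀ x ∈ S, f x = c + L x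

/-- `f` is a polynomial of degree at most two on `S`. -/
def IsQuadraticOn {F : Type*} [NormedAddCommGroup F] [NormedSpace ℝ F]
    (f : Plane → F) (S : Set Plane) : Prop :=
  ∃ (c : F) (L : Plane →L[ℝ] F) (B : Plane →L[ℝ] Plane →L[ℝ] F), ∀ x ∈ S, f x = c + L x + B x x

/-! ### The atomistic model -/

/-- The single lattice `A ℤ²`. -/
def homLattice (A : Matrix (Fin 2) (Fin 2) ℝ) : Set Plane :=
  {x | ∃ z : Fin 2 → ℤ, x = WithLp.toLp 2 (A.mulVec fun i => (z i : ℝ))}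

/-- The interaction range `R_ℓ` of a site `ℓ` of the point set `S`. -/
def interactionRange (S : Set Plane) (rcut : ℝ) (ℓ : Plane) : Set Plane :=
  {ρ | 0 < ‖ρ‖ ∧ ‖ρ‖ ≤ rcut ∧ ℓ + ρ ∈ S}

/-- A single lattice with point defects inside the closed ball `B_{R_DEF}`, with an interaction
cut-off radius. -/
structure DefectLattice where
  A : Matrix (Fin 2) (Fin 2) ℝ
  det_ne_zero : A.det ≠ 0
  Λ : Set Plane
  RDEF : ℝ
  RDEF_pos : 0 < RDEF
  finite_core : (Λ ∩ Metric.closedBall 0 RDEF).Finite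
  eq_outside : Λ \ Metric.closedBall 0 RDEF = homLattice A \ Metric.closedBall 0 RDEF
  rcut : ℝ
  rcut_pos : 0 < rcut

theorem homLattice_finite {A : Matrix (Fin 2) (Fin 2) ℝ} (hA : A.det ≠ 0) (r : ℝ) :
    (homLattice A ∩ Metric.closedBall 0 r).Finite := by
  let f : Plane →ₗ[ℝ] (Fin 2 → ℝ) :=
    (Matrix.mulVecLin A⁻¹) ∘ₗ (WithLp.linearEquiv 2 ℝ (Fin 2 → ℝ)).toLinearMap
  have hf : Continuous f := f.continuous_of_finiteDimensional
  have hK : IsCompact (f '' Metric.closedBall 0 r) := (isCompact_closedBall 0 r).image hf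
  obtain ⟨b, hb⟩ := hK.isBounded.subset_closedBall 0
  let S : Set (Fin 2 → ℤ) := Set.pi Set.univ fun _ => Set.Icc (-⌈b⌉) ⌈b⌉
  have hS : S.Finite := Set.Finite.pi fun _ => Set.finite_Icc _ _
  refine (hS.image fun z => WithLp.toLp 2 (A.mulVec fun i => (z i : ℝ))).subset ?_
  rintro x ⟨⟨z, rfl⟩, hx⟩
  refine ⟨z, fun i _ => ?_, rfl⟩
  have h1 := hb ⟨_, hx, rfl⟩
  have h2 : f (WithLp.toLp 2 (A.mulVec fun i => (z i : ℝ))) = fun i => (z i : ℝ) := by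
    have hu : IsUnit A.det := isUnit_iff_ne_zero.mpr hA
    change A⁻¹.mulVec (A.mulVec fun i => (z i : ℝ)) = _
    rw [Matrix.mulVec_mulVec, Matrix.nonsing_inv_mul A hu, Matrix.one_mulVec]
  rw [h2, mem_closedBall_zero_iff] at h1
  have h3 := (norm_le_pi_norm (fun i => (z i : ℝ)) i).trans h1
  rw [Real.norm_eq_abs, abs_le] at h3
  have h4 : (b : ℝ) ≤ ⌈b⌉ := Int.le_ceil b
  constructor
  · have : (-(⌈b⌉ : ℝ)) ≤ z i := by linarith
    exact_mod_cast this
  · have : (z i : ℝ) ≤ ⌈b⌉ := by linarith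
    exact_mod_cast this

theorem DefectLattice.locally_finite (L : DefectLattice) (r : ℝ) :
    (L.Λ ∩ Metric.closedBall 0 r).Finite := by
  refine (L.finite_core.union (homLattice_finite L.det_ne_zero r)).subset ?_
  rintro x ⟨hx, hr⟩
  by_cases h : x ∈ Metric.closedBall (0 : Plane) L.RDEF
  · exact Or.inl ⟨hx, h⟩
  · have : x ∈ L.Λ \ Metric.closedBall 0 L.RDEF := ⟨hx, h⟩
    rw [L.eq_outside] at this
    exact Or.inr ⟨this.1, hr⟩

theorem DefectLattice.range_finite (L : DefectLattice) (ℓ : Plane) :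
    (interactionRange L.Λ L.rcut ℓ).Finite := by
  have h := (L.locally_finite (‖ℓ‖ + L.rcut)).image (fun x => x - ℓ)
  refine h.subset ?_
  rintro ρ ⟨-, h2, h3⟩
  refine ⟨ℓ + ρ, ⟨h3, ?_⟩, by simp⟩
  rw [mem_closedBall_zero_iff]
  exact (norm_add_le _ _).trans (by linarith)

instance (L : DefectLattice) (ℓ : Plane) : Fintype (interactionRange L.Λ L.rcut ℓ) :=
  (L.range_finite ℓ).fintype

/-- The stencil `Du(ℓ) = (u(ℓ + ρ) - u(ℓ))_{ρ ∈ R_ℓ}`. -/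
def DefectLattice.stencil (L : DefectLattice) (u : L.Λ → Plane) (ℓ : L.Λ) :
    interactionRange L.Λ L.rcut ℓ → Plane :=
  fun ρ => u ⟨(ℓ : Plane) + ρ, ρ.2.2.2⟩ - u ℓ

/-- The displacement that moves the atom `ℓ` by the unit vector `e_i` and no other atom. -/
def DefectLattice.unitDisp (L : DefectLattice) (ℓ : L.Λ) (i : Fin 2) : L.Λ → Plane :=
  open Classical in Pi.single ℓ (EuclideanSpace.single i 1)

/-- Atomistic model: a defective lattice, twice continuously differentiable site potentials with
`V_ℓ(0) = 0` that agree with one homogeneous potential `Vhom` away from the defect core, and the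
background mesh, a triangulation of the plane whose nodes are exactly the atoms and whose
triangles have bounded diameters. -/
structure AtomisticModel where
  lattice : DefectLattice
  V : ∀ ℓ : lattice.Λ, (interactionRange lattice.Λ lattice.rcut ℓ → Plane) → ℝ
  V_contDiff : ∀ ℓ, ContDiff ℝ 2 (V ℓ)
  V_zero : ∀ ℓ, V ℓ 0 = 0
  Vhom : (interactionRange (homLattice lattice.A) lattice.rcut 0 → Plane) → ℝ
  /-- Here `R_ℓ` is the interaction range of the perfect lattice; stencils are written as
  restrictions of functions `g` on the plane. -/
  V_hom : ∀ ℓ : lattice.Λ, lattice.RDEF + lattice.rcut < ‖(ℓ : Plane)‖ → ∀ g : Plane → Plane,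
    V ℓ (fun ρ => g ρ) = Vhom (fun ρ => g ρ)
  mesh : Set (Finset Plane)
  mesh_triangulation : IsTriangulation mesh
  mesh_cover : ∀ x : Plane, ∃ T ∈ mesh, x ∈ hull T
  mesh_vertices : ∀ T ∈ mesh, ∀ p ∈ T, p ∈ lattice.Λ
  mesh_nodes : ∀ T ∈ mesh, ∀ p ∈ lattice.Λ, p ∈ hull T → p ∈ T
  mesh_diam : ∃ h : ℝ, ∀ T ∈ mesh, Metric.diam (hull T) ≤ h

/-- The set of atoms. -/
abbrev AtomisticModel.Λ (M : AtomisticModel) : Set Plane := M.lattice.Λ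

namespace AtomisticModel

variable (M : AtomisticModel)

/-- The nodal interpolant `I_a u` on the background mesh. -/
def interp (u : M.Λ → Plane) (x : Plane) : Plane :=
  ∑ᶠ ℓ : M.Λ, hat M.mesh ℓ x • u ℓ

/-- Membership in `U^{1,2}`, that is `‖∇ I_a u‖_{L²(ℝ²)} < ∞`. -/
def IsFiniteEnergy (u : M.Λ → Plane) : Prop :=
  MeasureTheory.Integrable (gradInner (M.interp u) (M.interp u))

/-- `‖u‖_{U^{1,2}} = ‖∇ I_a u‖_{L²(ℝ²)}`. -/
def norm12 (u : M.Λ → Plane) : ℝ := gradL2 Set.univ (M.interp u)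

/-- The force on the atom `ℓ` (derivative of the energy with respect to `u(ℓ)`) in the reference
configuration `u = 0`. It vanishes away from the defect core. -/
def refForce (ℓ : M.Λ) : Plane :=
  WithLp.toLp 2 fun i => ∑ᶠ k : M.Λ, fderiv ℝ (M.V k) 0 (M.lattice.stencil (M.lattice.unitDisp ℓ i) k)

/-- The atomistic energy difference `∑_ℓ V_ℓ(Du(ℓ))` on `U^{1,2}`. The plain series need not
converge there, so its first order part `∑_ℓ ⟨δV_ℓ(0), Du(ℓ)⟩` is summed by parts into the finite
sum `∑_ℓ F_ℓ(0) · u(ℓ)`; the remaining series converges absolutely. This is the continuous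
extension to `U^{1,2}` of the plain sum, see the helper fact
that follows. -/
def energy (u : M.Λ → Plane) : ℝ :=
  (∑' ℓ : M.Λ, (M.V ℓ (M.lattice.stencil u ℓ) - fderiv ℝ (M.V ℓ) 0 (M.lattice.stencil u ℓ)))
    + ∑ᶠ ℓ : M.Λ, ⟪M.refForce ℓ, u ℓ⟫

theorem stencil_zero_off (u : M.Λ → Plane) (hu : u.support.Finite) :
    {k : M.Λ | M.lattice.stencil u k ≠ 0}.Finite := by
  have hfin : ∀ k : M.Λ, {j : M.Λ | (j : Plane) = k ∨
      ((k : Plane) - j) ∈ Metric.closedBall (0 : Plane) M.lattice.rcut}.Finite := by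
    intro k
    have h := M.lattice.locally_finite (‖(k : Plane)‖ + M.lattice.rcut)
    have h' := h.preimage (f := (Subtype.val : M.Λ → Plane)) Subtype.val_injective.injOn
    refine h'.subset ?_
    rintro j (hj | hj)
    · refine ⟨j.2, ?_⟩
      rw [mem_closedBall_zero_iff, hj]
      linarith [M.lattice.rcut_pos]
    · refine ⟨j.2, ?_⟩
      rw [mem_closedBall_zero_iff] at hj ⊢
      have := norm_sub_le (k : Plane) ((k : Plane) - j)
      rw [sub_sub_cancel] at this
      linarith
  refine (hu.biUnion fun k _ => hfin k).subset ?_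
  intro j hj
  obtain ⟨ρ, hρ⟩ := Function.ne_iff.mp hj
  simp only [Set.mem_iUnion, exists_prop, Function.mem_support]
  by_cases h0 : u j = 0
  · refine ⟨⟨(j : Plane) + ρ, ρ.2.2.2⟩, ?_, Or.inr ?_⟩
    · intro h
      exact hρ (by simp [DefectLattice.stencil, h0, h])
    · simpa using ρ.2.2.1
  · exact ⟨j, h0, Or.inl rfl⟩

/-- For displacements that vanish outside a finite set the energy is the sum of the site
potentials. -/
theorem energy_eq_finsum (u : M.Λ → Plane) (hu : u.support.Finite) :
    M.energy u = ∑ᶠ ℓ : M.Λ, M.V ℓ (M.lattice.stencil u ℓ) := by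
  classical
  have hdec : u = ∑ ℓ ∈ hu.toFinset, ∑ i : Fin 2, u ℓ i • M.lattice.unitDisp ℓ i := by
    funext k
    rw [Finset.sum_apply]
    simp only [Finset.sum_apply, Pi.smul_apply, DefectLattice.unitDisp]
    by_cases hk : u k = 0
    · rw [hk]
      symm
      refine Finset.sum_eq_zero fun ℓ hℓ => ?_
      have : k ≠ ℓ := by
        rintro rfl
        exact (by simpa using hℓ : u k ≠ 0) hk
      simp [Pi.single_eq_of_ne this]
    · rw [Finset.sum_eq_single k]
      · ext j
        fin_cases j <;> simp [Fin.sum_univ_two]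
      · intro ℓ _ h
        simp [Pi.single_eq_of_ne h.symm]
      · intro h
        exact absurd (by simpa using hk) h
  have hst : ∀ k, M.lattice.stencil u k =
      ∑ ℓ ∈ hu.toFinset, ∑ i : Fin 2, u ℓ i • M.lattice.stencil (M.lattice.unitDisp ℓ i) k := by
    intro k
    funext ρ
    have h1 := congrFun hdec ⟨(k : Plane) + ρ, ρ.2.2.2⟩
    have h2 := congrFun hdec k
    simp only [Finset.sum_apply, Pi.smul_apply] at h1 h2
    simp only [Finset.sum_apply, Pi.smul_apply, DefectLattice.stencil, smul_sub,
      Finset.sum_sub_distrib]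
    exact congrArg₂ (· - ·) h1 h2
  have hunit : ∀ ℓ i, (M.lattice.unitDisp ℓ i).support.Finite := by
    intro ℓ i
    refine (Set.finite_singleton ℓ).subset ?_
    intro k hk
    by_contra h
    exact hk (by simp [DefectLattice.unitDisp, Pi.single_eq_of_ne h])
  have hlin : ∑ᶠ k : M.Λ, fderiv ℝ (M.V k) 0 (M.lattice.stencil u k)
      = ∑ᶠ ℓ : M.Λ, ⟪M.refForce ℓ, u ℓ⟫ := by
    have e1 : ∀ k, fderiv ℝ (M.V k) 0 (M.lattice.stencil u k) = ∑ ℓ ∈ hu.toFinset, ∑ i : Fin 2,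
        u ℓ i * fderiv ℝ (M.V k) 0 (M.lattice.stencil (M.lattice.unitDisp ℓ i) k) := by
      intro k
      rw [hst k]
      simp [map_sum]
    have hsup : ∀ ℓ i, (Function.support fun k : M.Λ =>
        u ℓ i * fderiv ℝ (M.V k) 0 (M.lattice.stencil (M.lattice.unitDisp ℓ i) k)).Finite := by
      intro ℓ i
      refine (M.stencil_zero_off _ (hunit ℓ i)).subset ?_
      intro k hk h
      exact hk (by simp [h])
    rw [finsum_congr e1, finsum_sum_comm _ _ (fun ℓ _ => ?_)]
    · rw [finsum_eq_sum_of_support_subset (s := hu.toFinset)]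
      · refine Finset.sum_congr rfl fun ℓ _ => ?_
        rw [finsum_sum_comm _ _ (fun i _ => hsup ℓ i)]
        simp only [PiLp.inner_apply, refForce]
        refine Finset.sum_congr rfl fun i _ => ?_
        rw [← mul_finsum']
        · simp
        · refine (M.stencil_zero_off _ (hunit ℓ i)).subset ?_
          intro k hk h
          exact hk (by simp [h])
      · intro ℓ hℓ
        rw [Finset.mem_coe, Set.Finite.mem_toFinset]
        intro h
        exact hℓ (by simp [h])
    · exact (Set.finite_iUnion fun i => hsup ℓ i).subset (by
        intro k hk
        by_contra h
        simp only [Set.mem_iUnion, Function.mem_support, not_exists, not_not] at h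
        exact hk (Finset.sum_eq_zero fun i _ => h i))
  have hS := M.stencil_zero_off u hu
  have h1 : (Function.support fun k => M.V k (M.lattice.stencil u k)).Finite :=
    hS.subset fun k hk h => hk (by simp [h, M.V_zero])
  have h2 : (Function.support fun k => fderiv ℝ (M.V k) 0 (M.lattice.stencil u k)).Finite :=
    hS.subset fun k hk h => hk (by simp [h])
  rw [energy, tsum_eq_finsum, finsum_sub_distrib h1 h2, hlin, sub_add_cancel]
  exact hS.subset fun k hk h => hk (by simp [h, M.V_zero])

/-- The residual `R(u)[v] = ⟨δE(u), v⟩`. -/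
def residual (u v : M.Λ → Plane) : ℝ := firstVariation M.energy u v

/-- The dual norm `‖R(u)‖_{(U^{1,2})*}`. -/
def residualNorm (u : M.Λ → Plane) : ℝ≥0∞ :=
  ⨆ (v : M.Λ → Plane) (_ : M.IsFiniteEnergy v) (_ : M.norm12 v ≤ 1), ENNReal.ofReal |M.residual u v|

/-- The residual force `F_ℓ(u) = ∂E/∂u(ℓ)`. -/
def force (u : M.Λ → Plane) (ℓ : M.Λ) : Plane :=
  WithLp.toLp 2 fun i => firstVariation M.energy u (M.lattice.unitDisp ℓ i)

/-- The rescaled piecewise affine interpolant of the residual forces,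
`∑_ℓ c_ℓ F_ℓ(u) ζ_ℓ` with `c_ℓ = 1 / ∫ ζ_ℓ`. -/
def forceInterp (u : M.Λ → Plane) (x : Plane) : Plane :=
  ∑ᶠ ℓ : M.Λ, (hat M.mesh ℓ x * (∫ y, hat M.mesh ℓ y)⁻¹) • M.force u ℓ

/-- A strongly stable solution of the atomistic problem: a local minimizer of the energy in
`U^{1,2}` at which the second variation is coercive. -/
structure IsStronglyStable (u : M.Λ → Plane) : Prop where
  finite_energy : M.IsFiniteEnergy u
  local_min : ∃ ε > 0, ∀ w, M.IsFiniteEnergy w → M.norm12 (w - u) < ε → M.energy u ≤ M.energy w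
  stable : ∃ γ > 0, ∀ v, M.IsFiniteEnergy v →
    γ * M.norm12 v ^ 2 ≤ secondVariation M.energy u v v

/-- The atomistic displacement (nodal values of `I_a f`) of a displacement field of the plane. -/
def nodal (f : Plane → Plane) : M.Λ → Plane := fun ℓ => f ℓ

/-- The Cauchy-Born energy density `W(F) = V(F R) / |det A|`. -/
def cauchyBorn (F : Plane →L[ℝ] Plane) : ℝ := |M.lattice.A.det|⁻¹ * M.Vhom (fun ρ => F ρ)

/-- The renormalized site potential `V''_ℓ`. -/
def V2 (ℓ : M.Λ) (g : interactionRange M.Λ M.lattice.rcut ℓ → Plane) : ℝ :=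
  M.V ℓ g - fderiv ℝ (M.V ℓ) 0 g

/-- The renormalized Cauchy-Born density `W''`. -/
def cauchyBorn2 (F : Plane →L[ℝ] Plane) : ℝ :=
  M.cauchyBorn F - fderiv ℝ M.cauchyBorn 0 F

end AtomisticModel

/-! ### Blended atomistic-to-continuum methods -/

/-- Finite element order in the continuum region. -/
inductive FEOrder
  | p1
  | p2

/-- The five blended methods: BQCE, P1/P2-BQCF and P1/P2-BGFC. -/
inductive BlendedMethod
  | bqce
  | bqcf (k : FEOrder)
  | bgfc (k : FEOrder)

/-- The approximation parameters. -/
structure Discretization (M : AtomisticModel) where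
  /-- `R_Ω`, the radius of the computational domain. -/
  R : ℝ
  R_pos : 0 < R
  /-- The triangles of the background mesh that make up the computational domain. -/
  TΩ : Finset (Finset Plane)
  TΩ_subset : ∀ T ∈ TΩ, T ∈ M.mesh
  ball_subset : Metric.closedBall 0 R ⊆ interior (⋃ T ∈ TΩ, hull T)
  subset_ball : interior (⋃ T ∈ TΩ, hull T) ⊆ Metric.closedBall 0 (2 * R)
  /-- Atomistic, blending and continuum regions. -/
  Ωa : Set Plane
  Ωb : Set Plane
  Ωc : Set Plane
  decomposition : Ωa ∪ Ωb ∪ Ωc = interior (⋃ T ∈ TΩ, hull T)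
  /-- The blending function, of class `C^{2,1}`. -/
  β : Plane → ℝ
  β_contDiff : ContDiff ℝ 2 β
  β_lipschitz : ∃ K, LipschitzWith K (fun x => iteratedFDeriv ℝ 2 β x)
  β_atomistic : ∀ x ∈ Ωa, β x = 0
  β_continuum : ∀ x ∈ Ωc, β x = 1
  β_support : tsupport (fderiv ℝ β) ⊆ Ωb
  /-- The finite element mesh. It contains the background mesh induced by the core and blended
  atoms. -/
  Th : Finset (Finset Plane)
  Th_triangulation : IsTriangulation (Th : Set (Finset Plane))
  Th_refined : ∀ T ∈ M.mesh, (∀ p ∈ T, p ∈ Ωa ∪ Ωb) → T ∈ Th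
  Th_domain : (⋃ T ∈ Th, hull T) ⊆ closure (interior (⋃ T ∈ TΩ, hull T))
  /-- The quadrature rule of the P2 methods: weights at finitely many points of each triangle,
  exact for polynomials of degree two (for instance the edge midpoint rule). -/
  quad2 : Finset Plane → (Plane →₀ ℝ)
  quad2_support : ∀ T ∈ Th, ∀ x ∈ (quad2 T).support, x ∈ hull T
  quad2_exact : ∀ T ∈ Th, ∀ q : Plane → ℝ, IsQuadraticOn q Set.univ →
    ∫ x in hull T, q x = (quad2 T).sum fun x ω => ω * q x

namespace Discretization

variable {M : AtomisticModel} (D : Discretization M)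

/-- The computational domain. -/
def Ω : Set Plane := interior (⋃ T ∈ D.TΩ, hull T)

/-- The meshed domain `Ω_h`. -/
def Ωh : Set Plane := ⋃ T ∈ D.Th, hull T

/-- Number of nodes of the finite element mesh. -/
def dof : ℕ := open Classical in (D.Th.biUnion id).card

/-- The spaces of coarse-grained displacements; P2 elements are used where `β = 1` on the whole
element, P1 elements elsewhere. -/
def space : FEOrder → Set (Plane → Plane)
  | .p1 => {u | Continuous u ∧ (∀ T ∈ D.Th, IsAffineOn u (hull T)) ∧ ∀ x, x ∉ D.Ωh → u x = 0}
  | .p2 => {u | Continuous u ∧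
      (∀ T ∈ D.Th, (∃ x ∈ hull T, D.β x < 1) → IsAffineOn u (hull T)) ∧
      (∀ T ∈ D.Th, (¬ ∃ x ∈ hull T, D.β x < 1) → IsQuadraticOn u (hull T)) ∧
      ∀ x, x ∉ D.Ωh → u x = 0}

/-- Quadrature weights on a triangle: the midpoint rule for the P1 methods. -/
def quad : FEOrder → Finset Plane → (Plane →₀ ℝ)
  | .p1 => fun T => Finsupp.single ((3 : ℝ)⁻¹ • ∑ p ∈ T, p) (MeasureTheory.volume.real (hull T))
  | .p2 => D.quad2

/-- `∫_{Ω_h} Q_h[b(x) w(∇u)] dx`, the gradient being that of the restriction of `u` to the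
respective element. -/
def quadIntegral (k : FEOrder) (b : Plane → ℝ) (w : (Plane →L[ℝ] Plane) → ℝ)
    (u : Plane → Plane) : ℝ :=
  ∑ T ∈ D.Th, (D.quad k T).sum fun x ω => ω * (b x * w (fderivWithin ℝ u (hull T) x))

/-- The pure Cauchy-Born finite element functional. -/
def energyCB (k : FEOrder) (u : Plane → Plane) : ℝ :=
  D.quadIntegral k (fun _ => 1) M.cauchyBorn u

/-- The BQCE energy. -/
def energyBQCE (u : Plane → Plane) : ℝ :=
  (∑ᶠ (ℓ : M.Λ) (_ : (ℓ : Plane) ∈ D.Ωh), (1 - D.β ℓ) * M.V ℓ (M.lattice.stencil (M.nodal u) ℓ))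
    + D.quadIntegral .p1 D.β M.cauchyBorn u

/-- The BGFC energy. -/
def energyBGFC (k : FEOrder) (u : Plane → Plane) : ℝ :=
  (∑ᶠ (ℓ : M.Λ) (_ : (ℓ : Plane) ∈ D.Ωh), (1 - D.β ℓ) * M.V2 ℓ (M.lattice.stencil (M.nodal u) ℓ))
    + D.quadIntegral k D.β M.cauchyBorn2 u

/-- The BQCF operator `⟨F(u), v⟩`. -/
def forceBQCF (k : FEOrder) (u v : Plane → Plane) : ℝ :=
  firstVariation M.energy (M.nodal u) (M.nodal fun x => (1 - D.β x) • v x)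
    + firstVariation (D.energyCB k) u (fun x => D.β x • v x)

/-- Local minimizers of `J` in a finite element space. -/
def IsLocalMinimizer (S : Set (Plane → Plane)) (J : (Plane → Plane) → ℝ) (u : Plane → Plane) :
    Prop :=
  u ∈ S ∧ ∃ ε > 0, ∀ w ∈ S, gradL2 Set.univ (w - u) < ε → J u ≤ J w

/-- `u` is a solution of the given blended method. -/
def IsSolution : BlendedMethod → (Plane → Plane) → Prop
  | .bqce, u => IsLocalMinimizer (D.space .p1) D.energyBQCE u
  | .bqcf k, u => u ∈ D.space k ∧ ∀ v ∈ D.space k, D.forceBQCF k u v = 0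
  | .bgfc k, u => IsLocalMinimizer (D.space k) (D.energyBGFC k) u

/-- The P1 space on the computational domain with zero boundary values, extended by zero. -/
def poissonSpace : Set (Plane → Plane) :=
  {φ | Continuous φ ∧ (∀ T ∈ D.TΩ, IsAffineOn φ (hull T)) ∧ ∀ x, x ∉ D.Ω → φ x = 0}

/-- `φ` is the finite element solution `φ_a(I_a u)` of the truncated Poisson problem. -/
def IsPoissonSolution (u φ : Plane → Plane) : Prop :=
  φ ∈ D.poissonSpace ∧ ∀ v ∈ D.poissonSpace,
    ∫ x in D.Ω, gradInner φ v x = ∫ x in D.Ω, ⟪M.forceInterp (M.nodal u) x, v x⟫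

/-- The error estimator `η = ‖∇φ_a‖_{L²(Ω)}`. -/
def estimator (φ : Plane → Plane) : ℝ := gradL2 D.Ω φ

/-- The truncation indicator `ρ_tr`. -/
def truncation (u φ : Plane → Plane) : ℝ :=
  D.R * normL2 (D.Ω \ Metric.closedBall 0 (D.R / 2)) (M.forceInterp (M.nodal u))
    + gradL2 (D.Ω \ Metric.closedBall 0 (D.R / 2)) φ

/-- The computational domain contains all atoms on which a residual force acts. -/
def CoversForces (u : Plane → Plane) : Prop :=
  ∀ ℓ : M.Λ, (ℓ : Plane) ∉ closure D.Ω → M.force (M.nodal u) ℓ = 0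

end Discretization

/-- Exponents of the number of degrees of freedom in the a priori error bounds, in dimension
`d = 2`: `1/2 - 2/d`, `-1/2 - 1/d` and `-1/2 - 2/d`. -/
def BlendedMethod.rate : BlendedMethod → ℝ
  | .bqce => 1 / 2 - 2 / 2
  | .bqcf .p1 => -1 / 2 - 1 / 2
  | .bqcf .p2 => -1 / 2 - 2 / 2
  | .bgfc .p1 => -1 / 2 - 1 / 2
  | .bgfc .p2 => -1 / 2 - 2 / 2

end BlendedAC

end

/-! ### Bounded partial sums, neighbourhoods of atoms, local difference energies. -/

noncomputable section
namespace BlendedAC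

/-! Write u for the nodal values of u_h, F_p for the forces at u, F̂ for the rescaled force field, R
for the radius R_Ω, and Π for `quasiInterp`, which replaces nodal values by averages against the hat
functions. The scaling of F̂ is such that ∫ F̂ · I_a w = Σ_p F_p · (Πw)_p (`integral_forceInterp`).
As u has finite support, the residual is a finite sum Σ_p F_p · v_p (`exists_residual_eq_sum`).
Hence the residual at Πw is the Dirichlet product of φ_a and I_a w whenever w is supported in Ω.

Lower bound (`exists_estimator_le`). If w consists of the nodal values of φ_a, the residual at Πw
equals η², and Π is bounded in the energy norm.

Upper bound (`exists_residualNorm_le`). The forces add up to zero, so a constant c may be subtracted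
from the test function v. Let χ be a cut-off between radius 3R/4 and R, let w = χ(v - c), and split
v - c = Πw + (w - Πw) + (1 - χ)(v - c). The first piece is a Dirichlet product with φ_a. In the
second, w - Πw is bounded in ℓ² by the energy of w, and the ℓ² norm of the forces is bounded by η
and the outer L² norm of F̂: the Poisson problem is tested with the interior part of the force field
and an inverse estimate is applied (`exists_sum_scaledForce_le`). The third piece lives on atoms
with |p| ≥ 3R/4; there a Poincaré inequality (`exists_poincare`) costs a factor R and the forces are
seen by the L² norm of F̂ outside the ball of radius R/2. This yields the first summand of the
truncation indicator; the second one is not needed.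

Uniform constants. Λ is a lattice outside a ball, so differences of atoms at bounded distance form a
finite set (`DefectLattice.diff_finite`). There are finitely many mesh triangles up to translation
and, away from the core, only one site potential. This gives shape regularity and the equivalence of
the energy norm with sums of squared differences over nearby atoms (`exists_sumLe_locEnergy`,
`exists_norm12_le`), in which most estimates are carried out. The radius R is bounded below because
Ω contains the interior of a mesh triangle.

Part (ii). A strongly stable solution is a critical point. Near it the second variation is bounded
and, by uniform continuity of the Hessians of the site potentials, still coercive. The mean value
theorem on the segment to u makes error and residual norm equivalent once the error is below a
threshold. All rates are at most -1/2, so a large number of degrees of freedom pushes the a priori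
bound below that threshold. The blended methods enter only through the finite support of the nodal
values. -/

/-- The partial sums of a family of real numbers are bounded by `B`. -/
def SumLe {ι : Type*} (a : ι → ℝ) (B : ℝ) : Prop := ∀ s : Finset ι, ∑ i ∈ s, a i ≤ B

theorem SumLe.nonneg {ι : Type*} {a : ι → ℝ} {B : ℝ} (h : SumLe a B) : 0 ≤ B := by
  simpa using h ∅

theorem SumLe.mono {ι : Type*} {a b : ι → ℝ} {A B : ℝ} (h : SumLe a A) (hab : ∀ i, b i ≤ a i)
    (hAB : A ≤ B) : SumLe b B := fun s =>
  (Finset.sum_le_sum fun i _ => hab i).trans ((h s).trans hAB)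

theorem SumLe.add {ι : Type*} {a b : ι → ℝ} {A B : ℝ} (h : SumLe a A) (h' : SumLe b B) :
    SumLe (fun i => a i + b i) (A + B) := fun s => by
  rw [Finset.sum_add_distrib]
  exact add_le_add (h s) (h' s)

theorem SumLe.const_mul {ι : Type*} {a : ι → ℝ} {A c : ℝ} (h : SumLe a A) (hc : 0 ≤ c) :
    SumLe (fun i => c * a i) (c * A) := fun s => by
  rw [← Finset.mul_sum]
  exact mul_le_mul_of_nonneg_left (h s) hc

theorem SumLe.summable {ι : Type*} {a : ι → ℝ} {A : ℝ} (h : SumLe a A) (ha : ∀ i, 0 ≤ a i) :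
    Summable a := summable_of_sum_le ha h

theorem SumLe.apply_le {ι : Type*} {a : ι → ℝ} {A : ℝ} (h : SumLe a A) (i : ι) : a i ≤ A := by
  simpa using h {i}

/-- Cauchy–Schwarz, arranged so that bounds on sums of squares can be inserted directly. -/
theorem sum_mul_le_of_sq {ι : Type*} (s : Finset ι) (f g : ι → ℝ) {A B : ℝ}
    (hA : 0 ≤ A) (hB : 0 ≤ B)
    (hf : ∑ i ∈ s, f i ^ 2 ≤ A ^ 2) (hg : ∑ i ∈ s, g i ^ 2 ≤ B ^ 2) :
    ∑ i ∈ s, f i * g i ≤ A * B := by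
  refine (abs_le_of_sq_le_sq' ?_ (by positivity)).2
  rw [mul_pow]
  exact (Finset.sum_mul_sq_le_sq_mul_sq s f g).trans
    (mul_le_mul hf hg (Finset.sum_nonneg fun i _ => sq_nonneg _) (by positivity))

/-- Uniform choice of a small parameter over a finite set. -/
theorem exists_pos_forall_mem_of_finite {α : Type*} {s : Set α} (hs : s.Finite)
    {P : α → ℝ → Prop} (hP : ∀ a ∈ s, ∃ r > 0, P a r)
    (hmono : ∀ a r r', 0 < r' → r' ≤ r → P a r → P a r') : ∃ r > 0, ∀ a ∈ s, P a r := by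
  have : ∀ᶠ r in nhdsWithin (0 : ℝ) (Set.Ioi 0), ∀ a ∈ s, P a r := by
    rw [Filter.eventually_all_finite hs]
    intro a ha
    obtain ⟨r, hr, h⟩ := hP a ha
    filter_upwards [Ioc_mem_nhdsGT hr] with r' hr'
    exact hmono a r r' hr'.1 hr'.2 h
  obtain ⟨r, h1, h2⟩ := (this.and self_mem_nhdsWithin).exists
  exact ⟨r, h2, h1⟩

/-- Uniform choice of a large constant over a finite set. -/
theorem exists_forall_mem_of_finite {α : Type*} {s : Set α} (hs : s.Finite)
    {P : α → ℝ → Prop} (hP : ∀ a ∈ s, ∃ C, P a C)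
    (hmono : ∀ a C C', C ≤ C' → P a C → P a C') : ∃ C > 0, ∀ a ∈ s, P a C := by
  have : ∀ᶠ C in Filter.atTop, ∀ a ∈ s, P a C := by
    rw [Filter.eventually_all_finite hs]
    intro a ha
    obtain ⟨C, h⟩ := hP a ha
    filter_upwards [Filter.eventually_ge_atTop C] with C' hC'
    exact hmono a C C' hC' h
  obtain ⟨C, h1, h2⟩ := (this.and (Filter.eventually_gt_atTop 0)).exists
  exact ⟨C, h2, h1⟩

theorem homLattice_sub {A : Matrix (Fin 2) (Fin 2) ℝ} {x y : Plane} (hx : x ∈ homLattice A)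
    (hy : y ∈ homLattice A) : x - y ∈ homLattice A := by
  obtain ⟨z, rfl⟩ := hx
  obtain ⟨z', rfl⟩ := hy
  refine ⟨z - z', ?_⟩
  rw [← WithLp.toLp_sub, ← Matrix.mulVec_sub]
  congr 2
  funext i
  simp

theorem homLattice_zero (A : Matrix (Fin 2) (Fin 2) ℝ) : (0 : Plane) ∈ homLattice A :=
  ⟨0, by ext i; simp [Matrix.mulVec, dotProduct]⟩

theorem homLattice_neg {A : Matrix (Fin 2) (Fin 2) ℝ} {x : Plane} (hx : x ∈ homLattice A) :
    -x ∈ homLattice A := by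
  simpa using homLattice_sub (homLattice_zero A) hx

theorem homLattice_add {A : Matrix (Fin 2) (Fin 2) ℝ} {x y : Plane} (hx : x ∈ homLattice A)
    (hy : y ∈ homLattice A) : x + y ∈ homLattice A := by
  simpa using homLattice_sub hx (homLattice_neg hy)

theorem DefectLattice.mem_iff_of_lt (L : DefectLattice) {x : Plane} (hx : L.RDEF < ‖x‖) :
    x ∈ L.Λ ↔ x ∈ homLattice L.A := by
  have h : x ∉ Metric.closedBall (0 : Plane) L.RDEF := by
    rw [mem_closedBall_zero_iff]; linarith
  have := Set.ext_iff.mp L.eq_outside x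
  simpa [h] using this

/-- Two atoms outside the core differ by a lattice vector. If one of them is in the core, both lie
in a fixed ball, which holds finitely many atoms. This is the source of uniformity over the mesh. -/
theorem DefectLattice.diff_finite (L : DefectLattice) (r : ℝ) :
    {d : Plane | ‖d‖ ≤ r ∧ ∃ p ∈ L.Λ, ∃ q ∈ L.Λ, d = q - p}.Finite := by
  have h1 := homLattice_finite L.det_ne_zero r
  have h2 := (L.locally_finite (L.RDEF + |r|)).image2 (fun p q => q - p)
    (L.locally_finite (L.RDEF + |r|))
  refine (h1.union h2).subset ?_
  rintro d ⟨hd, p, hp, q, hq, rfl⟩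
  have habs := le_abs_self r
  by_cases hpp : L.RDEF < ‖p‖
  · by_cases hqq : L.RDEF < ‖q‖
    · left
      refine ⟨homLattice_sub ((L.mem_iff_of_lt hqq).1 hq) ((L.mem_iff_of_lt hpp).1 hp), ?_⟩
      simpa using hd
    · right
      refine ⟨p, ⟨hp, ?_⟩, q, ⟨hq, ?_⟩, rfl⟩
      · rw [mem_closedBall_zero_iff]
        have := norm_sub_le q (q - p)
        rw [sub_sub_cancel] at this
        linarith
      · rw [mem_closedBall_zero_iff]
        linarith [abs_nonneg r]
  · right
    refine ⟨p, ⟨hp, ?_⟩, q, ⟨hq, ?_⟩, rfl⟩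
    · rw [mem_closedBall_zero_iff]
      linarith [abs_nonneg r]
    · rw [mem_closedBall_zero_iff]
      have := norm_add_le p (q - p)
      rw [add_sub_cancel] at this
      linarith

namespace AtomisticModel
variable (M : AtomisticModel)

theorem nb_finite (r : ℝ) (p : Plane) : {q : M.Λ | dist p q ≤ r}.Finite := by
  refine ((M.lattice.locally_finite (‖p‖ + r)).preimage
    (f := (Subtype.val : M.Λ → Plane)) Subtype.val_injective.injOn).subset ?_
  intro q hq
  refine ⟨q.2, ?_⟩
  rw [mem_closedBall_zero_iff]
  have h1 : dist p q ≤ r := hq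
  rw [dist_eq_norm] at h1
  have := norm_sub_le p (p - q)
  rw [sub_sub_cancel] at this
  linarith

/-- The atoms at distance at most `r` from `p`. -/
def nb (r : ℝ) (p : Plane) : Finset M.Λ := (M.nb_finite r p).toFinset

variable {M}

@[simp] theorem mem_nb {r : ℝ} {p : Plane} {q : M.Λ} : q ∈ M.nb r p ↔ dist p q ≤ r := by
  simp [nb]

theorem mem_nb_comm {r : ℝ} {p q : M.Λ} : q ∈ M.nb r p ↔ p ∈ M.nb r q := by
  simp [dist_comm]

variable (M)

/-- Subtracting one atom of the ball maps all of them injectively into the finite set of differences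
of length at most 2r, which does not depend on the centre. -/
theorem card_nb_le (r : ℝ) : ∃ N : ℕ, ∀ x : Plane, (M.nb r x).card ≤ N := by
  classical
  refine ⟨(M.lattice.diff_finite (2 * r)).toFinset.card, fun x => ?_⟩
  rcases (M.nb r x).eq_empty_or_nonempty with h | ⟨p, hp⟩
  · simp [h]
  · refine Finset.card_le_card_of_injOn (fun q => (q : Plane) - p) ?_ ?_
    · intro q hq
      rw [Finset.mem_coe, mem_nb] at hq
      rw [mem_nb] at hp
      rw [Finset.mem_coe, Set.Finite.mem_toFinset]
      refine ⟨?_, p, p.2, q, q.2, rfl⟩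
      rw [← dist_eq_norm]
      linarith [dist_triangle_left (q : Plane) p x]
    · intro q _ q' _ h
      exact Subtype.ext (sub_left_injective h)

/-- Bounded overlap: after exchanging the sums, each atom is counted once for every neighbourhood
that contains it, hence a bounded number of times. -/
theorem sumLe_nb (r : ℝ) : ∃ C > 0, ∀ (a : M.Λ → ℝ) (B : ℝ), (∀ p, 0 ≤ a p) → SumLe a B →
    SumLe (fun p : M.Λ => ∑ q ∈ M.nb r p, a q) (C * B) := by
  classical
  obtain ⟨N, hN⟩ := M.card_nb_le r
  refine ⟨N + 1, by positivity, fun a B ha h s => ?_⟩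
  have h1 : ∑ p ∈ s, ∑ q ∈ M.nb r p, a q
      = ∑ q ∈ s.biUnion (fun p : M.Λ => M.nb r p), ∑ _p ∈ s.filter (fun p : M.Λ => q ∈ M.nb r p), a q := by
    refine Finset.sum_comm' ?_
    intro p q
    simp only [Finset.mem_biUnion, Finset.mem_filter]
    tauto
  rw [h1]
  calc _ ≤ ∑ q ∈ s.biUnion (fun p : M.Λ => M.nb r p), ((N : ℝ) + 1) * a q := by
        refine Finset.sum_le_sum fun q _ => ?_
        rw [Finset.sum_const, nsmul_eq_mul]
        refine mul_le_mul_of_nonneg_right ?_ (ha q)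
        have : (s.filter fun p : M.Λ => q ∈ M.nb r p).card ≤ N := by
          refine (Finset.card_le_card ?_).trans (hN q)
          intro p hp
          exact mem_nb_comm.1 (Finset.mem_filter.1 hp).2
        have : ((s.filter fun p : M.Λ => q ∈ M.nb r p).card : ℝ) ≤ N := by exact_mod_cast this
        linarith
    _ ≤ _ := by
        rw [← Finset.mul_sum]
        exact mul_le_mul_of_nonneg_left (h _) (by positivity)

/-- The sum of the squared differences of `u` between `p` and the atoms within distance `r`. -/
def locEnergy (r : ℝ) (u : M.Λ → Plane) (p : M.Λ) : ℝ := ∑ q ∈ M.nb r p, ‖u q - u p‖ ^ 2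

variable {M}

theorem locEnergy_nonneg (r : ℝ) (u : M.Λ → Plane) (p : M.Λ) : 0 ≤ M.locEnergy r u p :=
  Finset.sum_nonneg fun _ _ => sq_nonneg _

theorem sq_le_locEnergy {r : ℝ} (u : M.Λ → Plane) {p q : M.Λ} (h : dist (p : Plane) q ≤ r) :
    ‖u q - u p‖ ^ 2 ≤ M.locEnergy r u p :=
  Finset.single_le_sum (f := fun q => ‖u q - u p‖ ^ 2) (fun _ _ => sq_nonneg _) (mem_nb.2 h)

theorem norm_add_sq_le {E : Type*} [SeminormedAddCommGroup E] (a b : E) :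
    ‖a + b‖ ^ 2 ≤ 2 * ‖a‖ ^ 2 + 2 * ‖b‖ ^ 2 := by
  have := norm_add_le a b
  nlinarith [sq_nonneg (‖a‖ - ‖b‖), norm_nonneg a, norm_nonneg b, norm_nonneg (a + b)]

theorem sumLe_locEnergy_add {r A B : ℝ} {u v : M.Λ → Plane} (hu : SumLe (M.locEnergy r u) A)
    (hv : SumLe (M.locEnergy r v) B) : SumLe (M.locEnergy r (u + v)) (2 * A + 2 * B) := by
  refine ((hu.const_mul zero_le_two).add (hv.const_mul zero_le_two)).mono (fun p => ?_) le_rfl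
  simp only [locEnergy, Finset.mul_sum, ← Finset.sum_add_distrib]
  refine Finset.sum_le_sum fun q _ => ?_
  rw [show (u + v) q - (u + v) p = (u q - u p) + (v q - v p) by simp; abel]
  exact norm_add_sq_le _ _

theorem locEnergy_smul (r t : ℝ) (u : M.Λ → Plane) (p : M.Λ) :
    M.locEnergy r (t • u) p = t ^ 2 * M.locEnergy r u p := by
  simp only [locEnergy, Finset.mul_sum, Pi.smul_apply, ← smul_sub, norm_smul, mul_pow,
    Real.norm_eq_abs, sq_abs]

end AtomisticModel
end BlendedAC
end

/-! ### Barycentric coordinates, hat functions and the nodal interpolant. -/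

noncomputable section
namespace BlendedAC

theorem IsBarycentric.unique {T : Finset Plane}
    (hT : AffineIndependent ℝ (fun p : T => (p : Plane))) {x : Plane} {w w' : Plane → ℝ}
    (h : IsBarycentric T x w) (h' : IsBarycentric T x w') : w = w' := by
  funext p
  by_cases hp : p ∈ T
  · have := (affineIndependent_iff.1 hT) T.attach (fun i => w i - w' i) ?_ ?_ ⟨p, hp⟩
      (Finset.mem_attach _ _)
    · linarith
    · rw [Finset.sum_attach T fun i => w i - w' i, Finset.sum_sub_distrib, h.2.2.1, h'.2.2.1,
        sub_self]
    · rw [Finset.sum_attach T fun i => (w i - w' i) • i]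
      simp only [sub_smul]
      rw [Finset.sum_sub_distrib, h.2.2.2, h'.2.2.2, sub_self]
  · rw [h.2.1 p hp, h'.2.1 p hp]

theorem IsBarycentric.mem_hull {T : Finset Plane} {x : Plane} {w : Plane → ℝ}
    (h : IsBarycentric T x w) : x ∈ hull T := by
  rw [hull, Finset.mem_convexHull']
  exact ⟨w, fun y _ => h.1 y, h.2.2.1, h.2.2.2⟩

theorem exists_isBarycentric {T : Finset Plane} {x : Plane} (h : x ∈ hull T) :
    ∃ w, IsBarycentric T x w := by
  classical
  rw [hull, Finset.mem_convexHull'] at h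
  obtain ⟨w, h1, h2, h3⟩ := h
  refine ⟨fun p => if p ∈ T then w p else 0, fun p => ?_, fun p hp => ?_, ?_, ?_⟩
  · by_cases hp : p ∈ T <;> simp [hp, h1 p]
  · simp [hp]
  · rw [← h2]
    exact Finset.sum_congr rfl fun p hp => by simp [hp]
  · rw [← h3]
    exact Finset.sum_congr rfl fun p hp => by simp [hp]

theorem IsBarycentric.mono {S T : Finset Plane} (hST : S ⊆ T) {x : Plane} {w : Plane → ℝ}
    (h : IsBarycentric S x w) : IsBarycentric T x w := by
  refine ⟨h.1, fun p hp => h.2.1 p fun h' => hp (hST h'), ?_, ?_⟩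
  · rw [← h.2.2.1]
    exact (Finset.sum_subset hST fun p _ hp => h.2.1 p hp).symm
  · rw [← h.2.2.2]
    exact (Finset.sum_subset hST fun p _ hp => by rw [h.2.1 p hp, zero_smul]).symm

/-- Conformity puts a common point into the hull of the common vertices; barycentric coordinates
with respect to these serve both triangles. -/
theorem IsTriangulation.exists_common {𝒯 : Set (Finset Plane)} (h𝒯 : IsTriangulation 𝒯)
    {T T' : Finset Plane} (hT : T ∈ 𝒯) (hT' : T' ∈ 𝒯) {x : Plane} (hx : x ∈ hull T)
    (hx' : x ∈ hull T') :
    ∃ w, IsBarycentric T x w ∧ IsBarycentric T' x w ∧ ∀ p, w p ≠ 0 → p ∈ T ∧ p ∈ T' := by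
  classical
  have h := h𝒯.conforming T hT T' hT' ⟨hx, hx'⟩
  rw [← Finset.coe_inter] at h
  obtain ⟨w, hw⟩ := exists_isBarycentric (T := T ∩ T') h
  refine ⟨w, hw.mono Finset.inter_subset_left, hw.mono Finset.inter_subset_right, fun p hp => ?_⟩
  by_contra hc
  exact hp (hw.2.1 p fun h => hc (Finset.mem_inter.1 h))

/-- The coordinates chosen in `hat` may belong to another triangle through the point. The common
coordinates coincide with either choice by uniqueness. -/
theorem hat_eq {𝒯 : Set (Finset Plane)} (h𝒯 : IsTriangulation 𝒯)
    {T : Finset Plane} (hT : T ∈ 𝒯) {x : Plane} {w : Plane → ℝ} (hw : IsBarycentric T x w)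
    (p : Plane) : hat 𝒯 p x = w p := by
  have hex : ∃ w : Plane → ℝ, ∃ T ∈ 𝒯, IsBarycentric T x w := ⟨w, T, hT, hw⟩
  rw [hat, dif_pos hex]
  obtain ⟨T', hT', h'⟩ := hex.choose_spec
  obtain ⟨w₀, h1, h2, -⟩ := h𝒯.exists_common hT hT' hw.mem_hull h'.mem_hull
  rw [h'.unique (h𝒯.indep T' hT') h2, hw.unique (h𝒯.indep T hT) h1]

theorem hat_nonneg (𝒯 : Set (Finset Plane)) (p x : Plane) : 0 ≤ hat 𝒯 p x := by
  unfold hat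
  split_ifs with h
  · obtain ⟨T, -, hw⟩ := h.choose_spec
    exact hw.1 p
  · exact le_rfl

theorem hat_le_one (𝒯 : Set (Finset Plane)) (p x : Plane) : hat 𝒯 p x ≤ 1 := by
  unfold hat
  split_ifs with h
  · obtain ⟨T, -, hw⟩ := h.choose_spec
    by_cases hp : p ∈ T
    · rw [← hw.2.2.1]
      exact Finset.single_le_sum (fun q _ => hw.1 q) hp
    · rw [hw.2.1 p hp]
      exact zero_le_one
  · exact zero_le_one

theorem exists_of_hat_ne_zero {𝒯 : Set (Finset Plane)} {p x : Plane} (h : hat 𝒯 p x ≠ 0) :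
    ∃ T ∈ 𝒯, p ∈ T ∧ x ∈ hull T := by
  unfold hat at h
  split_ifs at h with h'
  · obtain ⟨T, hT, hw⟩ := h'.choose_spec
    refine ⟨T, hT, ?_, hw.mem_hull⟩
    by_contra hp
    exact h (hw.2.1 p hp)
  · exact absurd rfl h

theorem hat_isBarycentric {𝒯 : Set (Finset Plane)} (h𝒯 : IsTriangulation 𝒯)
    {T : Finset Plane} (hT : T ∈ 𝒯) {x : Plane} (hx : x ∈ hull T) :
    IsBarycentric T x (fun p => hat 𝒯 p x) := by
  obtain ⟨w, hw⟩ := exists_isBarycentric hx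
  have : (fun p => hat 𝒯 p x) = w := funext fun p => hat_eq h𝒯 hT hw p
  rwa [this]

theorem isClosed_hull (T : Finset Plane) : IsClosed (hull T) :=
  (T.finite_toSet.isCompact_convexHull (𝕜 := ℝ)).isClosed

theorem isCompact_hull (T : Finset Plane) : IsCompact (hull T) :=
  T.finite_toSet.isCompact_convexHull (𝕜 := ℝ)

theorem mem_hull_of_mem {T : Finset Plane} {p : Plane} (hp : p ∈ T) : p ∈ hull T :=
  subset_convexHull ℝ _ hp

theorem convex_hull (T : Finset Plane) : Convex ℝ (hull T) := convex_convexHull ℝ _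

namespace AtomisticModel
variable (M : AtomisticModel)

/-- A positive upper bound of the diameters of the mesh triangles. -/
def meshSize : ℝ := max 1 M.mesh_diam.choose

theorem meshSize_pos : 0 < M.meshSize := lt_max_of_lt_left one_pos

variable {M}

theorem dist_le_meshSize {T : Finset Plane} (hT : T ∈ M.mesh) {x y : Plane} (hx : x ∈ hull T)
    (hy : y ∈ hull T) : dist x y ≤ M.meshSize :=
  (Metric.dist_le_diam_of_mem (isCompact_hull T).isBounded hx hy).trans
    ((M.mesh_diam.choose_spec T hT).trans (le_max_right _ _))

/-- The affine basis formed by the vertices of a mesh triangle. -/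
def basis {T : Finset Plane} (hT : T ∈ M.mesh) : AffineBasis T ℝ Plane where
  toFun := fun p => p
  ind' := M.mesh_triangulation.indep T hT
  tot' := by
    rw [(M.mesh_triangulation.indep T hT).affineSpan_eq_top_iff_card_eq_finrank_add_one]
    simp [M.mesh_triangulation.card_eq T hT]

theorem range_basis {T : Finset Plane} (hT : T ∈ M.mesh) :
    Set.range (M.basis hT) = (T : Set Plane) := by
  ext x
  simp [basis, DFunLike.coe]

theorem mem_hull_iff {T : Finset Plane} (hT : T ∈ M.mesh) {x : Plane} :
    x ∈ hull T ↔ ∀ i, 0 ≤ (M.basis hT).coord i x := by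
  rw [hull, ← range_basis hT, AffineBasis.convexHull_eq_nonneg_coord]
  rfl

theorem mem_interior_hull_iff {T : Finset Plane} (hT : T ∈ M.mesh) {x : Plane} :
    x ∈ interior (hull T) ↔ ∀ i, 0 < (M.basis hT).coord i x := by
  rw [hull, ← range_basis hT, AffineBasis.interior_convexHull]
  rfl

theorem basis_apply {T : Finset Plane} (hT : T ∈ M.mesh) (i : T) : M.basis hT i = i := rfl

variable (M)

open Classical in
/-- The barycentric coordinate of the triangle `T` that belongs to `p`, as an affine function on
the plane; zero if `p` is not a vertex of `T`. -/
def bary (T : Finset Plane) (p : Plane) : Plane →ᵃ[ℝ] ℝ :=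
  if h : T ∈ M.mesh ∧ p ∈ T then (M.basis h.1).coord ⟨p, h.2⟩ else 0

variable {M}

theorem bary_of_mem {T : Finset Plane} (hT : T ∈ M.mesh) (i : T) :
    M.bary T i = (M.basis hT).coord i := by
  rw [bary, dif_pos ⟨hT, i.2⟩]

theorem bary_of_notMem {T : Finset Plane} {p : Plane} (hp : p ∉ T) : M.bary T p = 0 := by
  rw [bary, dif_neg (fun h => hp h.2)]

theorem sum_bary {T : Finset Plane} (hT : T ∈ M.mesh) (x : Plane) :
    ∑ p ∈ T, M.bary T p x = 1 := by
  rw [← Finset.sum_coe_sort, ← (M.basis hT).sum_coord_apply_eq_one x]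
  exact Finset.sum_congr rfl fun i _ => by rw [bary_of_mem hT]

theorem sum_bary_smul {T : Finset Plane} (hT : T ∈ M.mesh) (x : Plane) :
    ∑ p ∈ T, M.bary T p x • p = x := by
  have h := (M.basis hT).linear_combination_coord_eq_self x
  rw [← Finset.sum_coe_sort T fun p => M.bary T p x • p]
  conv_rhs => rw [← h]
  exact Finset.sum_congr rfl fun i _ => by rw [bary_of_mem hT, basis_apply]

theorem bary_nonneg {T : Finset Plane} {x : Plane} (hx : x ∈ hull T) (p : Plane) :
    0 ≤ M.bary T p x := by
  by_cases h : T ∈ M.mesh ∧ p ∈ T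
  · rw [bary, dif_pos h]
    exact (mem_hull_iff h.1).1 hx _
  · rw [bary, dif_neg h]
    simp

theorem bary_pos {T : Finset Plane} (hT : T ∈ M.mesh) {x : Plane} (hx : x ∈ interior (hull T))
    {p : Plane} (hp : p ∈ T) : 0 < M.bary T p x := by
  rw [bary, dif_pos ⟨hT, hp⟩]
  exact (mem_interior_hull_iff hT).1 hx _

theorem bary_isBarycentric {T : Finset Plane} (hT : T ∈ M.mesh) {x : Plane} (hx : x ∈ hull T) :
    IsBarycentric T x (fun p => M.bary T p x) :=
  ⟨bary_nonneg hx, fun p hp => by simp [bary_of_notMem hp], sum_bary hT x, sum_bary_smul hT x⟩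

theorem hat_eq_bary {T : Finset Plane} (hT : T ∈ M.mesh) {x : Plane} (hx : x ∈ hull T)
    (p : Plane) : hat M.mesh p x = M.bary T p x :=
  hat_eq M.mesh_triangulation hT (bary_isBarycentric hT hx) p

/-- A mesh triangle that meets the interior of another mesh triangle is that triangle. -/
theorem eq_of_mem_interior {T T' : Finset Plane} (hT : T ∈ M.mesh) (hT' : T' ∈ M.mesh)
    {x : Plane} (hx : x ∈ interior (hull T)) (hx' : x ∈ hull T') : T = T' := by
  obtain ⟨w, h1, -, h3⟩ :=
    M.mesh_triangulation.exists_common hT hT' (interior_subset hx) hx'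
  have h4 := h1.unique (M.mesh_triangulation.indep T hT)
    (bary_isBarycentric hT (interior_subset hx))
  -- All barycentric coordinates of an interior point are positive, so every vertex of T is shared
  -- with T'; both have three vertices.
  refine Finset.eq_of_subset_of_card_le (fun p hp => (h3 p ?_).2) ?_
  · rw [h4]
    exact (bary_pos hT hx hp).ne'
  · rw [M.mesh_triangulation.card_eq T hT, M.mesh_triangulation.card_eq T' hT']

theorem interior_hull_nonempty {T : Finset Plane} (hT : T ∈ M.mesh) :
    (interior (hull T)).Nonempty := by
  rw [hull, interior_convexHull_nonempty_iff_affineSpan_eq_top, ← range_basis hT]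
  exact (M.basis hT).tot

variable (M) in
open Classical in
/-- The vertices of `T`, as atoms. -/
def vert (T : Finset Plane) : Finset M.Λ := T.subtype (· ∈ M.Λ)

@[simp] theorem mem_vert {T : Finset Plane} {p : M.Λ} : p ∈ M.vert T ↔ (p : Plane) ∈ T := by
  simp [vert]

theorem sum_vert {E : Type*} [AddCommMonoid E] {T : Finset Plane} (hT : T ∈ M.mesh)
    (f : Plane → E) : ∑ p ∈ M.vert T, f p = ∑ p ∈ T, f p := by
  classical
  unfold vert
  rw [Finset.sum_subtype_eq_sum_filter, Finset.filter_true_of_mem]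
  exact M.mesh_vertices T hT

theorem card_vert {T : Finset Plane} (hT : T ∈ M.mesh) : (M.vert T).card = 3 := by
  rw [← M.mesh_triangulation.card_eq T hT, Finset.card_eq_sum_ones, Finset.card_eq_sum_ones,
    sum_vert hT fun _ => 1]

theorem interp_eq {T : Finset Plane} (hT : T ∈ M.mesh) {x : Plane} (hx : x ∈ hull T)
    (u : M.Λ → Plane) : M.interp u x = ∑ p ∈ M.vert T, M.bary T p x • u p := by
  rw [interp, finsum_eq_sum_of_support_subset]
  · exact Finset.sum_congr rfl fun p _ => by rw [hat_eq_bary hT hx]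
  · intro p hp
    rw [Finset.mem_coe, mem_vert]
    by_contra h
    exact hp (by simp [hat_eq_bary hT hx, bary_of_notMem h])

theorem interp_add (u v : M.Λ → Plane) : M.interp (u + v) = M.interp u + M.interp v := by
  funext x
  obtain ⟨T, hT, hx⟩ := M.mesh_cover x
  simp [interp_eq hT hx, Finset.sum_add_distrib]

theorem interp_smul (t : ℝ) (u : M.Λ → Plane) : M.interp (t • u) = t • M.interp u := by
  funext x
  obtain ⟨T, hT, hx⟩ := M.mesh_cover x
  simp [interp_eq hT hx, Finset.smul_sum, smul_comm _ t]

/-- There are no hanging nodes: an atom in a closed triangle is one of its vertices. -/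
theorem exists_mem_of_atom (p : M.Λ) : ∃ T ∈ M.mesh, (p : Plane) ∈ T := by
  obtain ⟨T, hT, hx⟩ := M.mesh_cover p
  exact ⟨T, hT, M.mesh_nodes T hT p p.2 hx⟩

theorem hat_self (p : M.Λ) (q : M.Λ) [Decidable (p = q)] :
    hat M.mesh p q = if p = q then 1 else 0 := by
  classical
  obtain ⟨T, hT, hq⟩ := exists_mem_of_atom q
  have hw : IsBarycentric T q (fun x => if x = q then 1 else 0) := by
    refine ⟨fun x => by dsimp only; split_ifs <;> norm_num, fun x hx => if_neg ?_, ?_, ?_⟩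
    · rintro rfl
      exact hx hq
    · simp [hq]
    · simp [ite_smul, hq]
  rw [hat_eq M.mesh_triangulation hT hw]
  simp [Subtype.ext_iff]

theorem interp_apply (u : M.Λ → Plane) (q : M.Λ) : M.interp u q = u q := by
  classical
  rw [interp, finsum_eq_single _ q]
  · simp [hat_self]
  · intro p hp
    simp [hat_self, hp]

/-- A triangle is its vertex set, and the vertices lie in a slightly larger ball with finitely many
atoms. -/
theorem finite_mesh_inter (x : Plane) (r : ℝ) :
    {T ∈ M.mesh | (hull T ∩ Metric.closedBall x r).Nonempty}.Finite := by
  classical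
  refine ((((M.nb (r + M.meshSize) x).map (Function.Embedding.subtype _)).powerset).finite_toSet
    ).subset ?_
  rintro T ⟨hT, y, hy, hyr⟩
  rw [Finset.mem_coe, Finset.mem_powerset]
  intro p hp
  rw [Finset.mem_map]
  refine ⟨⟨p, M.mesh_vertices T hT p hp⟩, ?_, rfl⟩
  rw [mem_nb]
  have := dist_le_meshSize hT hy (mem_hull_of_mem hp)
  rw [Metric.mem_closedBall, dist_comm] at hyr
  exact (dist_triangle x y p).trans (by linarith)

theorem countable_mesh : M.mesh.Countable := by
  refine (Set.countable_iUnion fun n : ℕ => (finite_mesh_inter (M := M) 0 n).countable).mono ?_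
  intro T hT
  obtain ⟨x, hx⟩ := interior_hull_nonempty hT
  obtain ⟨n, hn⟩ := exists_nat_ge ‖x‖
  rw [Set.mem_iUnion]
  exact ⟨n, hT, x, interior_subset hx, by simpa using hn⟩

theorem locallyFinite_hull : LocallyFinite (fun T : M.mesh => hull (T : Finset Plane)) := by
  intro x
  refine ⟨Metric.closedBall x 1, Metric.closedBall_mem_nhds x one_pos, ?_⟩
  refine ((finite_mesh_inter (M := M) x 1).preimage
    (f := (Subtype.val : M.mesh → Finset Plane)) Subtype.val_injective.injOn).subset ?_
  intro T hT
  exact ⟨T.2, hT⟩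

theorem iUnion_hull : ⋃ T : M.mesh, hull (T : Finset Plane) = Set.univ := by
  refine Set.eq_univ_of_forall fun x => ?_
  obtain ⟨T, hT, hx⟩ := M.mesh_cover x
  exact Set.mem_iUnion.2 ⟨⟨T, hT⟩, hx⟩

theorem continuous_bary (T : Finset Plane) (p : Plane) : Continuous (M.bary T p) :=
  AffineMap.continuous_of_finiteDimensional _

/-- The interpolant is affine on each triangle, and the triangles form a locally finite closed
cover. -/
theorem continuous_interp (u : M.Λ → Plane) : Continuous (M.interp u) := by
  refine (locallyFinite_hull (M := M)).continuous iUnion_hull (fun T => isClosed_hull _) fun T => ?_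
  refine ContinuousOn.congr (f := fun x => ∑ p ∈ M.vert T, M.bary T p x • u p) ?_
    fun x hx => interp_eq T.2 hx u
  exact (continuous_finsetSum _ fun p _ => (continuous_bary _ _).smul
    continuous_const).continuousOn

theorem continuous_hat (p : Plane) : Continuous (hat M.mesh p) := by
  refine (locallyFinite_hull (M := M)).continuous iUnion_hull (fun T => isClosed_hull _) fun T => ?_
  exact ContinuousOn.congr (continuous_bary T p).continuousOn fun x hx => hat_eq_bary T.2 hx p

theorem dist_le_of_hat_ne_zero {p x : Plane} (h : hat M.mesh p x ≠ 0) :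
    dist p x ≤ M.meshSize := by
  obtain ⟨T, hT, hp, hx⟩ := exists_of_hat_ne_zero h
  exact dist_le_meshSize hT (mem_hull_of_mem hp) hx

theorem hasCompactSupport_hat (p : Plane) : HasCompactSupport (hat M.mesh p) := by
  refine HasCompactSupport.of_support_subset_isCompact
    (isCompact_closedBall p M.meshSize) fun x hx => ?_
  rw [Metric.mem_closedBall, dist_comm]
  exact dist_le_of_hat_ne_zero hx

theorem sum_hat_vert {T : Finset Plane} (hT : T ∈ M.mesh) {x : Plane} (hx : x ∈ hull T) :
    ∑ p ∈ M.vert T, hat M.mesh p x = 1 := by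
  rw [sum_vert hT fun p => hat M.mesh p x]
  exact (hat_isBarycentric M.mesh_triangulation hT hx).2.2.1

theorem interp_eq_sum_of_support {u : M.Λ → Plane} {W : Finset M.Λ} (h : ∀ p ∉ W, u p = 0)
    (x : Plane) : M.interp u x = ∑ p ∈ W, hat M.mesh p x • u p := by
  rw [interp, finsum_eq_sum_of_support_subset]
  intro p hp
  by_contra hc
  exact hp (by simp [h p hc])

end AtomisticModel
end BlendedAC
end

/-! ### Shape regularity, and the Dirichlet energy as a sum over triangles. -/

noncomputable section
namespace BlendedAC
open MeasureTheory
open scoped Pointwise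

/-- The Frobenius product of two linear maps of the plane. -/
def frob (L L' : Plane →L[ℝ] Plane) : ℝ :=
  ∑ i : Fin 2, ⟪L (EuclideanSpace.single i 1), L' (EuclideanSpace.single i 1)⟫

theorem frob_self_nonneg (L : Plane →L[ℝ] Plane) : 0 ≤ frob L L :=
  Finset.sum_nonneg fun _ _ => real_inner_self_nonneg

theorem norm_apply_sq_le_frob (L : Plane →L[ℝ] Plane) (x : Plane) :
    ‖L x‖ ^ 2 ≤ ‖x‖ ^ 2 * frob L L := by
  have hx : x = ∑ i : Fin 2, x i • EuclideanSpace.single i (1 : ℝ) := by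
    ext j; fin_cases j <;> simp [Fin.sum_univ_two]
  have h1 : ‖L x‖ ≤ ∑ i : Fin 2, |x i| * ‖L (EuclideanSpace.single i 1)‖ := by
    conv_lhs => rw [hx]
    rw [map_sum]
    refine (norm_sum_le _ _).trans (Finset.sum_le_sum fun i _ => ?_)
    rw [map_smul, norm_smul, Real.norm_eq_abs]
  have h2 := Finset.sum_mul_sq_le_sq_mul_sq Finset.univ (fun i => |x i|)
    (fun i : Fin 2 => ‖L (EuclideanSpace.single i 1)‖)
  have h3 : ∑ i : Fin 2, |x i| ^ 2 = ‖x‖ ^ 2 := by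
    rw [EuclideanSpace.norm_sq_eq]
    simp
  have h4 : frob L L = ∑ i : Fin 2, ‖L (EuclideanSpace.single i 1)‖ ^ 2 := by
    simp [frob]
  rw [h4, ← h3]
  exact (pow_le_pow_left₀ (norm_nonneg _) h1 2).trans h2

theorem gradInner_eq_frob {f g : Plane → Plane} {x : Plane} {L L' : Plane →L[ℝ] Plane}
    (hf : HasFDerivAt f L x) (hg : HasFDerivAt g L' x) : gradInner f g x = frob L L' := by
  rw [gradInner, hf.fderiv, hg.fderiv, frob]

theorem gradInner_self_nonneg (f : Plane → Plane) (x : Plane) : 0 ≤ gradInner f f x :=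
  Finset.sum_nonneg fun _ _ => real_inner_self_nonneg

theorem measurable_gradInner (f g : Plane → Plane) : Measurable (gradInner f g) := by
  unfold gradInner
  refine Finset.measurable_sum _ fun i _ => ?_
  exact (measurable_fderiv_apply_const ℝ f _).inner (measurable_fderiv_apply_const ℝ g _)

theorem hull_image_sub {T : Finset Plane} (p x : Plane) [DecidableEq Plane] :
    x - p ∈ hull (T.image (· - p)) ↔ x ∈ hull T := by
  have : ((T.image (· - p) : Finset Plane) : Set Plane) = (-p) +ᵥ (T : Set Plane) := by
    ext y
    simp only [Finset.coe_image, Set.mem_image, Set.mem_vadd_set, vadd_eq_add]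
    refine exists_congr fun z => and_congr Iff.rfl ?_
    rw [sub_eq_neg_add]
  rw [hull, this, convexHull_vadd, hull, Set.mem_vadd_set_iff_neg_vadd_mem]
  simp

namespace AtomisticModel
variable (M : AtomisticModel)

/-- Moving a vertex to the origin leaves only finitely many triangles, by
`DefectLattice.diff_finite`. Each has an interior point, and the smallest of the radii works for the
whole mesh. -/
theorem exists_closedBall_subset_hull :
    ∃ r > 0, ∀ T ∈ M.mesh, ∃ x, Metric.closedBall x r ⊆ hull T := by
  classical
  let 𝒮 : Set (Finset Plane) := {S | ∃ T ∈ M.mesh, ∃ p ∈ T, S = T.image (· - p)}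
  have hfin : 𝒮.Finite := by
    refine ((M.lattice.diff_finite M.meshSize).toFinset.powerset.finite_toSet).subset ?_
    rintro _ ⟨T, hT, p, hp, rfl⟩
    rw [Finset.mem_coe, Finset.mem_powerset]
    intro d hd
    obtain ⟨q, hq, rfl⟩ := Finset.mem_image.1 hd
    rw [Set.Finite.mem_toFinset]
    refine ⟨?_, p, M.mesh_vertices T hT p hp, q, M.mesh_vertices T hT q hq, rfl⟩
    rw [← dist_eq_norm]
    exact dist_le_meshSize hT (mem_hull_of_mem hq) (mem_hull_of_mem hp)
  have key : ∃ r > 0, ∀ S ∈ 𝒮, ∃ x, Metric.closedBall x r ⊆ hull S := by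
    refine exists_pos_forall_mem_of_finite hfin
      (P := fun S r => ∃ x, Metric.closedBall x r ⊆ hull S) ?_ ?_
    · rintro _ ⟨T, hT, p, hp, rfl⟩
      obtain ⟨x, hx⟩ := interior_hull_nonempty hT
      obtain ⟨r, hr, hxr⟩ := Metric.nhds_basis_closedBall.mem_iff.1 (mem_interior_iff_mem_nhds.1 hx)
      refine ⟨r, hr, x - p, fun y hy => ?_⟩
      have : y + p ∈ hull T := by
        refine hxr ?_
        rw [mem_closedBall_iff_norm] at hy ⊢
        convert hy using 2
        abel
      simpa using (hull_image_sub p (y + p)).2 this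
    · rintro S r r' _ hrr ⟨x, hx⟩
      exact ⟨x, (Metric.closedBall_subset_closedBall hrr).trans hx⟩
  obtain ⟨r, hr, h⟩ := key
  refine ⟨r, hr, fun T hT => ?_⟩
  obtain ⟨p, hp⟩ : T.Nonempty := by
    rw [← Finset.card_pos, M.mesh_triangulation.card_eq T hT]; norm_num
  obtain ⟨x, hx⟩ := h _ ⟨T, hT, p, hp, rfl⟩
  refine ⟨x + p, fun y hy => ?_⟩
  rw [← hull_image_sub p]
  refine hx ?_
  rw [mem_closedBall_iff_norm] at hy ⊢
  convert hy using 2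
  abel

variable {M}

theorem volume_frontier_hull (T : Finset Plane) : volume (frontier (hull T)) = 0 :=
  (convex_hull T).addHaar_frontier _

/-- The mesh is countable and frontiers of convex sets are null sets. -/
theorem ae_mem_interior_hull : ∀ᵐ x : Plane, ∃ T ∈ M.mesh, x ∈ interior (hull T) := by
  have h : ∀ᵐ x : Plane, ∀ T ∈ M.mesh, x ∉ frontier (hull T) := by
    rw [ae_ball_iff countable_mesh]
    intro T _
    exact measure_eq_zero_iff_ae_notMem.1 (volume_frontier_hull T)
  filter_upwards [h] with x hx
  obtain ⟨T, hT, hxT⟩ := M.mesh_cover x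
  refine ⟨T, hT, ?_⟩
  by_contra hc
  exact hx T hT ⟨subset_closure hxT, hc⟩

theorem pairwiseDisjoint_interior_hull : M.mesh.PairwiseDisjoint (fun T => interior (hull T)) := by
  intro T hT T' hT' hne
  refine Set.disjoint_left.2 fun x hx hx' => hne ?_
  exact eq_of_mem_interior hT hT' hx (interior_subset hx')

variable (M) in
/-- The gradient on the triangle `T` of the interpolant of `u`. -/
def grad (T : Finset Plane) (u : M.Λ → Plane) : Plane →L[ℝ] Plane :=
  ∑ p ∈ M.vert T, (M.bary T p).linear.toContinuousLinearMap.smulRight (u p)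

theorem grad_apply (T : Finset Plane) (u : M.Λ → Plane) (x : Plane) :
    M.grad T u x = ∑ p ∈ M.vert T, (M.bary T p).linear x • u p := by
  simp [grad]

theorem grad_add (T : Finset Plane) (u v : M.Λ → Plane) :
    M.grad T (u + v) = M.grad T u + M.grad T v := by
  ext1 x
  simp [grad_apply, Finset.sum_add_distrib]

theorem grad_smul (T : Finset Plane) (t : ℝ) (u : M.Λ → Plane) :
    M.grad T (t • u) = t • M.grad T u := by
  ext1 x
  simp [grad_apply, Finset.smul_sum, smul_comm t]

theorem interp_sub_interp {T : Finset Plane} (hT : T ∈ M.mesh) {x y : Plane} (hx : x ∈ hull T)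
    (hy : y ∈ hull T) (u : M.Λ → Plane) :
    M.interp u x - M.interp u y = M.grad T u (x - y) := by
  rw [interp_eq hT hx, interp_eq hT hy, grad_apply, ← Finset.sum_sub_distrib]
  refine Finset.sum_congr rfl fun p _ => ?_
  rw [← sub_smul]
  congr 1
  exact ((M.bary T p).linearMap_vsub x y).symm

theorem hasFDerivAt_interp {T : Finset Plane} (hT : T ∈ M.mesh) {x : Plane}
    (hx : x ∈ interior (hull T)) (u : M.Λ → Plane) :
    HasFDerivAt (M.interp u) (M.grad T u) x := by
  have h : HasFDerivAt (fun y => M.interp u x + M.grad T u (y - x)) (M.grad T u) x := by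
    exact ((M.grad T u).hasFDerivAt.comp x ((hasFDerivAt_id x).sub_const x)).const_add _
  refine h.congr_of_eventuallyEq ?_
  filter_upwards [mem_interior_iff_mem_nhds.1 hx] with y hy
  rw [← interp_sub_interp hT hy (interior_subset hx)]
  abel

theorem gradInner_interp {T : Finset Plane} (hT : T ∈ M.mesh) {x : Plane}
    (hx : x ∈ interior (hull T)) (u v : M.Λ → Plane) :
    gradInner (M.interp u) (M.interp v) x = frob (M.grad T u) (M.grad T v) :=
  gradInner_eq_frob (hasFDerivAt_interp hT hx u) (hasFDerivAt_interp hT hx v)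

variable (M) in
/-- The sum of the squared differences of `u` over the pairs of vertices of `T`. -/
def triEnergy (u : M.Λ → Plane) (T : Finset Plane) : ℝ :=
  ∑ p ∈ M.vert T, ∑ q ∈ M.vert T, ‖u q - u p‖ ^ 2

theorem triEnergy_nonneg (u : M.Λ → Plane) (T : Finset Plane) : 0 ≤ M.triEnergy u T :=
  Finset.sum_nonneg fun _ _ => Finset.sum_nonneg fun _ _ => sq_nonneg _

theorem sq_le_triEnergy (u : M.Λ → Plane) {T : Finset Plane} {p q : M.Λ} (hp : (p : Plane) ∈ T)
    (hq : (q : Plane) ∈ T) : ‖u q - u p‖ ^ 2 ≤ M.triEnergy u T :=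
  (Finset.single_le_sum (f := fun q => ‖u q - u p‖ ^ 2) (fun _ _ => sq_nonneg _)
    (mem_vert.2 hq)).trans
  (Finset.single_le_sum (f := fun p => ∑ q ∈ M.vert T, ‖u q - u p‖ ^ 2)
    (fun _ _ => Finset.sum_nonneg fun _ _ => sq_nonneg _) (mem_vert.2 hp))

theorem grad_apply_sub {T : Finset Plane} (hT : T ∈ M.mesh) {p q : M.Λ} (hp : (p : Plane) ∈ T)
    (hq : (q : Plane) ∈ T) (u : M.Λ → Plane) : u q - u p = M.grad T u (q - p) := by
  rw [← interp_sub_interp hT (mem_hull_of_mem hq) (mem_hull_of_mem hp), interp_apply, interp_apply]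

/-- There are nine ordered pairs of vertices, each at distance at most `meshSize`, and the
interpolant is affine. -/
theorem triEnergy_le_frob {T : Finset Plane} (hT : T ∈ M.mesh) (u : M.Λ → Plane) :
    M.triEnergy u T ≤ 9 * M.meshSize ^ 2 * frob (M.grad T u) (M.grad T u) := by
  have h : ∀ p ∈ M.vert T, ∑ q ∈ M.vert T, ‖u q - u p‖ ^ 2
      ≤ 3 * (M.meshSize ^ 2 * frob (M.grad T u) (M.grad T u)) := by
    intro p hp
    have := Finset.sum_le_card_nsmul (M.vert T) (fun q => ‖u q - u p‖ ^ 2)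
      (M.meshSize ^ 2 * frob (M.grad T u) (M.grad T u)) fun q hq => ?_
    · rwa [card_vert hT, nsmul_eq_mul] at this
    · rw [mem_vert] at hp hq
      rw [grad_apply_sub hT hp hq]
      refine (norm_apply_sq_le_frob _ _).trans
        (mul_le_mul_of_nonneg_right (pow_le_pow_left₀ (norm_nonneg _) ?_ 2) (frob_self_nonneg _))
      rw [← dist_eq_norm]
      exact dist_le_meshSize hT (mem_hull_of_mem hq) (mem_hull_of_mem hp)
  have := Finset.sum_le_card_nsmul _ _ _ h
  rw [card_vert hT, nsmul_eq_mul] at this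
  rw [triEnergy]
  push_cast at this
  linarith

theorem bary_le_one {T : Finset Plane} (hT : T ∈ M.mesh) {x : Plane} (hx : x ∈ hull T)
    (p : Plane) : M.bary T p x ≤ 1 := by
  rw [← hat_eq_bary hT hx]
  exact hat_le_one _ _ _

variable (M) in
-- Barycentric coordinates stay in [0,1] on an inscribed ball of radius r, so their directional
-- derivatives are at most 1/r. These derivatives add up to zero, so the gradient depends on
-- differences of nodal values only.
theorem exists_frob_le_triEnergy : ∃ C > 0, ∀ T ∈ M.mesh, ∀ u : M.Λ → Plane,
    frob (M.grad T u) (M.grad T u) ≤ C * M.triEnergy u T := by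
  obtain ⟨r, hr, hball⟩ := M.exists_closedBall_subset_hull
  refine ⟨2 * (3 * (1 / r) ^ 2), by positivity, fun T hT u => ?_⟩
  obtain ⟨x, hx⟩ := hball T hT
  have hb : ∀ (p : Plane) (i : Fin 2),
      |(M.bary T p).linear (EuclideanSpace.single i 1)| ≤ 1 / r := by
    intro p i
    have hy : x + r • EuclideanSpace.single i (1 : ℝ) ∈ hull T := by
      refine hx ?_
      simp [norm_smul, abs_of_pos hr]
    have hx0 : x ∈ hull T := hx (Metric.mem_closedBall_self hr.le)
    have e : r * (M.bary T p).linear (EuclideanSpace.single i 1)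
        = M.bary T p (x + r • EuclideanSpace.single i (1 : ℝ)) - M.bary T p x := by
      have := (M.bary T p).linearMap_vsub (x + r • EuclideanSpace.single i (1 : ℝ)) x
      simpa using this
    have h1 := bary_nonneg (M := M) hy p
    have h2 := bary_le_one hT hy p
    have h3 := bary_nonneg (M := M) hx0 p
    have h4 := bary_le_one hT hx0 p
    rw [le_div_iff₀ hr]
    calc _ = |r * (M.bary T p).linear (EuclideanSpace.single i 1)| := by
          rw [abs_mul, abs_of_pos hr, mul_comm]
      _ ≤ 1 := by
          rw [e, abs_le]
          constructor <;> linarith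
  have hsum : ∀ y, ∑ p ∈ M.vert T, (M.bary T p).linear y = 0 := by
    intro y
    have h1 := sum_bary hT (y + x)
    have h2 := sum_bary hT x
    rw [sum_vert hT fun p => (M.bary T p).linear y]
    have : ∀ p, (M.bary T p).linear y = M.bary T p (y + x) - M.bary T p x := by
      intro p
      have := (M.bary T p).linearMap_vsub (y + x) x
      simpa using this
    simp only [this, Finset.sum_sub_distrib, h1, h2, sub_self]
  obtain ⟨p₀, hp₀⟩ : (M.vert T).Nonempty := by
    rw [← Finset.card_pos, card_vert hT]; norm_num
  have hrow : ∀ i : Fin 2, ‖M.grad T u (EuclideanSpace.single i 1)‖ ^ 2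
      ≤ 3 * (1 / r) ^ 2 * M.triEnergy u T := by
    intro i
    set e := EuclideanSpace.single i (1 : ℝ)
    have e1 : M.grad T u e = ∑ p ∈ M.vert T, (M.bary T p).linear e • (u p - u p₀) := by
      simp only [smul_sub, Finset.sum_sub_distrib]
      rw [← Finset.sum_smul, hsum, zero_smul, sub_zero, grad_apply]
    have e2 : ‖M.grad T u e‖ ≤ ∑ p ∈ M.vert T, (1 / r) * ‖u p - u p₀‖ := by
      rw [e1]
      refine (norm_sum_le _ _).trans (Finset.sum_le_sum fun p _ => ?_)
      rw [norm_smul]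
      exact mul_le_mul_of_nonneg_right (hb p i) (norm_nonneg _)
    refine (pow_le_pow_left₀ (norm_nonneg _) e2 2).trans ?_
    refine (sq_sum_le_card_mul_sum_sq (s := M.vert T)
      (f := fun p => (1 / r) * ‖u p - u p₀‖)).trans ?_
    rw [card_vert hT]
    simp only [mul_pow]
    rw [← Finset.mul_sum, Nat.cast_ofNat, mul_assoc]
    refine mul_le_mul_of_nonneg_left (mul_le_mul_of_nonneg_left ?_ (by positivity)) (by norm_num)
    exact Finset.single_le_sum (f := fun p => ∑ q ∈ M.vert T, ‖u q - u p‖ ^ 2)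
      (fun _ _ => Finset.sum_nonneg fun _ _ => sq_nonneg _) hp₀
  simp only [frob, real_inner_self_eq_norm_sq, Fin.sum_univ_two]
  linarith [hrow 0, hrow 1]

variable (M) in
/-- The triangle energies of `u` on mesh triangles have partial sums bounded by `B`. -/
def TriLe (u : M.Λ → Plane) (B : ℝ) : Prop := SumLe (fun T : M.mesh => M.triEnergy u T) B

theorem volume_interior_hull (T : Finset Plane) :
    volume.real (interior (hull T)) = volume.real (hull T) :=
  (measureReal_congr (interior_ae_eq_of_null_frontier (volume_frontier_hull T)))

theorem volume_interior_hull_lt_top (T : Finset Plane) : volume (interior (hull T)) < ∞ :=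
  (measure_mono interior_subset).trans_lt (isCompact_hull T).measure_lt_top

variable (M) in
theorem exists_le_volume_hull : ∃ a > 0, ∀ T ∈ M.mesh, a ≤ volume.real (interior (hull T)) := by
  obtain ⟨r, hr, hball⟩ := M.exists_closedBall_subset_hull
  refine ⟨volume.real (Metric.closedBall (0 : Plane) r), ?_, fun T hT => ?_⟩
  · exact ENNReal.toReal_pos (Metric.measure_closedBall_pos _ _ hr).ne'
      (isCompact_closedBall _ _).measure_lt_top.ne
  · obtain ⟨x, hx⟩ := hball T hT
    rw [volume_interior_hull]
    have : volume.real (Metric.closedBall (0 : Plane) r)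
        = volume.real (Metric.closedBall x r) := by
      rw [measureReal_def, measureReal_def, Measure.addHaar_closedBall_center volume x]
    rw [this]
    exact measureReal_mono hx (isCompact_hull T).measure_lt_top.ne

variable (M) in
theorem volume_hull_le {T : Finset Plane} (hT : T ∈ M.mesh) :
    volume.real (interior (hull T)) ≤ volume.real (Metric.closedBall (0 : Plane) M.meshSize) := by
  obtain ⟨x, hx⟩ := interior_hull_nonempty hT
  have : volume.real (Metric.closedBall (0 : Plane) M.meshSize)
      = volume.real (Metric.closedBall x M.meshSize) := by
    rw [measureReal_def, measureReal_def, Measure.addHaar_closedBall_center volume x]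
  rw [this]
  refine measureReal_mono (fun y hy => ?_) (isCompact_closedBall _ _).measure_lt_top.ne
  exact dist_le_meshSize hT (interior_subset hy) (interior_subset hx)

theorem setIntegral_gradInner {T : Finset Plane} (hT : T ∈ M.mesh) (u v : M.Λ → Plane) :
    ∫ x in interior (hull T), gradInner (M.interp u) (M.interp v) x
      = volume.real (interior (hull T)) * frob (M.grad T u) (M.grad T v) := by
  rw [setIntegral_congr_fun isOpen_interior.measurableSet
    (fun x hx => gradInner_interp hT hx u v), setIntegral_const, smul_eq_mul]

theorem integrableOn_gradInner {T : Finset Plane} (hT : T ∈ M.mesh) (u v : M.Λ → Plane) :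
    IntegrableOn (gradInner (M.interp u) (M.interp v)) (interior (hull T)) := by
  refine (integrableOn_const (C := frob (M.grad T u) (M.grad T v))
    (volume_interior_hull_lt_top T).ne).congr_fun (fun x hx => ?_) isOpen_interior.measurableSet
  exact (gradInner_interp hT hx u v).symm

theorem norm12_sq (u : M.Λ → Plane) :
    M.norm12 u ^ 2 = ∫ x, gradInner (M.interp u) (M.interp u) x := by
  rw [norm12, gradL2, setIntegral_univ, Real.sq_sqrt]
  exact integral_nonneg fun x => gradInner_self_nonneg _ _

theorem norm12_nonneg (u : M.Λ → Plane) : 0 ≤ M.norm12 u := Real.sqrt_nonneg _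

/-- The triangle energies are controlled by the Dirichlet energy. -/
theorem exists_triLe (M : AtomisticModel) : ∃ C > 0, ∀ u : M.Λ → Plane, M.IsFiniteEnergy u →
    M.TriLe u (C * M.norm12 u ^ 2) := by
  obtain ⟨a, ha, hvol⟩ := M.exists_le_volume_hull
  have hm := M.meshSize_pos
  refine ⟨9 * M.meshSize ^ 2 / a, by positivity, fun u hu s => ?_⟩
  have h1 : ∀ T : M.mesh, M.triEnergy u T ≤ 9 * M.meshSize ^ 2 / a *
      ∫ x in interior (hull (T : Finset Plane)), gradInner (M.interp u) (M.interp u) x := by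
    intro T
    rw [setIntegral_gradInner T.2]
    refine (triEnergy_le_frob T.2 u).trans ?_
    have h2 := hvol T T.2
    have h3 := frob_self_nonneg (M.grad T u)
    calc _ = 9 * M.meshSize ^ 2 / a * (a * frob (M.grad T u) (M.grad T u)) := by
          field_simp
      _ ≤ _ := by gcongr
  refine (Finset.sum_le_sum fun T _ => h1 T).trans ?_
  rw [← Finset.mul_sum, norm12_sq]
  refine mul_le_mul_of_nonneg_left ?_ (by positivity)
  rw [← integral_biUnion_finset s (fun T _ => isOpen_interior.measurableSet) ?_
    (fun T _ => integrableOn_gradInner T.2 u u)]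
  · exact setIntegral_le_integral hu (ae_of_all _ fun x => gradInner_self_nonneg _ _)
  · intro T _ T' _ hne
    exact pairwiseDisjoint_interior_hull T.2 T'.2 fun h => hne (Subtype.ext h)

/-- Stated for the lower integral because integrability is still to be deduced. The open triangles
cover almost the whole plane and the gradient is constant on each. -/
theorem lintegral_gradInner_le {u : M.Λ → Plane} {B : ℝ} (hB : SumLe (fun T : M.mesh =>
    volume.real (interior (hull (T : Finset Plane))) * frob (M.grad T u) (M.grad T u)) B) :
    ∫⁻ x, ENNReal.ofReal (gradInner (M.interp u) (M.interp u) x) ≤ ENNReal.ofReal B := by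
  have : Countable M.mesh := countable_mesh
  have hU : (⋃ T : M.mesh, interior (hull (T : Finset Plane))) =ᵐ[volume] Set.univ := by
    rw [Filter.eventuallyEq_univ]
    filter_upwards [ae_mem_interior_hull (M := M)] with x hx
    obtain ⟨T, hT, hx⟩ := hx
    exact Set.mem_iUnion.2 ⟨⟨T, hT⟩, hx⟩
  rw [← setLIntegral_univ, ← setLIntegral_congr hU]
  refine (lintegral_iUnion_le _ _).trans ?_
  have h1 : ∀ T : M.mesh, ∫⁻ x in interior (hull (T : Finset Plane)),
      ENNReal.ofReal (gradInner (M.interp u) (M.interp u) x) = ENNReal.ofReal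
      (volume.real (interior (hull (T : Finset Plane))) * frob (M.grad T u) (M.grad T u)) := by
    intro T
    rw [← setIntegral_gradInner T.2, ofReal_integral_eq_lintegral_ofReal
      (integrableOn_gradInner T.2 u u) (ae_of_all _ fun x => gradInner_self_nonneg _ _)]
  simp only [h1]
  rw [ENNReal.tsum_eq_iSup_sum]
  refine iSup_le fun s => ?_
  rw [← ENNReal.ofReal_sum_of_nonneg fun T _ =>
    mul_nonneg measureReal_nonneg (frob_self_nonneg _)]
  exact ENNReal.ofReal_le_ofReal (hB s)

theorem isFiniteEnergy_of_sumLe {u : M.Λ → Plane} {B : ℝ} (hB : SumLe (fun T : M.mesh =>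
    volume.real (interior (hull (T : Finset Plane))) * frob (M.grad T u) (M.grad T u)) B) :
    M.IsFiniteEnergy u ∧ M.norm12 u ^ 2 ≤ B := by
  have h := lintegral_gradInner_le hB
  have h0 : ∀ x, 0 ≤ gradInner (M.interp u) (M.interp u) x := fun x => gradInner_self_nonneg _ _
  refine ⟨⟨(measurable_gradInner _ _).aestronglyMeasurable, ?_⟩, ?_⟩
  · rw [hasFiniteIntegral_iff_ofReal (ae_of_all _ h0)]
    exact h.trans_lt ENNReal.ofReal_lt_top
  · rw [norm12_sq, integral_eq_lintegral_of_nonneg_ae (ae_of_all _ h0)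
      (measurable_gradInner _ _).aestronglyMeasurable]
    exact ENNReal.toReal_le_of_le_ofReal hB.nonneg h

/-- The Dirichlet energy is controlled by the triangle energies. -/
theorem exists_isFiniteEnergy_of_triLe (M : AtomisticModel) : ∃ C > 0, ∀ (u : M.Λ → Plane) (B : ℝ),
    M.TriLe u B → M.IsFiniteEnergy u ∧ M.norm12 u ^ 2 ≤ C * B := by
  obtain ⟨C, hC, h⟩ := M.exists_frob_le_triEnergy
  set b := volume.real (Metric.closedBall (0 : Plane) M.meshSize)
  refine ⟨(b + 1) * C, by positivity, fun u B hB => isFiniteEnergy_of_sumLe ?_⟩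
  refine (hB.const_mul (c := (b + 1) * C) (by positivity)).mono (fun T => ?_) le_rfl
  have h1 := M.volume_hull_le T.2
  have h2 := h T T.2 u
  have h3 := frob_self_nonneg (M.grad T u)
  rw [mul_assoc]
  exact mul_le_mul (h1.trans (by linarith)) h2 h3 (by positivity)

end AtomisticModel
end BlendedAC
end

/-! ### Equivalence of the energy norm with differences over nearby atoms. -/

noncomputable section
namespace BlendedAC
open MeasureTheory
namespace AtomisticModel
variable {M : AtomisticModel}

variable (M) in
/-- The mesh triangles that meet the closed ball of radius `r` about `x`. -/
def triNear (r : ℝ) (x : Plane) : Finset M.mesh :=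
  ((finite_mesh_inter (M := M) x r).preimage (f := (Subtype.val : M.mesh → Finset Plane))
    Subtype.val_injective.injOn).toFinset

theorem mem_triNear {r : ℝ} {x : Plane} {T : M.mesh} :
    T ∈ M.triNear r x ↔ (hull (T : Finset Plane) ∩ Metric.closedBall x r).Nonempty := by
  simp [triNear]

variable (M) in
-- The vertex set of such a triangle is a subset of a neighbourhood with at most N atoms, which
-- leaves at most 2^N possibilities.
theorem card_triNear_le (r : ℝ) : ∃ N : ℕ, ∀ x : Plane, (M.triNear r x).card ≤ N := by
  classical
  obtain ⟨N, hN⟩ := M.card_nb_le (r + M.meshSize)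
  refine ⟨2 ^ N, fun x => ?_⟩
  calc (M.triNear r x).card ≤ (M.nb (r + M.meshSize) x).powerset.card := by
        refine Finset.card_le_card_of_injOn (fun T => M.vert T) ?_ ?_
        · intro T hT
          rw [Finset.mem_coe, mem_triNear] at hT
          obtain ⟨y, hy, hyr⟩ := hT
          rw [Finset.mem_coe, Finset.mem_powerset]
          intro p hp
          rw [mem_vert] at hp
          rw [mem_nb]
          have := dist_le_meshSize T.2 hy (mem_hull_of_mem hp)
          rw [Metric.mem_closedBall, dist_comm] at hyr
          exact (dist_triangle x y p).trans (by linarith)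
        · intro T _ T' _ h
          refine Subtype.ext (Finset.ext fun p => ?_)
          have h' : M.vert T = M.vert T' := h
          constructor
          · intro hp
            have := h' ▸ (mem_vert (p := ⟨p, M.mesh_vertices T T.2 p hp⟩)).2 hp
            exact mem_vert.1 this
          · intro hp
            have := h' ▸ (mem_vert (p := ⟨p, M.mesh_vertices T' T'.2 p hp⟩)).2 hp
            exact mem_vert.1 this
    _ ≤ 2 ^ N := by
        rw [Finset.card_powerset]
        exact Nat.pow_le_pow_right two_pos (hN x)

variable (M) in
-- Bounded overlap for triangles: the atoms near T all lie within r + `meshSize` of one fixed point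
-- of T.
theorem sumLe_triNear (r : ℝ) : ∃ C > 0, ∀ (a : M.mesh → ℝ) (B : ℝ), (∀ T, 0 ≤ a T) → SumLe a B →
    SumLe (fun p : M.Λ => ∑ T ∈ M.triNear r p, a T) (C * B) := by
  classical
  obtain ⟨N, hN⟩ := M.card_nb_le (r + M.meshSize)
  refine ⟨N + 1, by positivity, fun a B ha h s => ?_⟩
  have h1 : ∑ p ∈ s, ∑ T ∈ M.triNear r p, a T
      = ∑ T ∈ s.biUnion (fun p : M.Λ => M.triNear r p),
        ∑ _p ∈ s.filter (fun p : M.Λ => T ∈ M.triNear r p), a T := by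
    refine Finset.sum_comm' ?_
    intro p q
    simp only [Finset.mem_biUnion, Finset.mem_filter]
    tauto
  rw [h1]
  calc _ ≤ ∑ T ∈ s.biUnion (fun p : M.Λ => M.triNear r p), ((N : ℝ) + 1) * a T := by
        refine Finset.sum_le_sum fun T _ => ?_
        rw [Finset.sum_const, nsmul_eq_mul]
        refine mul_le_mul_of_nonneg_right ?_ (ha T)
        obtain ⟨x, hx⟩ := interior_hull_nonempty T.2
        have : (s.filter fun p : M.Λ => T ∈ M.triNear r p).card ≤ N := by
          refine (Finset.card_le_card ?_).trans (hN x)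
          intro p hp
          obtain ⟨y, hy, hyr⟩ := mem_triNear.1 (Finset.mem_filter.1 hp).2
          rw [mem_nb]
          have := dist_le_meshSize T.2 (interior_subset hx) hy
          rw [Metric.mem_closedBall] at hyr
          exact (dist_triangle x y p).trans (by linarith)
        have : ((s.filter fun p : M.Λ => T ∈ M.triNear r p).card : ℝ) ≤ N := by
          exact_mod_cast this
        linarith
    _ ≤ _ := by
        rw [← Finset.mul_sum]
        exact mul_le_mul_of_nonneg_left (h _) (by positivity)

/-- An interpolated value is a convex combination of nodal values. -/
theorem norm_interp_sub_le {T : Finset Plane} (hT : T ∈ M.mesh) {x : Plane} (hx : x ∈ hull T)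
    (u : M.Λ → Plane) (c : Plane) {δ : ℝ} (h : ∀ p ∈ M.vert T, ‖u p - c‖ ≤ δ) :
    ‖M.interp u x - c‖ ≤ δ := by
  have hs : ∑ p ∈ M.vert T, M.bary T p x = 1 := by
    rw [sum_vert hT fun p => M.bary T p x, sum_bary hT]
  have : M.interp u x - c = ∑ p ∈ M.vert T, M.bary T p x • (u p - c) := by
    simp only [smul_sub, Finset.sum_sub_distrib]
    rw [← Finset.sum_smul, hs, one_smul, interp_eq hT hx]
  rw [this]
  calc _ ≤ ∑ p ∈ M.vert T, M.bary T p x * δ := by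
        refine (norm_sum_le _ _).trans (Finset.sum_le_sum fun p hp => ?_)
        rw [norm_smul, Real.norm_of_nonneg (bary_nonneg hx _)]
        exact mul_le_mul_of_nonneg_left (h p hp) (bary_nonneg hx _)
    _ = δ := by rw [← Finset.sum_mul, hs, one_mul]

/-- Differences of nodal values are controlled by the triangle energies along the way: the values
of the interpolant on the segment form a connected set that the triangles cover. -/
theorem norm_sub_le_sum_triNear {r : ℝ} {p q : M.Λ} (h : dist (p : Plane) q ≤ r)
    (u : M.Λ → Plane) :
    ‖u q - u p‖ ≤ 2 * ∑ T ∈ M.triNear r p, √(M.triEnergy u T) := by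
  set e := u q - u p with he
  set S := ∑ T ∈ M.triNear r p, √(M.triEnergy u T)
  -- Projection onto the direction of the total difference e makes the function real-valued, with g
  -- q - g p = ‖e‖².
  let g : Plane → ℝ := fun x => ⟪e, M.interp u x⟫
  have hg : Continuous g := continuous_const.inner (continuous_interp u)
  have hsub : segment ℝ (p : Plane) q ⊆ Metric.closedBall (p : Plane) r := by
    refine (convex_closedBall _ _).segment_subset (Metric.mem_closedBall_self ?_) ?_
    · exact dist_nonneg.trans h
    · rwa [Metric.mem_closedBall, dist_comm]
  have hconn : IsPreconnected (g '' segment ℝ (p : Plane) q) :=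
    (convex_segment _ _).isPreconnected.image _ hg.continuousOn
  have hne : ∀ T : M.mesh, ∃ p, p ∈ M.vert T := fun T => by
    have : (M.vert T).Nonempty := by
      rw [← Finset.card_pos, card_vert T.2]; norm_num
    exact this
  choose w hw using hne
  -- On each triangle that meets the segment, g stays within ‖e‖ √(`triEnergy`) of its value at one
  -- vertex. Since the image of the segment is connected, these intervals cover everything between g
  -- p and g q.
  have hcov : Set.Icc (g p) (g q) ⊆
      ⋃ T ∈ M.triNear r p, Metric.closedBall (g (w T)) (‖e‖ * √(M.triEnergy u T)) := by
    refine (hconn.Icc_subset ⟨_, left_mem_segment ℝ _ _, rfl⟩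
      ⟨_, right_mem_segment ℝ _ _, rfl⟩).trans ?_
    rintro _ ⟨x, hx, rfl⟩
    obtain ⟨T, hT, hxT⟩ := M.mesh_cover x
    simp only [Set.mem_iUnion]
    refine ⟨⟨T, hT⟩, mem_triNear.2 ⟨x, hxT, hsub hx⟩, ?_⟩
    have hwT : (w ⟨T, hT⟩ : Plane) ∈ T := mem_vert.1 (hw ⟨T, hT⟩)
    rw [mem_closedBall_iff_norm]
    simp only [g, interp_apply, ← inner_sub_right]
    refine (norm_inner_le_norm _ _).trans (mul_le_mul_of_nonneg_left ?_ (norm_nonneg _))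
    refine norm_interp_sub_le hT hxT u _ fun y hy => ?_
    rw [mem_vert] at hy
    exact Real.le_sqrt_of_sq_le (sq_le_triEnergy u hwT hy)
  -- Comparison of lengths bounds ‖e‖² by the total length of the covering intervals; one factor ‖e‖
  -- cancels at the end.
  have hvol : ENNReal.ofReal (g q - g p) ≤ ENNReal.ofReal (2 * ‖e‖ * S) := by
    rw [← Real.volume_Icc]
    refine (measure_mono hcov).trans ((measure_biUnion_finset_le _ _).trans ?_)
    simp only [Real.volume_closedBall]
    rw [← ENNReal.ofReal_sum_of_nonneg fun T _ => by positivity]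
    refine ENNReal.ofReal_le_ofReal (le_of_eq ?_)
    rw [Finset.mul_sum]
    exact Finset.sum_congr rfl fun T _ => by ring
  have hS : 0 ≤ S := Finset.sum_nonneg fun _ _ => Real.sqrt_nonneg _
  have h1 : g q - g p = ‖e‖ ^ 2 := by
    simp only [g, interp_apply, ← inner_sub_right]
    rw [← he, real_inner_self_eq_norm_sq]
  rw [h1, ENNReal.ofReal_le_ofReal_iff (by positivity)] at hvol
  rcases (norm_nonneg e).eq_or_lt with h0 | h0
  · rw [← h0]; positivity
  · nlinarith

variable (M) in
-- The bound along a segment is squared with Cauchy–Schwarz over a bounded number of triangles, then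
-- summed over a bounded number of neighbours; bounded overlap finishes.
theorem exists_sumLe_locEnergy_of_triLe (r : ℝ) : ∃ C > 0, ∀ (u : M.Λ → Plane) (B : ℝ),
    M.TriLe u B → SumLe (M.locEnergy r u) (C * B) := by
  obtain ⟨N, hN⟩ := M.card_nb_le r
  obtain ⟨N', hN'⟩ := M.card_triNear_le r
  obtain ⟨C, hC, h⟩ := M.sumLe_triNear r
  refine ⟨(N + 1) * (4 * (N' + 1)) * C, by positivity, fun u B hB => ?_⟩
  refine ((h _ _ (fun T => triEnergy_nonneg u T) hB).const_mul
    (c := (N + 1) * (4 * (N' + 1))) (by positivity)).mono (fun p => ?_) (by simp only [mul_assoc, le_refl])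
  set S := ∑ T ∈ M.triNear r p, M.triEnergy u T
  have hS : 0 ≤ S := Finset.sum_nonneg fun _ _ => triEnergy_nonneg _ _
  have h1 : ∀ q ∈ M.nb r p, ‖u q - u p‖ ^ 2 ≤ 4 * (N' + 1) * S := by
    intro q hq
    have h2 := norm_sub_le_sum_triNear (mem_nb.1 hq) u
    have h3 := sq_sum_le_card_mul_sum_sq (s := M.triNear r p)
      (f := fun T : M.mesh => √(M.triEnergy u T))
    simp only [Real.sq_sqrt (triEnergy_nonneg u _)] at h3
    have h4 : ((M.triNear r p).card : ℝ) ≤ N' := by exact_mod_cast hN' p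
    calc ‖u q - u p‖ ^ 2 ≤ (2 * ∑ T ∈ M.triNear r p, √(M.triEnergy u T)) ^ 2 :=
          pow_le_pow_left₀ (norm_nonneg _) h2 2
      _ = 4 * (∑ T ∈ M.triNear r p, √(M.triEnergy u T)) ^ 2 := by ring
      _ ≤ 4 * ((M.triNear r p).card * S) := by gcongr
      _ ≤ 4 * ((N' + 1) * S) := by gcongr; linarith
      _ = _ := by ring
  have h5 := Finset.sum_le_card_nsmul _ _ _ h1
  rw [nsmul_eq_mul] at h5
  have h6 : ((M.nb r p).card : ℝ) ≤ N + 1 := by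
    have : ((M.nb r p).card : ℝ) ≤ N := by exact_mod_cast hN p
    linarith
  calc M.locEnergy r u p ≤ (M.nb r p).card * (4 * (N' + 1) * S) := h5
    _ ≤ (N + 1) * (4 * (N' + 1) * S) := by gcongr
    _ = _ := by ring

variable (M) in
-- Vertices of a triangle are at most `meshSize` apart, and an atom belongs to a bounded number of
-- triangles.
theorem exists_triLe_of_sumLe_locEnergy : ∃ C > 0, ∀ (u : M.Λ → Plane) (B : ℝ),
    SumLe (M.locEnergy M.meshSize u) B → M.TriLe u (C * B) := by
  classical
  obtain ⟨N, hN⟩ := M.card_triNear_le 0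
  refine ⟨N + 1, by positivity, fun u B hB s => ?_⟩
  have h1 : ∀ T ∈ s, M.triEnergy u T ≤ ∑ p ∈ M.vert T, M.locEnergy M.meshSize u p := by
    intro T _
    refine Finset.sum_le_sum fun p hp => ?_
    refine Finset.sum_le_sum_of_subset_of_nonneg (fun q hq => ?_) fun _ _ _ => sq_nonneg _
    rw [mem_vert] at hp hq
    exact mem_nb.2 (dist_le_meshSize T.2 (mem_hull_of_mem hp) (mem_hull_of_mem hq))
  refine (Finset.sum_le_sum h1).trans ?_
  have h2 : ∑ T ∈ s, ∑ p ∈ M.vert T, M.locEnergy M.meshSize u p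
      = ∑ p ∈ s.biUnion (fun T : M.mesh => M.vert T),
        ∑ _T ∈ s.filter (fun T : M.mesh => p ∈ M.vert T), M.locEnergy M.meshSize u p := by
    refine Finset.sum_comm' ?_
    intro p q
    simp only [Finset.mem_biUnion, Finset.mem_filter]
    tauto
  rw [h2]
  calc _ ≤ ∑ p ∈ s.biUnion (fun T : M.mesh => M.vert T), ((N : ℝ) + 1) * M.locEnergy M.meshSize u p := by
        refine Finset.sum_le_sum fun p _ => ?_
        rw [Finset.sum_const, nsmul_eq_mul]
        refine mul_le_mul_of_nonneg_right ?_ (locEnergy_nonneg _ _ _)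
        have : (s.filter fun T : M.mesh => p ∈ M.vert T).card ≤ N := by
          refine (Finset.card_le_card ?_).trans (hN p)
          intro T hT
          rw [mem_triNear]
          exact ⟨p, mem_hull_of_mem (mem_vert.1 (Finset.mem_filter.1 hT).2), by simp⟩
        have : ((s.filter fun T : M.mesh => p ∈ M.vert T).card : ℝ) ≤ N := by exact_mod_cast this
        linarith
    _ ≤ _ := by
        rw [← Finset.mul_sum]
        exact mul_le_mul_of_nonneg_left (hB _) (by positivity)

/-- The energy norm controls the differences over pairs of atoms at bounded distance. -/
theorem exists_sumLe_locEnergy (M : AtomisticModel) (r : ℝ) : ∃ C > 0, ∀ u : M.Λ → Plane,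
    M.IsFiniteEnergy u → SumLe (M.locEnergy r u) (C * M.norm12 u ^ 2) := by
  obtain ⟨C, hC, h⟩ := M.exists_triLe
  obtain ⟨C', hC', h'⟩ := M.exists_sumLe_locEnergy_of_triLe r
  refine ⟨C' * C, by positivity, fun u hu => ?_⟩
  rw [mul_assoc]
  exact h' _ _ (h u hu)

/-- The differences over pairs of atoms at bounded distance control the energy norm. -/
theorem exists_norm12_le (M : AtomisticModel) : ∃ C > 0, ∀ (u : M.Λ → Plane) (B : ℝ),
    SumLe (M.locEnergy M.meshSize u) B → M.IsFiniteEnergy u ∧ M.norm12 u ^ 2 ≤ C * B := by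
  obtain ⟨C, hC, h⟩ := M.exists_isFiniteEnergy_of_triLe
  obtain ⟨C', hC', h'⟩ := M.exists_triLe_of_sumLe_locEnergy
  refine ⟨C * C', by positivity, fun u B hu => ?_⟩
  rw [mul_assoc]
  exact h _ _ (h' u B hu)

/-- The discrete form of the energy norm reduces the claim to an inequality between finite sums. -/
theorem IsFiniteEnergy.add {u v : M.Λ → Plane} (hu : M.IsFiniteEnergy u)
    (hv : M.IsFiniteEnergy v) : M.IsFiniteEnergy (u + v) := by
  obtain ⟨C, -, h⟩ := M.exists_sumLe_locEnergy M.meshSize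
  obtain ⟨C', -, h'⟩ := M.exists_norm12_le
  exact (h' _ _ (sumLe_locEnergy_add (h u hu) (h v hv))).1

theorem IsFiniteEnergy.smul {u : M.Λ → Plane} (hu : M.IsFiniteEnergy u) (t : ℝ) :
    M.IsFiniteEnergy (t • u) := by
  obtain ⟨C, -, h⟩ := M.exists_sumLe_locEnergy M.meshSize
  obtain ⟨C', -, h'⟩ := M.exists_norm12_le
  refine (h' (t • u) (t ^ 2 * _) (((h u hu).const_mul (sq_nonneg t)).mono (fun p => ?_) le_rfl)).1
  rw [locEnergy_smul]

theorem IsFiniteEnergy.sub {u v : M.Λ → Plane} (hu : M.IsFiniteEnergy u)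
    (hv : M.IsFiniteEnergy v) : M.IsFiniteEnergy (u - v) := by
  have := hu.add (hv.smul (-1))
  rwa [neg_one_smul, ← sub_eq_add_neg] at this

theorem norm12_smul (t : ℝ) (u : M.Λ → Plane) : M.norm12 (t • u) = |t| * M.norm12 u := by
  have h : M.norm12 (t • u) ^ 2 = (|t| * M.norm12 u) ^ 2 := by
    rw [mul_pow, sq_abs, norm12_sq, norm12_sq, ← integral_const_mul]
    refine integral_congr_ae ?_
    filter_upwards [ae_mem_interior_hull (M := M)] with x hx
    obtain ⟨T, hT, hx⟩ := hx
    rw [gradInner_interp hT hx, gradInner_interp hT hx, grad_smul]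
    simp only [frob, real_inner_self_eq_norm_sq, Fin.sum_univ_two, _root_.smul_apply,
      norm_smul, mul_pow, Real.norm_eq_abs, sq_abs, mul_add]
  exact (sq_eq_sq₀ (norm12_nonneg _) (mul_nonneg (abs_nonneg _) (norm12_nonneg _))).1 h

theorem norm12_neg (u : M.Λ → Plane) : M.norm12 (-u) = M.norm12 u := by
  have := norm12_smul (-1) u
  rwa [neg_one_smul, abs_neg, abs_one, one_mul] at this

theorem isFiniteEnergy_of_support {u : M.Λ → Plane} (hu : u.support.Finite) :
    M.IsFiniteEnergy u := by
  classical
  obtain ⟨C, -, h⟩ := M.exists_norm12_le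
  let W : Finset M.Λ := hu.toFinset.biUnion fun p => insert p (M.nb M.meshSize p)
  have h0 : ∀ p ∉ W, M.locEnergy M.meshSize u p = 0 := by
    intro p hp
    have hW : ∀ q, u q ≠ 0 → q ≠ p ∧ p ∉ M.nb M.meshSize q := by
      intro q hq
      constructor
      · rintro rfl
        exact hp (Finset.mem_biUnion.2 ⟨q, by simpa using hq, Finset.mem_insert_self _ _⟩)
      · intro h
        exact hp (Finset.mem_biUnion.2 ⟨q, by simpa using hq, Finset.mem_insert_of_mem h⟩)
    refine Finset.sum_eq_zero fun q hq => ?_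
    have h1 : u p = 0 := by
      by_contra hc
      exact (hW p hc).1 rfl
    have h2 : u q = 0 := by
      by_contra hc
      exact (hW q hc).2 (mem_nb_comm.1 hq)
    simp [h1, h2]
  refine (h u (∑ p ∈ W, M.locEnergy M.meshSize u p) fun s => ?_).1
  rw [Finset.sum_subset Finset.subset_union_right fun p _ hp => h0 p hp]
  exact Finset.sum_le_sum_of_subset_of_nonneg (Finset.subset_union_left (s₂ := W))
    fun p _ _ => locEnergy_nonneg _ _ _

/-! ### Mass estimates -/

variable (M) in
/-- `∫ ζ_p`. -/
def mass (p : M.Λ) : ℝ := ∫ x, hat M.mesh p x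

/-- Averages of an affine function over a copy of a triangle shrunk towards a vertex control the
value at the vertex. -/
theorem norm_vertex_sq_le {T : Finset Plane} (hT : T ∈ M.mesh) {p : M.Λ} (hp : (p : Plane) ∈ T)
    (u : M.Λ → Plane) {s : ℝ} (hs : 0 < s) (hs1 : s ≤ 1) :
    s ^ 2 * volume.real (interior (hull T)) * ‖u p‖ ^ 2 ≤ 34 *
      ∫ x in AffineMap.homothety (p : Plane) s '' interior (hull T), ‖M.interp u x‖ ^ 2 := by
  set I := interior (hull T) with hI
  have hIm : MeasurableSet I := isOpen_interior.measurableSet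
  have hcont := continuous_interp u
  have hmem : ∀ y ∈ I, ∀ t : ℝ, 0 < t → t ≤ 1 → AffineMap.homothety (p : Plane) t y ∈ I := by
    intro y hy t ht ht1
    have := (convex_hull T).add_smul_sub_mem_interior (mem_hull_of_mem hp) hy ⟨ht, ht1⟩
    rwa [AffineMap.homothety_apply, vsub_eq_sub, vadd_eq_add, add_comm]
  -- Change of variables for the homothety of ratio t, whose Jacobian in the plane is t².
  have hcv : ∀ t : ℝ, 0 < t → ∫ x in AffineMap.homothety (p : Plane) t '' I, ‖M.interp u x‖ ^ 2
      = t ^ 2 * ∫ y in I, ‖M.interp u (AffineMap.homothety (p : Plane) t y)‖ ^ 2 := by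
    intro t ht
    have hd : ∀ y ∈ I, HasFDerivWithinAt (AffineMap.homothety (p : Plane) t)
        (t • ContinuousLinearMap.id ℝ Plane) I y := by
      intro y _
      have : HasFDerivAt (fun y : Plane => t • (y - (p : Plane)) + (p : Plane))
          (t • ContinuousLinearMap.id ℝ Plane) y :=
        (((hasFDerivAt_id y).sub_const (p : Plane)).const_smul t).add_const _
      exact this.hasFDerivWithinAt
    have hinj : Set.InjOn (AffineMap.homothety (p : Plane) t) I := by
      intro y _ z _ h
      simp only [AffineMap.homothety_apply, vsub_eq_sub, vadd_eq_add, add_left_inj] at h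
      simpa using smul_right_injective _ ht.ne' h
    rw [integral_image_eq_integral_abs_det_fderiv_smul volume hIm hd hinj]
    have hdet : |(t • ContinuousLinearMap.id ℝ Plane).det| = t ^ 2 := by
      have : (t • ContinuousLinearMap.id ℝ Plane).det = t ^ 2 := by
        rw [ContinuousLinearMap.det, ContinuousLinearMap.toLinearMap_smul, LinearMap.det_smul]
        simp
      rw [this, abs_of_nonneg (sq_nonneg t)]
    simp only [hdet, smul_eq_mul]
    rw [integral_const_mul]
  have hint : ∀ t : ℝ, IntegrableOn
      (fun y => ‖M.interp u (AffineMap.homothety (p : Plane) t y)‖ ^ 2) I := by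
    intro t
    have hc : Continuous fun y => ‖M.interp u (AffineMap.homothety (p : Plane) t y)‖ ^ 2 :=
      ((hcont.comp (AffineMap.continuous_of_finiteDimensional _)).norm).pow 2
    exact (hc.continuousOn.integrableOn_compact (isCompact_hull T)).mono_set interior_subset
  -- The interpolant is affine along the ray from p through y, so its value at p is twice the value
  -- at ratio s/2 minus the value at ratio s.
  have key : ∀ y ∈ I, ‖u p‖ ^ 2 ≤ 8 * ‖M.interp u (AffineMap.homothety (p : Plane) (s / 2) y)‖ ^ 2
      + 2 * ‖M.interp u (AffineMap.homothety (p : Plane) s y)‖ ^ 2 := by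
    intro y hy
    have h1 := interior_subset (hmem y hy s hs hs1)
    have h2 := interior_subset (hmem y hy (s / 2) (by linarith) (by linarith))
    have e1 := interp_sub_interp hT h1 (mem_hull_of_mem hp) u
    have e2 := interp_sub_interp hT h2 (mem_hull_of_mem hp) u
    rw [interp_apply] at e1 e2
    simp only [AffineMap.homothety_apply, vsub_eq_sub, vadd_eq_add, add_sub_cancel_right,
      map_smul] at e1 e2
    have e3 : u p = (2 : ℝ) • M.interp u (AffineMap.homothety (p : Plane) (s / 2) y)
        + -M.interp u (AffineMap.homothety (p : Plane) s y) := by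
      simp only [AffineMap.homothety_apply, vsub_eq_sub, vadd_eq_add]
      rw [sub_eq_iff_eq_add.1 e1, sub_eq_iff_eq_add.1 e2, smul_add, smul_smul,
        mul_div_cancel₀ s two_ne_zero, two_smul]
      abel
    have := norm_add_sq_le ((2 : ℝ) • M.interp u (AffineMap.homothety (p : Plane) (s / 2) y))
      (-M.interp u (AffineMap.homothety (p : Plane) s y))
    rw [← e3, norm_neg, norm_smul, mul_pow] at this
    norm_num at this
    linarith
  have h1 : volume.real I * ‖u p‖ ^ 2 ≤
      8 * (∫ y in I, ‖M.interp u (AffineMap.homothety (p : Plane) (s / 2) y)‖ ^ 2)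
      + 2 * ∫ y in I, ‖M.interp u (AffineMap.homothety (p : Plane) s y)‖ ^ 2 := by
    rw [← integral_const_mul, ← integral_const_mul,
      ← integral_add ((hint _).const_mul _) ((hint _).const_mul _), ← smul_eq_mul,
      ← setIntegral_const]
    exact setIntegral_mono_on (integrableOn_const (volume_interior_hull_lt_top T).ne)
      (((hint _).const_mul _).add ((hint _).const_mul _)) hIm key
  have hsub : AffineMap.homothety (p : Plane) (s / 2) '' I
      ⊆ AffineMap.homothety (p : Plane) s '' I := by
    rintro _ ⟨y, hy, rfl⟩
    refine ⟨AffineMap.homothety (p : Plane) (1 / 2 : ℝ) y,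
      hmem y hy _ (by norm_num) (by norm_num), ?_⟩
    rw [← AffineMap.homothety_mul_apply]
    congr 2
    ring
  have hsub' : AffineMap.homothety (p : Plane) s '' I ⊆ hull T := by
    rintro _ ⟨y, hy, rfl⟩
    exact interior_subset (hmem y hy s hs hs1)
  have h2 : ∫ x in AffineMap.homothety (p : Plane) (s / 2) '' I, ‖M.interp u x‖ ^ 2
      ≤ ∫ x in AffineMap.homothety (p : Plane) s '' I, ‖M.interp u x‖ ^ 2 := by
    refine setIntegral_mono_set ?_ (ae_of_all _ fun x => sq_nonneg _)
      (Filter.Eventually.of_forall hsub)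
    exact ((hcont.norm.pow 2).continuousOn.integrableOn_compact (isCompact_hull T)).mono_set hsub'
  rw [hcv _ (by linarith : 0 < s / 2)] at h2
  rw [hcv _ hs] at h2 ⊢
  -- The constant is 34 = 8 · 4 + 2: the half-size copy has Jacobian s²/4 and is contained in the
  -- copy of ratio s.
  nlinarith [mul_le_mul_of_nonneg_left h1 (sq_nonneg s)]

end AtomisticModel
end BlendedAC
end

/-! ### Nodal masses, quasi-interpolation and the rescaled force field. -/

noncomputable section
namespace BlendedAC
open MeasureTheory
namespace AtomisticModel
variable {M : AtomisticModel}

theorem integrable_hat (p : Plane) : Integrable (hat M.mesh p) :=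
  (continuous_hat p).integrable_of_hasCompactSupport (hasCompactSupport_hat p)

theorem integrable_hat_smul {E : Type*} [NormedAddCommGroup E] [NormedSpace ℝ E] {f : Plane → E}
    (hf : Continuous f) (p : Plane) : Integrable fun x => hat M.mesh p x • f x :=
  ((continuous_hat p).smul hf).integrable_of_hasCompactSupport
    ((hasCompactSupport_hat p).smul_right)

theorem integrableOn_norm_interp_sq (u : M.Λ → Plane) {Z : Set Plane} {r : ℝ}
    (hZ : Z ⊆ Metric.closedBall 0 r) : IntegrableOn (fun x => ‖M.interp u x‖ ^ 2) Z :=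
  (((continuous_interp u).norm.pow 2).continuousOn.integrableOn_compact
    (isCompact_closedBall _ _)).mono_set hZ

variable (M) in
theorem exists_mass_le : ∃ m > 0, ∀ p : M.Λ, M.mass p ≤ m := by
  refine ⟨volume.real (Metric.closedBall (0 : Plane) M.meshSize), ?_, fun p => ?_⟩
  · exact ENNReal.toReal_pos (Metric.measure_closedBall_pos _ _ M.meshSize_pos).ne'
      (isCompact_closedBall _ _).measure_lt_top.ne
  · have : volume.real (Metric.closedBall (0 : Plane) M.meshSize)
        = volume.real (Metric.closedBall (p : Plane) M.meshSize) := by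
      rw [measureReal_def, measureReal_def, Measure.addHaar_closedBall_center volume (p : Plane)]
    rw [this, mass, ← integral_indicator_one Metric.isClosed_closedBall.measurableSet]
    refine integral_mono (integrable_hat p) ?_ fun x => ?_
    · exact (integrable_indicator_iff Metric.isClosed_closedBall.measurableSet).2
        (integrableOn_const (isCompact_closedBall _ _).measure_lt_top.ne)
    · by_cases h : hat M.mesh p x = 0
      · rw [h]
        exact Set.indicator_nonneg (fun _ _ => zero_le_one) _
      · rw [Set.indicator_of_mem]
        · exact hat_le_one _ _ _
        · rw [Metric.mem_closedBall, dist_comm]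
          exact dist_le_of_hat_ne_zero h

variable (M) in
-- The vertex estimate is applied to a unit displacement, whose interpolant is the hat function
-- times a unit vector; ζ² ≤ ζ because ζ takes values in [0,1].
theorem exists_le_mass : ∃ m > 0, ∀ p : M.Λ, m ≤ M.mass p := by
  classical
  obtain ⟨a, ha, h⟩ := M.exists_le_volume_hull
  refine ⟨a / 34, by positivity, fun p => ?_⟩
  obtain ⟨T, hT, hp⟩ := exists_mem_of_atom p
  have hu : ∀ x, M.interp (M.lattice.unitDisp p 0) x
      = hat M.mesh p x • EuclideanSpace.single 0 1 := by
    intro x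
    rw [interp_eq_sum_of_support (W := {p})]
    · simp [DefectLattice.unitDisp]
    · intro q hq
      rw [Finset.mem_singleton] at hq
      simp [DefectLattice.unitDisp, hq]
  have h1 := norm_vertex_sq_le hT hp (M.lattice.unitDisp p 0) one_pos le_rfl
  simp only [hu, norm_smul, Real.norm_of_nonneg (hat_nonneg _ _ _), PiLp.norm_single,
    norm_one, mul_one] at h1
  simp only [AffineMap.homothety_one, DefectLattice.unitDisp, Pi.single_eq_same,
    PiLp.norm_single, norm_one, one_pow, one_mul, mul_one] at h1
  have h2 : ∫ x in (AffineMap.id ℝ Plane) '' interior (hull T), hat M.mesh p x ^ 2 ≤ M.mass p := by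
    have h3 : ∀ x, hat M.mesh p x ^ 2 ≤ hat M.mesh p x := fun x => by
      have := hat_nonneg M.mesh p x
      have := hat_le_one M.mesh p x
      nlinarith
    have hi : Integrable fun x => hat M.mesh p x ^ 2 := by
      simpa [sq] using integrable_hat_smul (M := M) (continuous_hat (M := M) p) p
    exact (setIntegral_le_integral hi (ae_of_all _ fun x => sq_nonneg _)).trans
      (integral_mono hi (integrable_hat p) h3)
  have := h T hT
  linarith

theorem mass_pos (p : M.Λ) : 0 < M.mass p := by
  obtain ⟨m, hm, h⟩ := M.exists_le_mass
  exact hm.trans_le (h p)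

variable (M) in
/-- Local masses of an interpolant control its nodal values. -/
theorem exists_sum_norm_sq_le {s : ℝ} (hs : 0 < s) (hs1 : s ≤ 1) :
    ∃ C > 0, ∀ (u : M.Λ → Plane) (W : Finset M.Λ) (Z : Set Plane) (r : ℝ), MeasurableSet Z →
      Z ⊆ Metric.closedBall 0 r →
      (∀ p ∈ W, ∃ T ∈ M.mesh, (p : Plane) ∈ T ∧
        AffineMap.homothety (p : Plane) s '' interior (hull T) ⊆ Z ∩ interior (hull T)) →
      ∑ p ∈ W, ‖u p‖ ^ 2 ≤ C * ∫ x in Z, ‖M.interp u x‖ ^ 2 := by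
  classical
  obtain ⟨a, ha, hvol⟩ := M.exists_le_volume_hull
  refine ⟨34 * 3 / (s ^ 2 * a), by positivity, fun u W Z r hZm hZ h => ?_⟩
  have h' : ∀ p : M.Λ, ∃ T : M.mesh, p ∈ W → (p : Plane) ∈ (T : Finset Plane) ∧
      AffineMap.homothety (p : Plane) s '' interior (hull (T : Finset Plane))
        ⊆ Z ∩ interior (hull (T : Finset Plane)) := by
    intro p
    by_cases hp : p ∈ W
    · obtain ⟨T, hT, hpT⟩ := h p hp
      exact ⟨⟨T, hT⟩, fun _ => hpT⟩
    · obtain ⟨T, hT, -⟩ := exists_mem_of_atom p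
      exact ⟨⟨T, hT⟩, fun h => absurd h hp⟩
  choose t ht using h'
  let J : M.mesh → ℝ := fun T => ∫ x in Z ∩ interior (hull (T : Finset Plane)), ‖M.interp u x‖ ^ 2
  have hJ0 : ∀ T, 0 ≤ J T := fun T => integral_nonneg fun _ => sq_nonneg _
  have hint := integrableOn_norm_interp_sq u hZ
  have h1 : ∀ p ∈ W, ‖u p‖ ^ 2 ≤ 34 / (s ^ 2 * a) * J (t p) := by
    intro p hp
    have h2 := norm_vertex_sq_le (t p).2 (ht p hp).1 u hs hs1
    have h3 : ∫ x in AffineMap.homothety (p : Plane) s '' interior (hull (t p : Finset Plane)),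
        ‖M.interp u x‖ ^ 2 ≤ J (t p) :=
      setIntegral_mono_set (hint.mono_set Set.inter_subset_left) (ae_of_all _ fun x => sq_nonneg _)
        (Filter.Eventually.of_forall (ht p hp).2)
    rw [div_mul_eq_mul_div, le_div_iff₀ (by positivity)]
    have h4 := mul_le_mul_of_nonneg_right (mul_le_mul_of_nonneg_left (hvol _ (t p).2)
      (sq_nonneg s)) (sq_nonneg ‖u p‖)
    linarith
  -- A triangle is selected at most by its three vertices, and the open triangles are disjoint.
  have h5 : ∑ p ∈ W, J (t p) ≤ 3 * ∫ x in Z, ‖M.interp u x‖ ^ 2 := by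
    rw [Finset.sum_comp J t]
    have h6 : ∀ T ∈ W.image t, (W.filter fun p => t p = T).card • J T ≤ 3 * J T := by
      intro T _
      rw [nsmul_eq_mul]
      refine mul_le_mul_of_nonneg_right ?_ (hJ0 T)
      have : (W.filter fun p => t p = T).card ≤ 3 := by
        rw [← card_vert T.2]
        refine Finset.card_le_card fun p hp => ?_
        obtain ⟨hp', rfl⟩ := Finset.mem_filter.1 hp
        exact mem_vert.2 (ht p hp').1
      exact_mod_cast this
    refine (Finset.sum_le_sum h6).trans ?_
    rw [← Finset.mul_sum]
    refine mul_le_mul_of_nonneg_left ?_ (by norm_num)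
    rw [← integral_biUnion_finset _ (fun T _ => hZm.inter isOpen_interior.measurableSet) ?_
      (fun T _ => hint.mono_set Set.inter_subset_left)]
    · refine setIntegral_mono_set hint (ae_of_all _ fun x => sq_nonneg _)
        (Filter.Eventually.of_forall ?_)
      exact Set.iUnion₂_subset fun T _ => Set.inter_subset_left
    · intro T _ T' _ hne
      exact (pairwiseDisjoint_interior_hull T.2 T'.2 fun h => hne (Subtype.ext h)).mono
        Set.inter_subset_right Set.inter_subset_right
  refine (Finset.sum_le_sum h1).trans ?_
  rw [← Finset.mul_sum]
  refine (mul_le_mul_of_nonneg_left h5 (by positivity)).trans (le_of_eq ?_)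
  ring

theorem sum_hat_le_one (W : Finset M.Λ) (x : Plane) : ∑ p ∈ W, hat M.mesh p x ≤ 1 := by
  classical
  obtain ⟨T, hT, hx⟩ := M.mesh_cover x
  calc ∑ p ∈ W, hat M.mesh p x ≤ ∑ p ∈ W ∪ M.vert T, hat M.mesh p x :=
        Finset.sum_le_sum_of_subset_of_nonneg Finset.subset_union_left
          fun _ _ _ => hat_nonneg _ _ _
    _ = ∑ p ∈ M.vert T, hat M.mesh p x := by
        refine (Finset.sum_subset Finset.subset_union_right fun p _ hp => ?_).symm
        rw [hat_eq_bary hT hx, bary_of_notMem fun h => hp (mem_vert.2 h)]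
        rfl
    _ = 1 := sum_hat_vert hT hx

variable (M) in
/-- The mass of an interpolant is controlled by its nodal values. -/
theorem exists_integral_norm_interp_sq_le : ∃ C > 0, ∀ (u : M.Λ → Plane) (W : Finset M.Λ)
    (Z : Set Plane), (∀ p ∉ W, u p = 0) → MeasurableSet Z →
    ∫ x in Z, ‖M.interp u x‖ ^ 2 ≤ C * ∑ p ∈ W, ‖u p‖ ^ 2 := by
  obtain ⟨m, hm, h⟩ := M.exists_mass_le
  refine ⟨m, hm, fun u W Z hu hZ => ?_⟩
  have h1 : ∀ x, ‖M.interp u x‖ ^ 2 ≤ ∑ p ∈ W, hat M.mesh p x * ‖u p‖ ^ 2 := by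
    intro x
    rw [interp_eq_sum_of_support hu]
    have h2 : ‖∑ p ∈ W, hat M.mesh p x • u p‖ ≤ ∑ p ∈ W, hat M.mesh p x * ‖u p‖ := by
      refine (norm_sum_le _ _).trans (Finset.sum_le_sum fun p _ => ?_)
      rw [norm_smul, Real.norm_of_nonneg (hat_nonneg _ _ _)]
    -- Cauchy–Schwarz with the hat functions as weights; their sum is at most one.
    have h3 := Finset.sum_sq_le_sum_mul_sum_of_sq_le_mul W (r := fun p => hat M.mesh p x * ‖u p‖)
      (f := fun p => hat M.mesh p x) (g := fun p => hat M.mesh p x * ‖u p‖ ^ 2)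
      (fun p _ => hat_nonneg _ _ _) (fun p _ => mul_nonneg (hat_nonneg _ _ _) (sq_nonneg _))
      (fun p _ => le_of_eq (by ring))
    refine (pow_le_pow_left₀ (norm_nonneg _) h2 2).trans (h3.trans ?_)
    exact mul_le_of_le_one_left (Finset.sum_nonneg fun p _ =>
      mul_nonneg (hat_nonneg _ _ _) (sq_nonneg _)) (sum_hat_le_one W x)
  have hi : Integrable fun x => ∑ p ∈ W, hat M.mesh p x * ‖u p‖ ^ 2 :=
    integrable_finsetSum _ fun p _ => (integrable_hat _).mul_const _
  have h0 : ∀ x, 0 ≤ ∑ p ∈ W, hat M.mesh p x * ‖u p‖ ^ 2 := fun x =>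
    Finset.sum_nonneg fun p _ => mul_nonneg (hat_nonneg _ _ _) (sq_nonneg _)
  have hi' : Integrable fun x => ‖M.interp u x‖ ^ 2 := by
    refine hi.mono' ((continuous_interp u).norm.pow 2).aestronglyMeasurable (ae_of_all _ fun x => ?_)
    rw [Real.norm_of_nonneg (sq_nonneg _)]
    exact h1 x
  calc ∫ x in Z, ‖M.interp u x‖ ^ 2 ≤ ∫ x, ‖M.interp u x‖ ^ 2 :=
        setIntegral_le_integral hi' (ae_of_all _ fun x => sq_nonneg _)
    _ ≤ ∫ x, ∑ p ∈ W, hat M.mesh p x * ‖u p‖ ^ 2 := integral_mono hi' hi h1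
    _ = ∑ p ∈ W, M.mass p * ‖u p‖ ^ 2 := by
        rw [integral_finsetSum _ fun p _ => (integrable_hat _).mul_const _]
        exact Finset.sum_congr rfl fun p _ => integral_mul_const _ _
    _ ≤ _ := by
        rw [Finset.mul_sum]
        exact Finset.sum_le_sum fun p _ => mul_le_mul_of_nonneg_right (h p) (sq_nonneg _)

variable (M) in
/-- The quasi-interpolant whose nodal values are the averages of `I_a w` with weights `ζ_p`. -/
def quasiInterp (w : M.Λ → Plane) (p : M.Λ) : Plane :=
  (M.mass p)⁻¹ • ∫ x, hat M.mesh p x • M.interp w x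

/-- The new value is a weighted average over the triangles at p, where the interpolant differs from
w p by at most the largest difference to a neighbouring vertex. -/
theorem norm_quasiInterp_sub_sq_le (w : M.Λ → Plane) (p : M.Λ) :
    ‖M.quasiInterp w p - w p‖ ^ 2 ≤ M.locEnergy M.meshSize w p := by
  set δ := √(M.locEnergy M.meshSize w p) with hδ
  have hm := mass_pos p
  have h1 : ∀ x, ‖hat M.mesh p x • (M.interp w x - w p)‖ ≤ hat M.mesh p x * δ := by
    intro x
    rw [norm_smul, Real.norm_of_nonneg (hat_nonneg _ _ _)]
    by_cases h : hat M.mesh p x = 0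
    · simp [h]
    refine mul_le_mul_of_nonneg_left ?_ (hat_nonneg _ _ _)
    obtain ⟨T, hT, hp, hx⟩ := exists_of_hat_ne_zero h
    refine norm_interp_sub_le hT hx w _ fun q hq => Real.le_sqrt_of_sq_le (sq_le_locEnergy w ?_)
    exact dist_le_meshSize hT (mem_hull_of_mem hp) (mem_hull_of_mem (mem_vert.1 hq))
  have e : M.quasiInterp w p - w p
      = (M.mass p)⁻¹ • ∫ x, hat M.mesh p x • (M.interp w x - w p) := by
    simp only [smul_sub]
    rw [integral_sub (integrable_hat_smul (continuous_interp w) p)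
      ((integrable_hat (M := M) p).smul_const _), integral_smul_const, smul_sub, quasiInterp]
    congr 1
    rw [smul_smul, ← mass, inv_mul_cancel₀ hm.ne', one_smul]
  have h2 : ‖M.quasiInterp w p - w p‖ ≤ δ := by
    rw [e, norm_smul, Real.norm_of_nonneg (inv_nonneg.2 hm.le), inv_mul_le_iff₀ hm]
    refine (norm_integral_le_of_norm_le ((integrable_hat (M := M) p).mul_const δ)
      (ae_of_all _ h1)).trans (le_of_eq ?_)
    rw [integral_mul_const, mass]
  calc _ ≤ δ ^ 2 := pow_le_pow_left₀ (norm_nonneg _) h2 2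
    _ = _ := Real.sq_sqrt (locEnergy_nonneg _ _ _)

variable (M) in
-- Stability of Π in the energy norm: a difference of averaged values is a difference of w plus two
-- averaging errors, and the errors sum up by bounded overlap.
theorem exists_sumLe_quasiInterp : ∃ C > 0, ∀ (w : M.Λ → Plane) (B : ℝ),
    SumLe (M.locEnergy M.meshSize w) B →
      SumLe (M.locEnergy M.meshSize (M.quasiInterp w)) (C * B) := by
  obtain ⟨C, hC, h⟩ := M.sumLe_nb M.meshSize
  obtain ⟨N, hN⟩ := M.card_nb_le M.meshSize
  refine ⟨4 * (C + 1 + N), by positivity, fun w B hB => ?_⟩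
  have h1 := h (M.locEnergy M.meshSize w) B (locEnergy_nonneg _ w) hB
  have h2 := ((h1.add hB).add (hB.const_mul (Nat.cast_nonneg N))).const_mul
    (c := 4) (by norm_num)
  refine h2.mono (fun p => ?_) (le_of_eq (by ring))
  have h3 : ∀ q ∈ M.nb M.meshSize p, ‖M.quasiInterp w q - M.quasiInterp w p‖ ^ 2
      ≤ 4 * (M.locEnergy M.meshSize w q + ‖w q - w p‖ ^ 2 + M.locEnergy M.meshSize w p) := by
    intro q _
    have e : M.quasiInterp w q - M.quasiInterp w p = (w q - w p) +
        ((M.quasiInterp w q - w q) + -(M.quasiInterp w p - w p)) := by abel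
    have i1 := norm_add_sq_le (w q - w p)
      ((M.quasiInterp w q - w q) + -(M.quasiInterp w p - w p))
    have i2 := norm_add_sq_le (M.quasiInterp w q - w q) (-(M.quasiInterp w p - w p))
    rw [norm_neg] at i2
    rw [← e] at i1
    have i3 := norm_quasiInterp_sub_sq_le w p
    have i4 := norm_quasiInterp_sub_sq_le w q
    nlinarith [sq_nonneg ‖w q - w p‖]
  refine (Finset.sum_le_sum h3).trans ?_
  rw [← Finset.mul_sum, Finset.sum_add_distrib, Finset.sum_add_distrib, Finset.sum_const,
    nsmul_eq_mul]
  have h4 : ((M.nb M.meshSize p).card : ℝ) ≤ N := by exact_mod_cast hN p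
  have h5 := mul_le_mul_of_nonneg_right h4 (locEnergy_nonneg M.meshSize w p)
  have h6 : ∑ q ∈ M.nb M.meshSize p, ‖w q - w p‖ ^ 2 = M.locEnergy M.meshSize w p := rfl
  linarith

variable (M) in
/-- Nodal values of the rescaled force field. -/
def scaledForce (u : M.Λ → Plane) (p : M.Λ) : Plane := (M.mass p)⁻¹ • M.force u p

theorem forceInterp_eq (u : M.Λ → Plane) : M.forceInterp u = M.interp (M.scaledForce u) := by
  funext x
  simp only [forceInterp, interp, scaledForce, smul_smul, mass]

/-- Testing the rescaled force field with an interpolant. -/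
theorem integral_forceInterp {u : M.Λ → Plane} {W : Finset M.Λ} (hW : ∀ p ∉ W, M.force u p = 0)
    (w : M.Λ → Plane) : ∫ x, ⟪M.forceInterp u x, M.interp w x⟫
      = ∑ p ∈ W, ⟪M.force u p, M.quasiInterp w p⟫ := by
  have h1 : ∀ x, ⟪M.forceInterp u x, M.interp w x⟫
      = ∑ p ∈ W, ⟪M.scaledForce u p, hat M.mesh p x • M.interp w x⟫ := by
    intro x
    rw [forceInterp_eq, interp_eq_sum_of_support (W := W), sum_inner]
    · refine Finset.sum_congr rfl fun p _ => ?_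
      rw [real_inner_smul_left, real_inner_smul_right]
    · intro p hp
      rw [scaledForce, hW p hp, smul_zero]
  simp only [h1]
  have hi : ∀ p ∈ W, Integrable fun x =>
      ⟪M.scaledForce u p, hat M.mesh p x • M.interp w x⟫ := fun p _ =>
    (integrable_hat_smul (M := M) (continuous_interp w) p).const_inner _
  rw [integral_finsetSum _ hi]
  refine Finset.sum_congr rfl fun p _ => ?_
  -- The factor 1/∫ζ_p passes from the force to the test function, where it normalises the average.
  rw [integral_inner (integrable_hat_smul (M := M) (continuous_interp w) p), quasiInterp,
    scaledForce, real_inner_smul_left, real_inner_smul_right]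

end AtomisticModel
end BlendedAC
end

/-! ### A Poincaré inequality for displacements of the defective lattice. -/

noncomputable section
namespace BlendedAC

/-- Telescoping followed by Cauchy–Schwarz. The last increment leaves the index range, which is
harmless for an upper bound. -/
theorem norm_sub_sq_le_sum_range {E : Type*} [NormedAddCommGroup E] (g : ℕ → E) {N i j : ℕ}
    (hi : i < N) (hj : j < N) :
    ‖g i - g j‖ ^ 2 ≤ N * ∑ k ∈ Finset.range N, ‖g (k + 1) - g k‖ ^ 2 := by
  wlog hij : i ≤ j generalizing i j
  · rw [norm_sub_rev]
    exact this hj hi (le_of_not_ge hij)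
  have h1 : ‖g i - g j‖ ≤ ∑ k ∈ Finset.range N, ‖g (k + 1) - g k‖ := by
    rw [norm_sub_rev, ← Finset.sum_Ico_sub g hij]
    refine (norm_sum_le _ _).trans ?_
    refine Finset.sum_le_sum_of_subset_of_nonneg (fun k hk => ?_) fun _ _ _ => norm_nonneg _
    rw [Finset.mem_Ico] at hk
    exact Finset.mem_range.2 (hk.2.trans hj)
  refine (pow_le_pow_left₀ (norm_nonneg _) h1 2).trans ?_
  have := sq_sum_le_card_mul_sum_sq (s := Finset.range N) (f := fun k => ‖g (k + 1) - g k‖)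
  rwa [Finset.card_range] at this

/-- A discrete Poincaré inequality on a square grid. -/
theorem exists_grid_poincare {E : Type*} [NormedAddCommGroup E] (f : ℕ → ℕ → E) {N : ℕ}
    (hN : 0 < N) : ∃ c : E, ∑ i ∈ Finset.range N, ∑ j ∈ Finset.range N, ‖f i j - c‖ ^ 2 ≤
      2 * N ^ 2 * ∑ i ∈ Finset.range N, ∑ j ∈ Finset.range N,
        (‖f (i + 1) j - f i j‖ ^ 2 + ‖f i (j + 1) - f i j‖ ^ 2) := by
  set R := Finset.range N with hR
  set Sx := ∑ i ∈ R, ∑ j ∈ R, ‖f (i + 1) j - f i j‖ ^ 2 with hSx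
  set Sy := ∑ i ∈ R, ∑ j ∈ R, ‖f i (j + 1) - f i j‖ ^ 2 with hSy
  have hS : ∑ i ∈ R, ∑ j ∈ R, (‖f (i + 1) j - f i j‖ ^ 2 + ‖f i (j + 1) - f i j‖ ^ 2)
      = Sx + Sy := by simp only [Finset.sum_add_distrib, hSx, hSy]
  have hcard : (R.card : ℝ) = N := by rw [hR, Finset.card_range]
  -- The points (i, j) and (k, l) are joined through (k, j), by one line in each coordinate
  -- direction.
  have hpt : ∀ k ∈ R, ∀ l ∈ R, ∀ i ∈ R, ∀ j ∈ R, ‖f i j - f k l‖ ^ 2 ≤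
      2 * (N * ∑ m ∈ R, ‖f (m + 1) j - f m j‖ ^ 2)
        + 2 * (N * ∑ m ∈ R, ‖f k (m + 1) - f k m‖ ^ 2) := by
    intro k hk l hl i hi j hj
    rw [hR, Finset.mem_range] at hk hl hi hj
    have h1 := norm_sub_sq_le_sum_range (fun i => f i j) hi hk
    have h2 := norm_sub_sq_le_sum_range (fun j => f k j) hj hl
    have h3 := AtomisticModel.norm_add_sq_le (f i j - f k j) (f k j - f k l)
    rw [sub_add_sub_cancel] at h3
    linarith
  have hsum : ∑ k ∈ R, ∑ l ∈ R, ∑ i ∈ R, ∑ j ∈ R, ‖f i j - f k l‖ ^ 2 ≤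
      ∑ k ∈ R, ∑ l ∈ R, (2 * N ^ 2 * (Sx + Sy)) := by
    calc _ ≤ ∑ k ∈ R, ∑ l ∈ R, ∑ i ∈ R, ∑ j ∈ R,
        (2 * (N * ∑ m ∈ R, ‖f (m + 1) j - f m j‖ ^ 2)
          + 2 * (N * ∑ m ∈ R, ‖f k (m + 1) - f k m‖ ^ 2)) :=
          Finset.sum_le_sum fun k hk => Finset.sum_le_sum fun l hl => Finset.sum_le_sum
            fun i hi => Finset.sum_le_sum fun j hj => hpt k hk l hl i hi j hj
      _ = _ := by
          simp only [Finset.sum_add_distrib, Finset.sum_const, ← Finset.mul_sum, nsmul_eq_mul,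
            hcard]
          rw [Finset.sum_comm (s := R) (t := R) (f := fun j m => ‖f (m + 1) j - f m j‖ ^ 2),
            ← hSx, ← hSy]
          ring
  have hne : R.Nonempty := ⟨0, Finset.mem_range.2 hN⟩
  -- Summed over all reference points the estimate holds on average, so some grid value f k l serves
  -- as the constant.
  obtain ⟨k, -, hk⟩ := Finset.exists_le_of_sum_le hne hsum
  obtain ⟨l, -, hl⟩ := Finset.exists_le_of_sum_le hne hk
  exact ⟨f k l, by rw [hS]; exact hl⟩

namespace AtomisticModel
variable (M : AtomisticModel)

theorem nonempty_atoms : Nonempty M.Λ := by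
  obtain ⟨T, hT, -⟩ := M.mesh_cover 0
  obtain ⟨p, hp⟩ : T.Nonempty := by
    rw [← Finset.card_pos, M.mesh_triangulation.card_eq T hT]; norm_num
  exact ⟨⟨p, M.mesh_vertices T hT p hp⟩⟩

/-- The lattice point with integer coordinates `z`. -/
def latticePoint (z : ℤ × ℤ) : Plane :=
  WithLp.toLp 2 (M.lattice.A.mulVec ![(z.1 : ℝ), (z.2 : ℝ)])

theorem latticePoint_mem (z : ℤ × ℤ) : M.latticePoint z ∈ homLattice M.lattice.A := by
  refine ⟨![z.1, z.2], ?_⟩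
  rw [latticePoint]
  congr 2
  funext i
  fin_cases i <;> rfl

theorem exists_latticePoint {x : Plane} (hx : x ∈ homLattice M.lattice.A) :
    ∃ z, M.latticePoint z = x := by
  obtain ⟨z, rfl⟩ := hx
  refine ⟨(z 0, z 1), ?_⟩
  rw [latticePoint]
  congr 2
  funext i
  fin_cases i <;> rfl

theorem latticePoint_sub (z z' : ℤ × ℤ) :
    M.latticePoint z - M.latticePoint z' = M.latticePoint (z - z') := by
  rw [latticePoint, latticePoint, latticePoint, ← WithLp.toLp_sub, ← Matrix.mulVec_sub]
  congr 2
  funext i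
  fin_cases i <;> simp

theorem exists_abs_le_latticePoint : ∃ K > 0, ∀ z : ℤ × ℤ,
    |(z.1 : ℝ)| ≤ K * ‖M.latticePoint z‖ ∧ |(z.2 : ℝ)| ≤ K * ‖M.latticePoint z‖ := by
  let f : Plane →L[ℝ] (Fin 2 → ℝ) := ((Matrix.mulVecLin M.lattice.A⁻¹) ∘ₗ
    (WithLp.linearEquiv 2 ℝ (Fin 2 → ℝ)).toLinearMap).toContinuousLinearMap
  refine ⟨‖f‖ + 1, by positivity, fun z => ?_⟩
  have h2 : f (M.latticePoint z) = ![(z.1 : ℝ), (z.2 : ℝ)] := by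
    have hu : IsUnit M.lattice.A.det := isUnit_iff_ne_zero.mpr M.lattice.det_ne_zero
    change M.lattice.A⁻¹.mulVec (M.lattice.A.mulVec ![(z.1 : ℝ), (z.2 : ℝ)]) = _
    rw [Matrix.mulVec_mulVec, Matrix.nonsing_inv_mul _ hu, Matrix.one_mulVec]
  have h3 : ‖f (M.latticePoint z)‖ ≤ (‖f‖ + 1) * ‖M.latticePoint z‖ :=
    (f.le_opNorm _).trans (mul_le_mul_of_nonneg_right (by linarith) (norm_nonneg _))
  have h4 := fun i => (norm_le_pi_norm (f (M.latticePoint z)) i).trans h3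
  rw [h2] at h4
  exact ⟨by simpa using h4 0, by simpa using h4 1⟩

theorem latticePoint_injective : Function.Injective M.latticePoint := by
  obtain ⟨K, -, hK⟩ := M.exists_abs_le_latticePoint
  intro z z' h
  have h0 := hK (z - z')
  rw [← latticePoint_sub, h, sub_self, norm_zero, mul_zero] at h0
  have h1 : ((z - z').1 : ℝ) = 0 := abs_nonpos_iff.1 h0.1
  have h2 : ((z - z').2 : ℝ) = 0 := abs_nonpos_iff.1 h0.2
  norm_cast at h1 h2
  exact sub_eq_zero.1 (Prod.ext h1 h2)

theorem finite_latticePoint_le (r : ℝ) : {z : ℤ × ℤ | ‖M.latticePoint z‖ ≤ r}.Finite := by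
  refine Set.Finite.subset ((homLattice_finite M.lattice.det_ne_zero r).preimage
    M.latticePoint_injective.injOn) fun z hz => ⟨M.latticePoint_mem z, ?_⟩
  rwa [mem_closedBall_zero_iff]

theorem latticePoint_mem_atoms {z : ℤ × ℤ} (hz : M.lattice.RDEF < ‖M.latticePoint z‖) :
    M.latticePoint z ∈ M.Λ :=
  (M.lattice.mem_iff_of_lt hz).2 (M.latticePoint_mem z)

open Classical in
/-- The atom at the lattice point `z`, or the atom `p₀` for the lattice points of the core. -/
def siteOf (p₀ : M.Λ) (z : ℤ × ℤ) : M.Λ :=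
  if h : M.lattice.RDEF < ‖M.latticePoint z‖ then ⟨_, M.latticePoint_mem_atoms h⟩ else p₀

variable {M}

theorem dist_siteOf_le (p₀ : M.Λ) (z : ℤ × ℤ) :
    dist (M.siteOf p₀ z : Plane) (M.latticePoint z) ≤ ‖(p₀ : Plane)‖ + M.lattice.RDEF := by
  rw [siteOf]
  split_ifs with h
  · rw [dist_self]
    have := M.lattice.RDEF_pos
    positivity
  · rw [dist_eq_norm]
    exact (norm_sub_le _ _).trans (by linarith)

theorem dist_siteOf_siteOf_le (p₀ : M.Λ) (z z' : ℤ × ℤ) :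
    dist (M.siteOf p₀ z : Plane) (M.siteOf p₀ z') ≤
      2 * (‖(p₀ : Plane)‖ + M.lattice.RDEF) + ‖M.latticePoint (z' - z)‖ := by
  have h1 := dist_siteOf_le p₀ z
  have h2 := dist_siteOf_le p₀ z'
  have h3 : dist (M.latticePoint z) (M.latticePoint z') = ‖M.latticePoint (z' - z)‖ := by
    rw [dist_comm, dist_eq_norm, latticePoint_sub]
  have h4 := dist_triangle4 (M.siteOf p₀ z : Plane) (M.latticePoint z) (M.latticePoint z')
    (M.siteOf p₀ z')
  rw [dist_comm (M.latticePoint z') _] at h4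
  linarith

variable (M) in
-- Outside the core distinct lattice points give distinct atoms; the finitely many core points are
-- all sent to one atom.
theorem card_siteOf_fiber_le (p₀ : M.Λ) : ∃ m : ℕ, ∀ (s : Finset (ℤ × ℤ)) (p : M.Λ)
    [DecidablePred fun z => M.siteOf p₀ z = p], (s.filter fun z => M.siteOf p₀ z = p).card ≤ m := by
  classical
  let Z := (M.finite_latticePoint_le M.lattice.RDEF).toFinset
  refine ⟨Z.card + 1, fun s p _ => ?_⟩
  have hfar : (s.filter fun z => M.latticePoint z = p).card ≤ 1 :=
    Finset.card_le_one.2 fun z hz z' hz' => M.latticePoint_injective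
      ((Finset.mem_filter.1 hz).2.trans (Finset.mem_filter.1 hz').2.symm)
  refine (Finset.card_le_card (t := Z ∪ s.filter fun z => M.latticePoint z = p) ?_).trans
    ((Finset.card_union_le _ _).trans (by omega))
  intro z hz
  obtain ⟨hz1, hz2⟩ := Finset.mem_filter.1 hz
  by_cases h : M.lattice.RDEF < ‖M.latticePoint z‖
  · refine Finset.mem_union_right _ (Finset.mem_filter.2 ⟨hz1, ?_⟩)
    rw [← hz2, siteOf, dif_pos h]
  · refine Finset.mem_union_left _ ?_
    simpa [Z] using h

/-- A Poincaré inequality for displacements of the defective lattice. -/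
theorem exists_poincare (M : AtomisticModel) {r₀ : ℝ} (hr₀ : 0 < r₀) :
    ∃ C > 0, ∃ r₁ : ℝ, ∀ ρ ≥ r₀, ∀ (v : M.Λ → Plane) (B : ℝ), SumLe (M.locEnergy r₁ v) B →
      ∃ c : Plane, ∀ W : Finset M.Λ, (∀ p ∈ W, ‖(p : Plane)‖ ≤ ρ) →
        ∑ p ∈ W, ‖v p - c‖ ^ 2 ≤ C * ρ ^ 2 * B := by
  classical
  obtain ⟨p₀⟩ := M.nonempty_atoms
  obtain ⟨K, hK, hKz⟩ := M.exists_abs_le_latticePoint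
  obtain ⟨m, hm⟩ := M.card_siteOf_fiber_le p₀
  obtain ⟨m', hm'⟩ := M.card_nb_le M.lattice.RDEF
  have hRD := M.lattice.RDEF_pos
  -- One step on the grid moves the attached atom by at most this much: two displacements caused by
  -- the core, plus a lattice generator.
  set r₁ := 2 * (‖(p₀ : Plane)‖ + M.lattice.RDEF) + ‖M.latticePoint (1, 0)‖
    + ‖M.latticePoint (0, 1)‖ with hr₁
  refine ⟨(1 + 2 * m') * (2 * (2 * K + 3 / r₀) ^ 2 * (2 * m)) + 2 * m' / r₀ ^ 2 + 1,
    by positivity, r₁, fun ρ hρ v B hB => ?_⟩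
  have hρ0 : 0 < ρ := hr₀.trans_le hρ
  have hB0 := hB.nonneg
  -- Lattice points of norm at most ρ have integer coordinates in [-n, n]; the grid is shifted by n
  -- to start at zero.
  set n := ⌈K * ρ⌉₊ with hn
  set N := 2 * n + 1 with hN
  let z : ℕ × ℕ → ℤ × ℤ := fun i => ((i.1 : ℤ) - n, (i.2 : ℤ) - n)
  have hz : Function.Injective z := by
    intro i j h
    simp only [z, Prod.mk.injEq, sub_left_inj, Nat.cast_inj] at h
    exact Prod.ext h.1 h.2
  let f : ℕ → ℕ → Plane := fun i j => v (M.siteOf p₀ (z (i, j)))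
  obtain ⟨c, hc⟩ := exists_grid_poincare f (N := N) (by omega)
  set G := ∑ i ∈ Finset.range N, ∑ j ∈ Finset.range N, ‖f i j - c‖ ^ 2 with hG
  have hG' : G = ∑ i ∈ Finset.range N ×ˢ Finset.range N, ‖v (M.siteOf p₀ (z i)) - c‖ ^ 2 := by
    rw [hG, Finset.sum_product]
  have hG0 : 0 ≤ G := Finset.sum_nonneg fun _ _ => Finset.sum_nonneg fun _ _ => sq_nonneg _
  have hloc : ∑ i ∈ Finset.range N, ∑ j ∈ Finset.range N,
      (‖f (i + 1) j - f i j‖ ^ 2 + ‖f i (j + 1) - f i j‖ ^ 2) ≤ 2 * m * B := by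
    have h1 : ∀ i j, ‖f (i + 1) j - f i j‖ ^ 2 + ‖f i (j + 1) - f i j‖ ^ 2
        ≤ 2 * M.locEnergy r₁ v (M.siteOf p₀ (z (i, j))) := by
      intro i j
      have h2 : ‖f (i + 1) j - f i j‖ ^ 2 ≤ M.locEnergy r₁ v (M.siteOf p₀ (z (i, j))) := by
        refine sq_le_locEnergy v ((dist_siteOf_siteOf_le _ _ _).trans ?_)
        rw [show z (i + 1, j) - z (i, j) = (1, 0) by simp [z]]
        linarith [norm_nonneg (M.latticePoint (0, 1))]
      have h3 : ‖f i (j + 1) - f i j‖ ^ 2 ≤ M.locEnergy r₁ v (M.siteOf p₀ (z (i, j))) := by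
        refine sq_le_locEnergy v ((dist_siteOf_siteOf_le _ _ _).trans ?_)
        rw [show z (i, j + 1) - z (i, j) = (0, 1) by simp [z]]
        linarith [norm_nonneg (M.latticePoint (1, 0))]
      linarith
    refine (Finset.sum_le_sum fun i _ => Finset.sum_le_sum fun j _ => h1 i j).trans ?_
    simp only [← Finset.mul_sum]
    rw [← Finset.sum_product' (f := fun i j => M.locEnergy r₁ v (M.siteOf p₀ (z (i, j)))),
      mul_assoc]
    refine mul_le_mul_of_nonneg_left ?_ two_pos.le
    rw [← Finset.sum_image (s := Finset.range N ×ˢ Finset.range N) (g := z)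
      (f := fun z => M.locEnergy r₁ v (M.siteOf p₀ z)) hz.injOn,
      Finset.sum_comp (M.locEnergy r₁ v) (M.siteOf p₀)]
    refine le_trans (Finset.sum_le_sum fun p _ => ?_)
      ((Finset.mul_sum _ _ _).symm.trans_le (mul_le_mul_of_nonneg_left (hB _) (Nat.cast_nonneg m)))
    rw [nsmul_eq_mul]
    exact mul_le_mul_of_nonneg_right (by exact_mod_cast hm _ _) (locEnergy_nonneg _ _ _)
  -- The 3 comes from 2(Kρ + 1) + 1; it is absorbed by means of ρ ≥ r₀.
  have hNρ : (N : ℝ) ≤ (2 * K + 3 / r₀) * ρ := by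
    have h1 : (n : ℝ) < K * ρ + 1 := Nat.ceil_lt_add_one (by positivity)
    have h2 : 3 ≤ 3 / r₀ * ρ := by
      rw [div_mul_eq_mul_div, le_div_iff₀ hr₀]
      linarith
    rw [hN]
    push_cast
    linarith
  have hGB : G ≤ 2 * (2 * K + 3 / r₀) ^ 2 * (2 * m) * ρ ^ 2 * B := by
    refine hc.trans ?_
    calc _ ≤ 2 * ((2 * K + 3 / r₀) * ρ) ^ 2 * (2 * m * B) := by gcongr
      _ = _ := by ring
  refine ⟨c, fun W hW => ?_⟩
  rw [← Finset.sum_filter_add_sum_filter_not W fun p : M.Λ => M.lattice.RDEF < ‖(p : Plane)‖]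
  -- Every atom outside the core is attached to a grid point, so its term already occurs in the grid
  -- sum.
  have hfar : ∑ p ∈ W.filter (fun p : M.Λ => M.lattice.RDEF < ‖(p : Plane)‖), ‖v p - c‖ ^ 2
      ≤ G := by
    have hex : ∀ p ∈ W.filter (fun p : M.Λ => M.lattice.RDEF < ‖(p : Plane)‖),
        ∃ i ∈ Finset.range N ×ˢ Finset.range N, M.siteOf p₀ (z i) = p := by
      intro p hp
      obtain ⟨hpW, hpR⟩ := Finset.mem_filter.1 hp
      obtain ⟨y, hy⟩ := M.exists_latticePoint ((M.lattice.mem_iff_of_lt hpR).1 p.2)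
      have hyn : ∀ a : ℤ, |(a : ℝ)| ≤ K * ‖M.latticePoint y‖ → -(n : ℤ) ≤ a ∧ a ≤ n := by
        intro a ha
        have : |(a : ℝ)| ≤ n := ha.trans ((mul_le_mul_of_nonneg_left
          (hy ▸ hW p hpW) hK.le).trans (Nat.le_ceil _))
        rw [abs_le] at this
        exact ⟨by exact_mod_cast this.1, by exact_mod_cast this.2⟩
      have h1 := hyn _ (hKz y).1
      have h2 := hyn _ (hKz y).2
      refine ⟨((y.1 + n).toNat, (y.2 + n).toNat), ?_, ?_⟩
      · simp only [Finset.mem_product, Finset.mem_range]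
        omega
      · have hzy : z ((y.1 + n).toNat, (y.2 + n).toNat) = y := by
          refine Prod.ext ?_ ?_
          · simp only [z]; omega
          · simp only [z]; omega
        rw [hzy]
        refine Subtype.ext ?_
        rw [siteOf, dif_pos (by rwa [hy])]
        exact hy
    choose! i hi hip using hex
    rw [hG']
    calc _ = ∑ p ∈ W.filter (fun p : M.Λ => M.lattice.RDEF < ‖(p : Plane)‖),
          ‖v (M.siteOf p₀ (z (i p))) - c‖ ^ 2 :=
          Finset.sum_congr rfl fun p hp => by rw [hip p hp]
      _ = ∑ j ∈ (W.filter (fun p : M.Λ => M.lattice.RDEF < ‖(p : Plane)‖)).image i,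
          ‖v (M.siteOf p₀ (z j)) - c‖ ^ 2 := by
          rw [Finset.sum_image]
          intro p hp q hq h
          rw [← hip p hp, ← hip q hq, h]
      _ ≤ _ := by
          refine Finset.sum_le_sum_of_subset_of_nonneg ?_ fun _ _ _ => sq_nonneg _
          intro j hj
          obtain ⟨p, hp, rfl⟩ := Finset.mem_image.1 hj
          exact hi p hp
  -- The boundedly many core atoms are compared with p₀, whose value occurs at the centre of the
  -- grid because the lattice point 0 lies in the core.
  have hnear : ∑ p ∈ W.filter (fun p : M.Λ => ¬ M.lattice.RDEF < ‖(p : Plane)‖), ‖v p - c‖ ^ 2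
      ≤ m' * (2 * B + 2 * G) := by
    have h0 : ‖v p₀ - c‖ ^ 2 ≤ G := by
      have h1 : M.siteOf p₀ (z (n, n)) = p₀ := by
        have : M.latticePoint (z (n, n)) = 0 := by
          rw [show z (n, n) = 0 - 0 by simp [z], ← latticePoint_sub, sub_self]
        rw [siteOf, dif_neg]
        rw [this, norm_zero]
        exact hRD.not_gt
      rw [hG']
      have := Finset.single_le_sum (f := fun i => ‖v (M.siteOf p₀ (z i)) - c‖ ^ 2)
        (s := Finset.range N ×ˢ Finset.range N) (fun _ _ => sq_nonneg _) (a := (n, n))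
        (by simp only [Finset.mem_product, Finset.mem_range]; omega)
      simpa only [h1] using this
    have h1 : ∀ p ∈ W.filter (fun p : M.Λ => ¬ M.lattice.RDEF < ‖(p : Plane)‖),
        ‖v p - c‖ ^ 2 ≤ 2 * B + 2 * G := by
      intro p hp
      have hpR := (Finset.mem_filter.1 hp).2
      have h2 : ‖v p - v p₀‖ ^ 2 ≤ B := by
        refine (sq_le_locEnergy (r := r₁) v ?_).trans (hB.apply_le p₀)
        rw [dist_eq_norm]
        have := norm_sub_le (p₀ : Plane) p
        have := norm_nonneg (M.latticePoint (1, 0))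
        have := norm_nonneg (M.latticePoint (0, 1))
        have := norm_nonneg (p₀ : Plane)
        linarith
      have h3 := norm_add_sq_le (v p - v p₀) (v p₀ - c)
      rw [sub_add_sub_cancel] at h3
      linarith
    refine (Finset.sum_le_card_nsmul _ _ _ h1).trans ?_
    rw [nsmul_eq_mul]
    refine mul_le_mul_of_nonneg_right ?_ (by positivity)
    have : (W.filter (fun p : M.Λ => ¬ M.lattice.RDEF < ‖(p : Plane)‖)).card ≤ m' := by
      refine (Finset.card_le_card fun p hp => ?_).trans (hm' 0)
      have hpR := (Finset.mem_filter.1 hp).2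
      rw [mem_nb, dist_zero_left]
      exact not_lt.1 hpR
    exact_mod_cast this
  have h1 : (m' : ℝ) * (2 * B) ≤ 2 * m' / r₀ ^ 2 * ρ ^ 2 * B := by
    have : 1 ≤ ρ ^ 2 / r₀ ^ 2 := by
      rw [le_div_iff₀ (by positivity), one_mul]
      gcongr
    calc (m' : ℝ) * (2 * B) = 1 * (m' * (2 * B)) := by ring
      _ ≤ ρ ^ 2 / r₀ ^ 2 * (m' * (2 * B)) := by gcongr
      _ = _ := by ring
  have h2 : (1 + 2 * (m' : ℝ)) * G
      ≤ (1 + 2 * m') * (2 * (2 * K + 3 / r₀) ^ 2 * (2 * m) * ρ ^ 2 * B) := by gcongr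
  have h3 : 0 ≤ ρ ^ 2 * B := by positivity
  nlinarith

end AtomisticModel
end BlendedAC
end

/-! ### Site potentials: uniform bounds, and the forces in the reference configuration. -/

noncomputable section
namespace BlendedAC
namespace AtomisticModel
variable {M : AtomisticModel}

theorem stencil_add (u v : M.Λ → Plane) (k : M.Λ) :
    M.lattice.stencil (u + v) k = M.lattice.stencil u k + M.lattice.stencil v k := by
  funext ρ
  simp only [DefectLattice.stencil, Pi.add_apply]
  abel

theorem stencil_smul (t : ℝ) (u : M.Λ → Plane) (k : M.Λ) :
    M.lattice.stencil (t • u) k = t • M.lattice.stencil u k := by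
  funext ρ
  simp [DefectLattice.stencil, smul_sub]

theorem stencil_zero (k : M.Λ) : M.lattice.stencil (0 : M.Λ → Plane) k = 0 := by
  funext ρ
  simp [DefectLattice.stencil]

theorem stencil_sum {ι : Type*} (s : Finset ι) (u : ι → M.Λ → Plane) (k : M.Λ) :
    M.lattice.stencil (∑ i ∈ s, u i) k = ∑ i ∈ s, M.lattice.stencil (u i) k := by
  classical
  induction s using Finset.induction_on with
  | empty => simp [stencil_zero]
  | insert a s ha ih => rw [Finset.sum_insert ha, Finset.sum_insert ha, stencil_add, ih]

theorem dist_add_range (k : M.Λ) (ρ : interactionRange M.Λ M.lattice.rcut k) :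
    dist (k : Plane) ((k : Plane) + ρ) ≤ M.lattice.rcut := by
  rw [dist_self_add_right]
  exact ρ.2.2.1

theorem stencil_eq_of_eqOn {u v : M.Λ → Plane} {k : M.Λ}
    (h : ∀ q ∈ M.nb M.lattice.rcut k, u q = v q) :
    M.lattice.stencil u k = M.lattice.stencil v k := by
  funext ρ
  have hk : k ∈ M.nb M.lattice.rcut k := by
    rw [mem_nb, dist_self]
    exact M.lattice.rcut_pos.le
  simp only [DefectLattice.stencil]
  rw [h k hk, h ⟨_, ρ.2.2.2⟩ (mem_nb.2 (dist_add_range k ρ))]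

theorem norm_stencil_sq_le (u : M.Λ → Plane) (k : M.Λ) :
    ‖M.lattice.stencil u k‖ ^ 2 ≤ M.locEnergy M.lattice.rcut u k := by
  have h : ‖M.lattice.stencil u k‖ ≤ √(M.locEnergy M.lattice.rcut u k) := by
    refine (pi_norm_le_iff_of_nonneg (Real.sqrt_nonneg _)).2 fun ρ => ?_
    refine Real.le_sqrt_of_sq_le (sq_le_locEnergy u (q := ⟨_, ρ.2.2.2⟩) ?_)
    exact dist_add_range k ρ
  exact (pow_le_pow_left₀ (norm_nonneg _) h 2).trans_eq (Real.sq_sqrt (locEnergy_nonneg _ _ _))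

theorem range_eq_of_far {k : M.Λ} (hk : M.lattice.RDEF + M.lattice.rcut < ‖(k : Plane)‖) :
    interactionRange M.Λ M.lattice.rcut k
      = interactionRange (homLattice M.lattice.A) M.lattice.rcut 0 := by
  have hkh : (k : Plane) ∈ homLattice M.lattice.A :=
    (M.lattice.mem_iff_of_lt (by linarith [M.lattice.rcut_pos])).1 k.2
  ext ρ
  simp only [interactionRange, Set.mem_ofPred_eq, zero_add]
  refine and_congr_right fun _ => and_congr_right fun hρ => ?_
  have : M.lattice.RDEF < ‖(k : Plane) + ρ‖ := by
    have := norm_sub_le ((k : Plane) + ρ) ρ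
    rw [add_sub_cancel_right] at this
    linarith
  rw [M.lattice.mem_iff_of_lt this]
  constructor
  · intro h
    simpa using homLattice_sub h hkh
  · exact homLattice_add hkh

/-- Interaction ranges of different sites are equal sets but distinct types, so the property is
quantified over the set. Extension by zero shows that agreement on functions of the plane is
agreement everywhere. -/
theorem transfer_potential {P : ∀ (S : Set Plane) [Fintype S], ((S → Plane) → ℝ) → Prop}
    {S S' : Set Plane} (h : S = S') [i : Fintype S] [i' : Fintype S'] {V : (S → Plane) → ℝ}
    {V' : (S' → Plane) → ℝ} (hV : ∀ g : Plane → Plane, V (fun ρ => g ρ) = V' (fun ρ => g ρ))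
    (hP : P S V) : P S' V' := by
  classical
  subst h
  obtain rfl := Subsingleton.elim i i'
  have : V = V' := by
    funext g
    have := hV fun x => if hx : x ∈ S then g ⟨x, hx⟩ else 0
    simpa using this
  rwa [← this]

/-- Constants that exist for every smooth potential can be chosen uniformly for the model. -/
theorem exists_uniform_potential (M : AtomisticModel)
    {P : ∀ (S : Set Plane) [Fintype S], ((S → Plane) → ℝ) → ℝ → Prop}
    (hP : ∀ (S : Set Plane) [Fintype S] (V : (S → Plane) → ℝ), ContDiff ℝ 2 V → ∃ C, P S V C)
    (hmono : ∀ (S : Set Plane) [Fintype S] (V : (S → Plane) → ℝ) C C', C ≤ C' → P S V C →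
      P S V C') :
    ∃ C > 0, ∀ k : M.Λ, P (interactionRange M.Λ M.lattice.rcut k) (M.V k) C := by
  have key : ∀ s : Set M.Λ, s.Finite → ∃ C > 0, ∀ k ∈ s,
      P (interactionRange M.Λ M.lattice.rcut k) (M.V k) C := fun s hs =>
    exists_forall_mem_of_finite hs (fun k _ => hP _ _ (M.V_contDiff k))
      fun k C C' h => hmono _ _ C C' h
  have hfin : {k : M.Λ | ‖(k : Plane)‖ ≤ M.lattice.RDEF + M.lattice.rcut}.Finite := by
    simpa [dist_zero_left] using M.nb_finite (M.lattice.RDEF + M.lattice.rcut) 0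
  -- Away from the core all sites carry the same potential, so one distant representative and the
  -- finitely many near sites suffice.
  by_cases hex : ∃ k₀ : M.Λ, M.lattice.RDEF + M.lattice.rcut < ‖(k₀ : Plane)‖
  · obtain ⟨k₀, hk₀⟩ := hex
    obtain ⟨C, hC, h⟩ := key _ (hfin.insert k₀)
    refine ⟨C, hC, fun k => ?_⟩
    by_cases hk : M.lattice.RDEF + M.lattice.rcut < ‖(k : Plane)‖
    · refine transfer_potential (P := fun S _ V => P S V C)
        ((range_eq_of_far hk₀).trans (range_eq_of_far hk).symm) (fun g => ?_)
        (h k₀ (Set.mem_insert _ _))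
      rw [M.V_hom k₀ hk₀, M.V_hom k hk]
    · exact h k (Set.mem_insert_of_mem _ (not_lt.1 hk))
  · obtain ⟨C, hC, h⟩ := key _ hfin
    push Not at hex
    exact ⟨C, hC, fun k => h k (hex k)⟩

theorem exists_norm_le_of_continuous {X F : Type*} [NormedAddCommGroup X] [ProperSpace X]
    [NormedAddCommGroup F] {f : X → F} (hf : Continuous f) (r : ℝ) :
    ∃ C, ∀ g : X, ‖g‖ ≤ r → ‖f g‖ ≤ C := by
  obtain ⟨C, hC⟩ := (isCompact_closedBall (0 : X) r).exists_bound_of_continuousOn hf.continuousOn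
  exact ⟨C, fun g hg => hC g (mem_closedBall_zero_iff.2 hg)⟩

/-- Uniform continuity on the ball of radius r + 1. The increment is bounded by 1/C so that the
property persists when C grows, as `exists_uniform_potential` requires. -/
theorem exists_norm_sub_le_of_continuous {X F : Type*} [NormedAddCommGroup X] [ProperSpace X]
    [NormedAddCommGroup F] {f : X → F} (hf : Continuous f) (r : ℝ) {ε : ℝ} (hε : 0 < ε) :
    ∃ C > 0, ∀ g g' : X, ‖g‖ ≤ r → ‖g'‖ ≤ 1 / C → ‖f (g + g') - f g‖ ≤ ε := by
  have hu := (isCompact_closedBall (0 : X) (r + 1)).uniformContinuousOn_of_continuous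
    hf.continuousOn
  obtain ⟨δ, hδ, h⟩ := Metric.uniformContinuousOn_iff.1 hu ε hε
  refine ⟨1 / (min (δ / 2) 1), by positivity, fun g g' hg hg' => ?_⟩
  rw [one_div_one_div, le_min_iff] at hg'
  rw [← dist_eq_norm]
  refine (h _ ?_ _ ?_ ?_).le
  · rw [mem_closedBall_zero_iff]
    exact (norm_add_le _ _).trans (by linarith)
  · rw [mem_closedBall_zero_iff]
    linarith
  · rw [dist_self_add_left]
    linarith

theorem continuous_fderiv_fderiv {X : Type*} [NormedAddCommGroup X] [NormedSpace ℝ X]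
    {V : X → ℝ} (hV : ContDiff ℝ 2 V) : Continuous (fderiv ℝ (fderiv ℝ V)) :=
  (hV.fderiv_right (m := 1) (by norm_num)).continuous_fderiv one_ne_zero

variable (M) in
/-- The second derivative of a site potential. -/
def hess (k : M.Λ) (g : interactionRange M.Λ M.lattice.rcut k → Plane) :=
  fderiv ℝ (fderiv ℝ (M.V k)) g

theorem exists_norm_hess_le (M : AtomisticModel) (r : ℝ) : ∃ C > 0, ∀ (k : M.Λ)
    (g : interactionRange M.Λ M.lattice.rcut k → Plane), ‖g‖ ≤ r → ‖M.hess k g‖ ≤ C := by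
  refine M.exists_uniform_potential
    (P := fun S _ V C => ∀ g : S → Plane, ‖g‖ ≤ r → ‖fderiv ℝ (fderiv ℝ V) g‖ ≤ C) ?_ ?_
  · intro S _ V hV
    exact exists_norm_le_of_continuous (F := (S → Plane) →L[ℝ] (S → Plane) →L[ℝ] ℝ)
      (continuous_fderiv_fderiv hV) r
  · intro S _ V C C' h hP g hg
    exact (hP g hg).trans h

theorem exists_hess_sub_le (M : AtomisticModel) (r : ℝ) {ε : ℝ} (hε : 0 < ε) :
    ∃ δ > 0, ∀ (k : M.Λ) (g g' : interactionRange M.Λ M.lattice.rcut k → Plane), ‖g‖ ≤ r →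
      ‖g'‖ ≤ δ → ‖M.hess k (g + g') - M.hess k g‖ ≤ ε := by
  -- Positivity of C is part of the property because monotonicity of 1/C depends on it.
  have key : ∃ C > 0, ∀ k : M.Λ, 0 < C ∧ ∀ g g' : interactionRange M.Λ M.lattice.rcut k → Plane,
      ‖g‖ ≤ r → ‖g'‖ ≤ 1 / C → ‖M.hess k (g + g') - M.hess k g‖ ≤ ε := by
    refine M.exists_uniform_potential
      (P := fun S _ V C => 0 < C ∧ ∀ g g' : S → Plane, ‖g‖ ≤ r → ‖g'‖ ≤ 1 / C →
        ‖fderiv ℝ (fderiv ℝ V) (g + g') - fderiv ℝ (fderiv ℝ V) g‖ ≤ ε) ?_ ?_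
    · intro S _ V hV
      obtain ⟨C, hC, h⟩ := exists_norm_sub_le_of_continuous
        (F := (S → Plane) →L[ℝ] (S → Plane) →L[ℝ] ℝ) (continuous_fderiv_fderiv hV) r hε
      exact ⟨C, hC, h⟩
    · rintro S _ V C C' h ⟨hC, hP⟩
      refine ⟨hC.trans_le h, fun g g' hg hg' => hP g g' hg (hg'.trans ?_)⟩
      exact one_div_le_one_div_of_le hC h
  obtain ⟨C, hC, h⟩ := key
  exact ⟨1 / C, by positivity, fun k => (h k).2⟩

theorem hasFDerivAt_V (k : M.Λ) (g : interactionRange M.Λ M.lattice.rcut k → Plane) :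
    HasFDerivAt (M.V k) (fderiv ℝ (M.V k) g) g :=
  (((M.V_contDiff k).differentiable two_ne_zero) g).hasFDerivAt

theorem hasFDerivAt_fderiv_V (k : M.Λ) (g : interactionRange M.Λ M.lattice.rcut k → Plane) :
    HasFDerivAt (fderiv ℝ (M.V k)) (M.hess k g) g :=
  ((((M.V_contDiff k).fderiv_right (m := 1) (by norm_num)).differentiable one_ne_zero)
    g).hasFDerivAt

theorem norm_fderiv_V_sub_le {r C : ℝ} {k : M.Λ}
    (hC : ∀ g : interactionRange M.Λ M.lattice.rcut k → Plane, ‖g‖ ≤ r → ‖M.hess k g‖ ≤ C)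
    {g : interactionRange M.Λ M.lattice.rcut k → Plane} (hg : ‖g‖ ≤ r) :
    ‖fderiv ℝ (M.V k) g - fderiv ℝ (M.V k) 0‖ ≤ C * ‖g‖ := by
  have := (convex_closedBall (0 : interactionRange M.Λ M.lattice.rcut k → Plane)
    r).norm_image_sub_le_of_norm_hasFDerivWithin_le (f := fderiv ℝ (M.V k)) (f' := M.hess k) (C := C)
    (fun x _ => (hasFDerivAt_fderiv_V k x).hasFDerivWithinAt)
    (fun x hx => hC x (mem_closedBall_zero_iff.1 hx)) (x := 0) (y := g)
    (by simpa using (norm_nonneg g).trans hg) (mem_closedBall_zero_iff.2 hg)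
  simpa using this

/-- Two applications of the mean value inequality. The quadratic bound makes the renormalised energy
series converge for square summable strains. -/
theorem abs_V_sub_le {r C : ℝ} {k : M.Λ}
    (hC : ∀ g : interactionRange M.Λ M.lattice.rcut k → Plane, ‖g‖ ≤ r → ‖M.hess k g‖ ≤ C)
    {g : interactionRange M.Λ M.lattice.rcut k → Plane} (hg : ‖g‖ ≤ r) :
    |M.V k g - fderiv ℝ (M.V k) 0 g| ≤ C * ‖g‖ ^ 2 := by
  have hC0 : 0 ≤ C := (norm_nonneg (M.hess k g)).trans (hC g hg)
  have := (convex_closedBall (0 : interactionRange M.Λ M.lattice.rcut k → Plane)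
    ‖g‖).norm_image_sub_le_of_norm_hasFDerivWithin_le
    (f := fun x => M.V k x - fderiv ℝ (M.V k) 0 x)
    (f' := fun x => fderiv ℝ (M.V k) x - fderiv ℝ (M.V k) 0) (C := C * ‖g‖)
    (fun x _ => ((hasFDerivAt_V k x).sub (fderiv ℝ (M.V k) 0).hasFDerivAt).hasFDerivWithinAt)
    (fun x hx => ?_) (x := 0) (y := g) (by simp) (by simp)
  · simpa [M.V_zero, sq, mul_assoc] using this
  · rw [mem_closedBall_zero_iff] at hx
    exact (norm_fderiv_V_sub_le hC (hx.trans hg)).trans (mul_le_mul_of_nonneg_left hx hC0)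

/-- Both sides are the derivative of `Vhom` along the ray through g. Only the ray is needed, so
differentiability of `Vhom` is not used. -/
theorem fderiv_V_far {k k' : M.Λ} (hk : M.lattice.RDEF + M.lattice.rcut < ‖(k : Plane)‖)
    (hk' : M.lattice.RDEF + M.lattice.rcut < ‖(k' : Plane)‖) (g : Plane → Plane) :
    fderiv ℝ (M.V k) 0 (fun ρ => g ρ) = fderiv ℝ (M.V k') 0 (fun ρ => g ρ) := by
  have h : ∀ k : M.Λ, M.lattice.RDEF + M.lattice.rcut < ‖(k : Plane)‖ →
      fderiv ℝ (M.V k) 0 (fun ρ => g ρ) = deriv (fun t : ℝ => M.Vhom fun ρ => t • g ρ) 0 := by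
    intro k hk
    have h1 : HasDerivAt (fun t : ℝ => M.V k (t • fun ρ : interactionRange M.Λ M.lattice.rcut k =>
        g ρ))
        (fderiv ℝ (M.V k) 0 (fun ρ => g ρ)) 0 := by
      have h2 : HasDerivAt (fun t : ℝ => t • (fun ρ : interactionRange M.Λ M.lattice.rcut k =>
          g ρ)) (fun ρ => g ρ) 0 := by
        simpa using (hasDerivAt_id (0 : ℝ)).smul_const
          (fun ρ : interactionRange M.Λ M.lattice.rcut k => g ρ)
      have h3 := hasFDerivAt_V k (0 : interactionRange M.Λ M.lattice.rcut k → Plane)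
      rw [← zero_smul ℝ (fun ρ : interactionRange M.Λ M.lattice.rcut k => g ρ)] at h3
      have h4 := h3.comp_hasDerivAt (0 : ℝ) h2
      rw [zero_smul] at h4
      exact h4
    rw [← h1.deriv]
    congr 1
    funext t
    exact M.V_hom k hk fun x => t • g x
  rw [h k hk, h k' hk']

/-- Summation by parts in the perfect lattice: the first order part of the energy vanishes on
displacements that are constant near the defect core and vanish at infinity. -/
theorem finsum_fderiv_V_zero (χ : Plane → Plane) {R : ℝ} (hR : ∀ x, R < ‖x‖ → χ x = 0)
    {c : Plane} (hc : ∀ x, ‖x‖ ≤ M.lattice.RDEF + 2 * M.lattice.rcut → χ x = c) :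
    ∑ᶠ k : M.Λ, fderiv ℝ (M.V k) 0 (M.lattice.stencil (fun q => χ q) k) = 0 := by
  classical
  have hrc := M.lattice.rcut_pos
  let K : Finset M.Λ := (M.nb (R + M.lattice.rcut) 0).filter
    fun k => M.lattice.RDEF + M.lattice.rcut < ‖(k : Plane)‖
  -- A site within RDEF + rcut has all its neighbours within RDEF + 2 rcut, where χ is constant.
  have hnear : ∀ k x : Plane, ‖k‖ ≤ M.lattice.RDEF + M.lattice.rcut → ‖x‖ ≤ M.lattice.rcut →
      χ (k + x) - χ k = 0 := by
    intro k x hk hx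
    rw [hc k (by linarith), hc (k + x) ((norm_add_le _ _).trans (by linarith)), sub_self]
  have hout : ∀ k x : Plane, R + M.lattice.rcut < ‖k‖ → ‖x‖ ≤ M.lattice.rcut →
      χ (k + x) - χ k = 0 := by
    intro k x hk hx
    have := norm_sub_le (k + x) x
    rw [add_sub_cancel_right] at this
    rw [hR k (by linarith), hR (k + x) (by linarith), sub_self]
  have hsupp : ∀ k ∉ K, M.lattice.stencil (fun q => χ q) k = 0 := by
    intro k hk
    funext ρ
    have : ¬ (‖(k : Plane)‖ ≤ R + M.lattice.rcut ∧
        M.lattice.RDEF + M.lattice.rcut < ‖(k : Plane)‖) := by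
      simpa [K, dist_zero_left] using hk
    by_cases h : R + M.lattice.rcut < ‖(k : Plane)‖
    · exact hout k ρ h ρ.2.2.1
    · refine hnear k ρ ?_ ρ.2.2.1
      by_contra hcon
      exact this ⟨not_lt.1 h, not_le.1 hcon⟩
  rw [finsum_eq_sum_of_support_subset (s := K)]
  swap
  · intro k hk
    by_contra hcon
    exact hk (by simp only [hsupp k hcon, map_zero])
  rcases K.eq_empty_or_nonempty with hK | ⟨k₀, hk₀⟩
  · rw [hK, Finset.sum_empty]
  have hk₀' := (Finset.mem_filter.1 hk₀).2
  -- The remaining sites share one linear functional, so it suffices that the sum of their stencils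
  -- vanishes in each component.
  have h1 : ∀ k ∈ K, fderiv ℝ (M.V k) 0 (M.lattice.stencil (fun q => χ q) k)
      = fderiv ℝ (M.V k₀) 0 (fun ρ => χ (k + ρ) - χ k) := fun k hk =>
    fderiv_V_far (Finset.mem_filter.1 hk).2 hk₀' fun x => χ (k + x) - χ k
  rw [Finset.sum_congr rfl h1, ← map_sum]
  convert map_zero (fderiv ℝ (M.V k₀) 0)
  funext ρ
  rw [Finset.sum_apply, Pi.zero_apply]
  have hρ : (ρ : Plane) ∈ interactionRange (homLattice M.lattice.A) M.lattice.rcut 0 := by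
    rw [← range_eq_of_far hk₀']
    exact ρ.2
  have hρh : (ρ : Plane) ∈ homLattice M.lattice.A := by simpa using hρ.2.2
  have hρn : ‖(ρ : Plane)‖ ≤ M.lattice.rcut := hρ.2.1
  let K' : Finset Plane := (homLattice_finite M.lattice.det_ne_zero (R + M.lattice.rcut)).toFinset
  have hK' : ∀ x, x ∈ K' ↔ x ∈ homLattice M.lattice.A ∧ ‖x‖ ≤ R + M.lattice.rcut := by
    intro x
    simp [K']
  -- The sum is extended to all lattice points of a ball; the added points lie near the core and
  -- contribute zero.
  have h2 : ∑ k ∈ K, (χ (k + ρ) - χ k) = ∑ k ∈ K', (χ (k + ρ) - χ k) := by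
    rw [← Finset.sum_image (s := K) (g := (Subtype.val : M.Λ → Plane))
      (f := fun k => χ (k + ρ) - χ k) Subtype.val_injective.injOn]
    refine Finset.sum_subset ?_ ?_
    · intro x hx
      obtain ⟨k, hk, rfl⟩ := Finset.mem_image.1 hx
      obtain ⟨hk1, hk2⟩ := Finset.mem_filter.1 hk
      rw [hK']
      refine ⟨(M.lattice.mem_iff_of_lt (by linarith)).1 k.2, ?_⟩
      simpa [dist_zero_left] using hk1
    · intro x hx hxK
      rw [hK'] at hx
      refine hnear x ρ ?_ hρn
      by_contra hcon
      rw [not_le] at hcon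
      have hxΛ : x ∈ M.Λ := (M.lattice.mem_iff_of_lt (by linarith)).2 hx.1
      refine hxK (Finset.mem_image.2 ⟨⟨x, hxΛ⟩, Finset.mem_filter.2 ⟨?_, hcon⟩, rfl⟩)
      rw [mem_nb, dist_zero_left]
      exact hx.2
  rw [h2, Finset.sum_sub_distrib, sub_eq_zero]
  -- The ball is not invariant under the shift by ρ, but χ vanishes beyond R, so the shift is a
  -- bijection between the nonzero terms.
  refine Finset.sum_bij_ne_zero (fun x _ _ => x + ρ) ?_ ?_ ?_ ?_
  · intro x hx hne
    rw [hK'] at hx ⊢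
    refine ⟨homLattice_add hx.1 hρh, ?_⟩
    by_contra hcon
    exact hne (hR _ (by linarith))
  · intro x _ _ y _ _ h
    exact add_right_cancel h
  · intro y hy hne
    rw [hK'] at hy
    have hyR : ‖y‖ ≤ R := by
      by_contra hcon
      exact hne (hR _ (not_le.1 hcon))
    refine ⟨y - ρ, (hK' _).2 ⟨homLattice_sub hy.1 hρh, (norm_sub_le _ _).trans (by linarith)⟩,
      ?_, by simp⟩
    simpa using hne
  · intro x _ _
    rfl

variable (M) in
/-- The atoms that may carry a force in the reference configuration. -/
def refCore : Finset M.Λ := M.nb (M.lattice.RDEF + 2 * M.lattice.rcut) 0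

/-- Summation by parts with a unit displacement of the single atom p, which lies too far out to be
seen near the core. -/
theorem refForce_eq_zero {p : M.Λ} (hp : p ∉ M.refCore) : M.refForce p = 0 := by
  classical
  rw [refCore, mem_nb, dist_zero_left, not_le] at hp
  ext i
  have := finsum_fderiv_V_zero (M := M)
    (fun x => if x = p then EuclideanSpace.single i (1 : ℝ) else 0) (R := ‖(p : Plane)‖)
    (fun x hx => if_neg (by rintro rfl; exact lt_irrefl _ hx)) (c := 0)
    (fun x hx => if_neg (by rintro rfl; linarith))
  have h2 : (fun q : M.Λ => if (q : Plane) = p then EuclideanSpace.single i (1 : ℝ) else 0)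
      = M.lattice.unitDisp p i := by
    funext q
    rw [DefectLattice.unitDisp, Pi.single_apply]
    simp [Subtype.ext_iff]
  rw [h2] at this
  exact this

theorem finite_support_unitDisp (p : M.Λ) (i : Fin 2) :
    (M.lattice.unitDisp p i).support.Finite := by
  refine (Set.finite_singleton p).subset fun k hk => ?_
  by_contra h
  exact hk (by simp [DefectLattice.unitDisp, Pi.single_eq_of_ne h])

/-- Summation by parts with a unit displacement of all atoms of `refCore` together. -/
theorem sum_refForce : ∑ p ∈ M.refCore, M.refForce p = 0 := by
  classical
  ext i
  rw [WithLp.ofLp_sum, Finset.sum_apply]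
  simp only [refForce]
  rw [← finsum_sum_comm]
  swap
  · intro p _
    refine (M.stencil_zero_off _ (finite_support_unitDisp p i)).subset fun k hk h => hk ?_
    simp only [h, map_zero]
  have := finsum_fderiv_V_zero (M := M) (fun x => if ‖x‖ ≤ M.lattice.RDEF + 2 * M.lattice.rcut
    then EuclideanSpace.single i (1 : ℝ) else 0) (R := M.lattice.RDEF + 2 * M.lattice.rcut)
    (fun x hx => if_neg (not_le.2 hx)) (c := EuclideanSpace.single i (1 : ℝ))
    (fun x hx => if_pos hx)
  have h2 : (fun q : M.Λ => if ‖(q : Plane)‖ ≤ M.lattice.RDEF + 2 * M.lattice.rcut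
      then EuclideanSpace.single i (1 : ℝ) else 0) = ∑ p ∈ M.refCore, M.lattice.unitDisp p i := by
    funext q
    rw [Finset.sum_apply]
    simp only [DefectLattice.unitDisp, Pi.single_apply]
    rw [Finset.sum_ite_eq]
    simp [refCore, dist_zero_left]
  rw [h2] at this
  simp only [stencil_sum, map_sum] at this
  exact this

end AtomisticModel
end BlendedAC
end

/-! ### First and second variation of the energy; the residual as a sum of forces. -/

noncomputable section
namespace BlendedAC
namespace AtomisticModel
variable {M : AtomisticModel}

/-- The strain of a displacement is square summable. -/
theorem exists_sumLe_stencil (M : AtomisticModel) : ∃ C > 0, ∀ u : M.Λ → Plane,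
    M.IsFiniteEnergy u → SumLe (fun k => ‖M.lattice.stencil u k‖ ^ 2) (C * M.norm12 u ^ 2) := by
  obtain ⟨C, hC, h⟩ := M.exists_sumLe_locEnergy M.lattice.rcut
  exact ⟨C, hC, fun u hu => (h u hu).mono (norm_stencil_sq_le u) le_rfl⟩

theorem IsFiniteEnergy.summable_stencil {u : M.Λ → Plane} (hu : M.IsFiniteEnergy u) :
    Summable fun k => ‖M.lattice.stencil u k‖ ^ 2 := by
  obtain ⟨C, -, h⟩ := M.exists_sumLe_stencil
  exact (h u hu).summable fun _ => sq_nonneg _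

theorem IsFiniteEnergy.summable_mul {u v : M.Λ → Plane} (hu : M.IsFiniteEnergy u)
    (hv : M.IsFiniteEnergy v) :
    Summable fun k => ‖M.lattice.stencil u k‖ * ‖M.lattice.stencil v k‖ := by
  refine Summable.of_nonneg_of_le (fun _ => by positivity) (fun k => ?_)
    (hu.summable_stencil.add hv.summable_stencil)
  nlinarith [sq_nonneg (‖M.lattice.stencil u k‖ - ‖M.lattice.stencil v k‖),
    norm_nonneg (M.lattice.stencil u k), norm_nonneg (M.lattice.stencil v k)]

theorem tsum_mul_le {C : ℝ} (hC : ∀ u : M.Λ → Plane, M.IsFiniteEnergy u →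
    SumLe (fun k => ‖M.lattice.stencil u k‖ ^ 2) (C * M.norm12 u ^ 2)) (hC0 : 0 ≤ C)
    {u v : M.Λ → Plane} (hu : M.IsFiniteEnergy u) (hv : M.IsFiniteEnergy v) :
    ∑' k, ‖M.lattice.stencil u k‖ * ‖M.lattice.stencil v k‖ ≤ C * (M.norm12 u * M.norm12 v) := by
  have e : C * (M.norm12 u * M.norm12 v) = (√C * M.norm12 u) * (√C * M.norm12 v) := by
    rw [mul_mul_mul_comm, Real.mul_self_sqrt hC0]
  have hsq : ∀ w : M.Λ → Plane, (√C * M.norm12 w) ^ 2 = C * M.norm12 w ^ 2 := fun w => by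
    rw [mul_pow, Real.sq_sqrt hC0]
  rw [e]
  refine (hu.summable_mul hv).tsum_le_of_sum_le fun s => ?_
  refine sum_mul_le_of_sq s _ _ (mul_nonneg (Real.sqrt_nonneg _) (norm12_nonneg _))
    (mul_nonneg (Real.sqrt_nonneg _) (norm12_nonneg _)) ?_ ?_
  · rw [hsq]
    exact hC u hu s
  · rw [hsq]
    exact hC v hv s

theorem exists_norm_stencil_le (M : AtomisticModel) : ∃ C > 0, ∀ u : M.Λ → Plane,
    M.IsFiniteEnergy u → ∀ k, ‖M.lattice.stencil u k‖ ≤ C * M.norm12 u := by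
  obtain ⟨C, hC, h⟩ := M.exists_sumLe_stencil
  refine ⟨√C, Real.sqrt_pos.2 hC, fun u hu k => ?_⟩
  refine abs_le_of_sq_le_sq' ?_ (mul_nonneg (Real.sqrt_nonneg _) (norm12_nonneg u)) |>.2
  rw [mul_pow, Real.sq_sqrt hC.le]
  exact (h u hu).apply_le k

theorem finsum_refForce (u : M.Λ → Plane) :
    ∑ᶠ p : M.Λ, ⟪M.refForce p, u p⟫ = ∑ p ∈ M.refCore, ⟪M.refForce p, u p⟫ := by
  refine finsum_eq_sum_of_support_subset _ fun p hp => ?_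
  by_contra h
  exact hp (by simp only [refForce_eq_zero h, inner_zero_left])

variable (M) in
/-- The first variation of the energy, `⟨δE(u), v⟩`. -/
def firstForm (u v : M.Λ → Plane) : ℝ :=
  (∑' k : M.Λ, (fderiv ℝ (M.V k) (M.lattice.stencil u k) - fderiv ℝ (M.V k) 0)
    (M.lattice.stencil v k)) + ∑ p ∈ M.refCore, ⟪M.refForce p, v p⟫

variable (M) in
/-- The second variation of the energy, `⟨δ²E(u) v, w⟩`. -/
def secondForm (u v w : M.Λ → Plane) : ℝ :=
  ∑' k : M.Λ, M.hess k (M.lattice.stencil u k) (M.lattice.stencil v k) (M.lattice.stencil w k)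

theorem hasDerivAt_stencil (u v : M.Λ → Plane) (k : M.Λ) (t : ℝ) :
    HasDerivAt (fun t : ℝ => M.lattice.stencil (u + t • v) k) (M.lattice.stencil v k) t := by
  simp only [stencil_add, stencil_smul]
  simpa using ((hasDerivAt_id t).smul_const (M.lattice.stencil v k)).const_add
    (M.lattice.stencil u k)

/-- The first bound puts all strains into one ball, where the Hessians are uniformly bounded; the
second gives majorants that do not depend on t. -/
theorem exists_norm_stencil_add_smul_le {u v : M.Λ → Plane} (hu : M.IsFiniteEnergy u)
    (hv : M.IsFiniteEnergy v) : ∃ r, ∀ t ∈ Metric.ball (0 : ℝ) 1, ∀ k,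
      ‖M.lattice.stencil (u + t • v) k‖ ≤ r ∧ ‖M.lattice.stencil (u + t • v) k‖
        ≤ ‖M.lattice.stencil u k‖ + ‖M.lattice.stencil v k‖ := by
  obtain ⟨C, -, h⟩ := M.exists_norm_stencil_le
  refine ⟨C * M.norm12 u + C * M.norm12 v, fun t ht k => ?_⟩
  have h1 : ‖M.lattice.stencil (u + t • v) k‖
      ≤ ‖M.lattice.stencil u k‖ + ‖M.lattice.stencil v k‖ := by
    rw [stencil_add, stencil_smul]
    refine (norm_add_le _ _).trans (add_le_add le_rfl ?_)
    rw [norm_smul]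
    refine mul_le_of_le_one_left (norm_nonneg _) ?_
    rw [mem_ball_zero_iff] at ht
    exact ht.le
  exact ⟨h1.trans (add_le_add (h u hu k) (h v hv k)), h1⟩

/-- The series is differentiated term by term. Subtracting the derivative at 0 makes each term of
the derivative at most C(‖Du‖ + ‖Dv‖)‖Dv‖, which is summable. -/
theorem hasDerivAt_energy {u v : M.Λ → Plane} (hu : M.IsFiniteEnergy u)
    (hv : M.IsFiniteEnergy v) :
    HasDerivAt (fun t : ℝ => M.energy (u + t • v)) (M.firstForm u v) 0 := by
  obtain ⟨r, hr⟩ := exists_norm_stencil_add_smul_le hu hv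
  obtain ⟨C, hC, hCb⟩ := M.exists_norm_hess_le r
  have h0 : (0 : ℝ) ∈ Metric.ball (0 : ℝ) 1 := Metric.mem_ball_self one_pos
  have h1 : HasDerivAt (fun t : ℝ => ∑' k : M.Λ, (M.V k (M.lattice.stencil (u + t • v) k)
      - fderiv ℝ (M.V k) 0 (M.lattice.stencil (u + t • v) k)))
      (∑' k : M.Λ, (fderiv ℝ (M.V k) (M.lattice.stencil (u + (0 : ℝ) • v) k)
        - fderiv ℝ (M.V k) 0) (M.lattice.stencil v k)) 0 := by
    refine hasDerivAt_tsum_of_isPreconnected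
      (u := fun k => C * ((‖M.lattice.stencil u k‖ + ‖M.lattice.stencil v k‖)
        * ‖M.lattice.stencil v k‖)) ?_ Metric.isOpen_ball (convex_ball _ _).isPreconnected
      (g' := fun k t => (fderiv ℝ (M.V k) (M.lattice.stencil (u + t • v) k)
        - fderiv ℝ (M.V k) 0) (M.lattice.stencil v k)) ?_ ?_ h0 ?_ h0
    · simp only [add_mul]
      exact ((hu.summable_mul hv).add (hv.summable_mul hv)).mul_left C
    · intro k t _
      have h2 := (hasFDerivAt_V k (M.lattice.stencil (u + t • v) k)).comp_hasDerivAt t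
        (hasDerivAt_stencil u v k t)
      have h3 := (fderiv ℝ (M.V k) 0).hasFDerivAt.comp_hasDerivAt t (hasDerivAt_stencil u v k t)
      exact h2.sub h3
    · intro k t ht
      refine (ContinuousLinearMap.le_opNorm _ _).trans ?_
      rw [← mul_assoc]
      refine mul_le_mul_of_nonneg_right ?_ (norm_nonneg _)
      exact (norm_fderiv_V_sub_le (hCb k) (hr t ht k).1).trans
        (mul_le_mul_of_nonneg_left (hr t ht k).2 hC.le)
    · refine Summable.of_norm_bounded (g := fun k => C * ‖M.lattice.stencil u k‖ ^ 2)
        (hu.summable_stencil.mul_left C) fun k => ?_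
      have h2 := (hr 0 h0 k).1
      rw [zero_smul, add_zero] at h2 ⊢
      exact abs_V_sub_le (hCb k) h2
  have h2 : HasDerivAt (fun t : ℝ => ∑ p ∈ M.refCore, ⟪M.refForce p, (u + t • v) p⟫)
      (∑ p ∈ M.refCore, ⟪M.refForce p, v p⟫) 0 := by
    refine HasDerivAt.fun_sum fun p _ => ?_
    have : (fun t : ℝ => ⟪M.refForce p, (u + t • v) p⟫)
        = fun t => ⟪M.refForce p, u p⟫ + t * ⟪M.refForce p, v p⟫ := by
      funext t
      rw [Pi.add_apply, Pi.smul_apply, inner_add_right, real_inner_smul_right]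
    rw [this]
    simpa using ((hasDerivAt_id (0 : ℝ)).mul_const ⟪M.refForce p, v p⟫).const_add
      ⟪M.refForce p, u p⟫
  have h3 := h1.add h2
  rw [zero_smul, add_zero] at h3
  refine h3.congr_of_eventuallyEq (Filter.Eventually.of_forall fun t => ?_)
  simp only [energy, finsum_refForce, Pi.add_apply]

theorem residual_eq {u v : M.Λ → Plane} (hu : M.IsFiniteEnergy u) (hv : M.IsFiniteEnergy v) :
    M.residual u v = M.firstForm u v := (hasDerivAt_energy hu hv).deriv

theorem exists_sub_sub_le {u : M.Λ → Plane} (hu : M.IsFiniteEnergy u) : ∃ C > 0, ∀ k,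
    ‖fderiv ℝ (M.V k) (M.lattice.stencil u k) - fderiv ℝ (M.V k) 0‖
      ≤ C * ‖M.lattice.stencil u k‖ := by
  obtain ⟨r, hr⟩ := exists_norm_stencil_add_smul_le hu hu
  obtain ⟨C, hC, hCb⟩ := M.exists_norm_hess_le r
  refine ⟨C, hC, fun k => ?_⟩
  have := (hr 0 (Metric.mem_ball_self one_pos) k).1
  rw [zero_smul, add_zero] at this
  exact norm_fderiv_V_sub_le (hCb k) this

theorem summable_firstForm {u v : M.Λ → Plane} (hu : M.IsFiniteEnergy u)
    (hv : M.IsFiniteEnergy v) :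
    Summable fun k => (fderiv ℝ (M.V k) (M.lattice.stencil u k) - fderiv ℝ (M.V k) 0)
      (M.lattice.stencil v k) := by
  obtain ⟨C, hC, h⟩ := exists_sub_sub_le hu
  refine Summable.of_norm_bounded (g := fun k => C * (‖M.lattice.stencil u k‖
    * ‖M.lattice.stencil v k‖)) ((hu.summable_mul hv).mul_left C) fun k => ?_
  refine (ContinuousLinearMap.le_opNorm _ _).trans ?_
  rw [← mul_assoc]
  exact mul_le_mul_of_nonneg_right (h k) (norm_nonneg _)

theorem firstForm_smul (u v : M.Λ → Plane) (t : ℝ) :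
    M.firstForm u (t • v) = t * M.firstForm u v := by
  simp only [firstForm, stencil_smul, map_smul, smul_eq_mul, tsum_mul_left, Pi.smul_apply,
    real_inner_smul_right, ← Finset.mul_sum, mul_add]

theorem firstForm_add {u v w : M.Λ → Plane} (hu : M.IsFiniteEnergy u) (hv : M.IsFiniteEnergy v)
    (hw : M.IsFiniteEnergy w) :
    M.firstForm u (v + w) = M.firstForm u v + M.firstForm u w := by
  simp only [firstForm, stencil_add, map_add, Pi.add_apply, inner_add_right,
    Finset.sum_add_distrib]
  rw [(summable_firstForm hu hv).tsum_add (summable_firstForm hu hw)]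
  ring

/-- Termwise differentiation again, with majorant C‖Dv‖‖Dw‖. -/
theorem hasDerivAt_firstForm {u v w : M.Λ → Plane} (hu : M.IsFiniteEnergy u)
    (hv : M.IsFiniteEnergy v) (hw : M.IsFiniteEnergy w) (s : ℝ) :
    HasDerivAt (fun s : ℝ => M.firstForm (u + s • v) w) (M.secondForm (u + s • v) v w) s := by
  have key : ∀ u : M.Λ → Plane, M.IsFiniteEnergy u →
      HasDerivAt (fun s : ℝ => M.firstForm (u + s • v) w) (M.secondForm u v w) 0 := by
    intro u hu
    obtain ⟨r, hr⟩ := exists_norm_stencil_add_smul_le hu hv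
    obtain ⟨C, hC, hCb⟩ := M.exists_norm_hess_le r
    have h0 : (0 : ℝ) ∈ Metric.ball (0 : ℝ) 1 := Metric.mem_ball_self one_pos
    have h1 : HasDerivAt (fun t : ℝ => ∑' k : M.Λ, (fderiv ℝ (M.V k)
        (M.lattice.stencil (u + t • v) k) - fderiv ℝ (M.V k) 0) (M.lattice.stencil w k))
        (∑' k : M.Λ, M.hess k (M.lattice.stencil (u + (0 : ℝ) • v) k) (M.lattice.stencil v k)
          (M.lattice.stencil w k)) 0 := by
      refine hasDerivAt_tsum_of_isPreconnected
        (u := fun k => C * (‖M.lattice.stencil v k‖ * ‖M.lattice.stencil w k‖))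
        ((hv.summable_mul hw).mul_left C) Metric.isOpen_ball (convex_ball _ _).isPreconnected
        (g' := fun k t => M.hess k (M.lattice.stencil (u + t • v) k) (M.lattice.stencil v k)
          (M.lattice.stencil w k)) ?_ ?_ h0 ?_ h0
      · intro k t _
        have h2 := (hasFDerivAt_fderiv_V k (M.lattice.stencil (u + t • v) k)).comp_hasDerivAt t
          (hasDerivAt_stencil u v k t)
        simpa using (HasDerivAt.sub_const (fderiv ℝ (M.V k) 0) h2).clm_apply
          (hasDerivAt_const t (M.lattice.stencil w k))
      · intro k t ht
        refine (ContinuousLinearMap.le_opNorm₂ _ _ _).trans ?_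
        rw [mul_assoc]
        exact mul_le_mul_of_nonneg_right (hCb k _ (hr t ht k).1) (by positivity)
      · simpa using summable_firstForm hu hw
    rw [zero_smul, add_zero] at h1
    exact h1.add_const _
  -- The derivative at s is the derivative at 0 for the base point moved to u + s v.
  have h := key (u + s • v) (hu.add (hv.smul s))
  have h' := HasDerivAt.comp_sub_const (f := fun t : ℝ => M.firstForm (u + s • v + t • v) w)
    s s (by rw [sub_self]; exact h)
  refine h'.congr_of_eventuallyEq (Filter.Eventually.of_forall fun t => ?_)
  simp only
  rw [add_assoc, ← add_smul, add_sub_cancel]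

theorem secondVariation_eq {u v w : M.Λ → Plane} (hu : M.IsFiniteEnergy u)
    (hv : M.IsFiniteEnergy v) (hw : M.IsFiniteEnergy w) :
    secondVariation M.energy u v w = M.secondForm u v w := by
  have h := (hasDerivAt_firstForm hu hv hw 0).deriv
  rw [zero_smul, add_zero] at h
  rw [← h, secondVariation]
  congr 1
  funext s
  exact residual_eq (hu.add (hv.smul s)) hw

theorem locEnergy_const (r : ℝ) (c : Plane) (p : M.Λ) : M.locEnergy r (fun _ => c) p = 0 := by
  simp [locEnergy]

theorem isFiniteEnergy_const (c : Plane) : M.IsFiniteEnergy fun _ => c := by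
  obtain ⟨C, -, h⟩ := M.exists_norm12_le
  refine (h (fun _ => c) 0 fun s => ?_).1
  simp [locEnergy_const]

theorem unitDisp_decomposition (W : Finset M.Λ) (v : M.Λ → Plane) {q : M.Λ} (hq : q ∈ W) :
    (∑ p ∈ W, ∑ i : Fin 2, v p i • M.lattice.unitDisp p i) q = v q := by
  classical
  rw [Finset.sum_apply, Finset.sum_eq_single q]
  · ext j
    fin_cases j <;> simp [Fin.sum_univ_two, DefectLattice.unitDisp]
  · intro p _ hp
    simp [DefectLattice.unitDisp, Pi.single_eq_of_ne hp.symm]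
  · intro h
    exact absurd hq h

theorem force_inner {u : M.Λ → Plane} (hu : M.IsFiniteEnergy u) (p : M.Λ) (x : Plane) :
    ⟪M.force u p, x⟫ = ∑ i : Fin 2, x i * M.firstForm u (M.lattice.unitDisp p i) := by
  simp only [force, PiLp.inner_apply]
  refine Finset.sum_congr rfl fun i _ => ?_
  have : firstVariation M.energy u (M.lattice.unitDisp p i)
      = M.firstForm u (M.lattice.unitDisp p i) :=
    residual_eq hu (isFiniteEnergy_of_support (finite_support_unitDisp p i))
  rw [this]
  simp

/-- At a finitely supported displacement the residual acts through finitely many forces. -/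
theorem exists_residual_eq_sum {u : M.Λ → Plane} (hu : u.support.Finite) :
    ∃ W : Finset M.Λ, (∀ p ∉ W, M.force u p = 0) ∧ ∀ v, M.IsFiniteEnergy v →
      M.residual u v = ∑ p ∈ W, ⟪M.force u p, v p⟫ := by
  classical
  have hfe := isFiniteEnergy_of_support hu
  set K := (M.stencil_zero_off u hu).toFinset with hK
  have hKz : ∀ k ∉ K, M.lattice.stencil u k = 0 := by
    intro k hk
    simpa [hK] using hk
  -- The first variation only sees the test function on the reference core and within the cut-off of
  -- the sites with nonzero strain.
  set W := M.refCore ∪ K.biUnion fun k => M.nb M.lattice.rcut k with hW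
  have hagree : ∀ v v' : M.Λ → Plane, (∀ p ∈ W, v p = v' p) →
      M.firstForm u v = M.firstForm u v' := by
    intro v v' h
    rw [firstForm, firstForm]
    congr 1
    · refine tsum_congr fun k => ?_
      by_cases hk : k ∈ K
      · rw [stencil_eq_of_eqOn fun q hq => h q (Finset.mem_union_right _
          (Finset.mem_biUnion.2 ⟨k, hk, hq⟩))]
      · rw [hKz k hk, sub_self]
        rfl
    · exact Finset.sum_congr rfl fun p hp => by rw [h p (Finset.mem_union_left _ hp)]
  have hfu := fun p i => isFiniteEnergy_of_support (finite_support_unitDisp (M := M) p i)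
  have hzero : M.IsFiniteEnergy (0 : M.Λ → Plane) := isFiniteEnergy_const 0
  have hform0 : M.firstForm u 0 = 0 := by
    have := firstForm_smul u 0 0
    rwa [zero_smul, zero_mul] at this
  have hsum : ∀ (s : Finset (M.Λ × Fin 2)) (v : M.Λ → Plane),
      M.IsFiniteEnergy (∑ x ∈ s, v x.1 x.2 • M.lattice.unitDisp x.1 x.2) ∧
      M.firstForm u (∑ x ∈ s, v x.1 x.2 • M.lattice.unitDisp x.1 x.2)
        = ∑ x ∈ s, v x.1 x.2 * M.firstForm u (M.lattice.unitDisp x.1 x.2) := by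
    intro s v
    induction s using Finset.induction_on with
    | empty => exact ⟨hzero, hform0⟩
    | insert a s ha ih =>
      rw [Finset.sum_insert ha, Finset.sum_insert ha]
      refine ⟨((hfu _ _).smul _).add ih.1, ?_⟩
      rw [firstForm_add hfe ((hfu _ _).smul _) ih.1, ih.2, firstForm_smul]
  refine ⟨W, fun p hp => ?_, fun v hv => ?_⟩
  · ext i
    have : firstVariation M.energy u (M.lattice.unitDisp p i)
        = M.firstForm u (M.lattice.unitDisp p i) := residual_eq hfe (hfu p i)
    simp only [force, this]
    rw [hagree _ 0, hform0]
    · rfl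
    · intro q hq
      have : q ≠ p := by
        rintro rfl
        exact hp hq
      simp [DefectLattice.unitDisp, Pi.single_eq_of_ne this]
  · rw [residual_eq hfe hv]
    have h := (hsum (W ×ˢ Finset.univ) v).2
    rw [Finset.sum_product, Finset.sum_product] at h
    rw [hagree v _ fun p hp => (unitDisp_decomposition W v hp).symm, h]
    exact Finset.sum_congr rfl fun p _ => (force_inner hfe p (v p)).symm

/-- Any finite set that carries all forces may be used, since further atoms contribute zero. -/
theorem residual_eq_sum {u : M.Λ → Plane} (hu : u.support.Finite) {W : Finset M.Λ}
    (hW : ∀ p ∉ W, M.force u p = 0) {v : M.Λ → Plane} (hv : M.IsFiniteEnergy v) :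
    M.residual u v = ∑ p ∈ W, ⟪M.force u p, v p⟫ := by
  classical
  obtain ⟨W', hW', h⟩ := exists_residual_eq_sum hu
  rw [h v hv, Finset.sum_subset (Finset.subset_union_left (s₂ := W)) fun p _ hp => by
    rw [hW' p hp, inner_zero_left],
    ← Finset.sum_subset (Finset.subset_union_right (s₁ := W')) fun p _ hp => by
    rw [hW p hp, inner_zero_left]]

/-- The energy is invariant under translations: the forces add up to zero. -/
theorem sum_force_inner_const {u : M.Λ → Plane} (hu : u.support.Finite) {W : Finset M.Λ}
    (hW : ∀ p ∉ W, M.force u p = 0) (c : Plane) : ∑ p ∈ W, ⟪M.force u p, c⟫ = 0 := by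
  rw [← residual_eq_sum hu hW (isFiniteEnergy_const c),
    residual_eq (isFiniteEnergy_of_support hu) (isFiniteEnergy_const c), firstForm,
    ← sum_inner, sum_refForce, inner_zero_left, add_zero]
  have : ∀ k : M.Λ, M.lattice.stencil (fun _ => c) k = 0 := by
    intro k
    funext ρ
    simp [DefectLattice.stencil]
  simp [this]

end AtomisticModel
end BlendedAC
end

/-! ### The computational domain and the discrete Poisson problem. -/

noncomputable section
namespace BlendedAC
open MeasureTheory
namespace Discretization
open AtomisticModel
variable {M : AtomisticModel} (D : Discretization M)

theorem isOpen_Ω : IsOpen D.Ω := isOpen_interior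

theorem Ω_subset_closedBall : D.Ω ⊆ Metric.closedBall 0 (2 * D.R) := D.subset_ball

theorem isClosed_iUnion_TΩ : IsClosed (⋃ T ∈ D.TΩ, hull T) :=
  D.TΩ.finite_toSet.isClosed_biUnion fun T _ => isClosed_hull T

theorem closure_Ω_subset : closure D.Ω ⊆ ⋃ T ∈ D.TΩ, hull T :=
  closure_minimal interior_subset D.isClosed_iUnion_TΩ

theorem interior_hull_subset_Ω {T : Finset Plane} (hT : T ∈ D.TΩ) : interior (hull T) ⊆ D.Ω :=
  interior_mono (Set.subset_biUnion_of_mem (u := fun T => hull T) hT)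

theorem mem_TΩ_of_mem_interior {T : Finset Plane} (hT : T ∈ M.mesh) {x : Plane}
    (hx : x ∈ interior (hull T)) (hxΩ : x ∈ D.Ω) : T ∈ D.TΩ := by
  obtain ⟨T', hT', hx'⟩ := Set.mem_iUnion₂.1 (interior_subset hxΩ)
  rwa [eq_of_mem_interior hT (D.TΩ_subset T' hT') hx hx']

theorem hull_subset_closure_interior {T : Finset Plane} (hT : T ∈ M.mesh) :
    hull T ⊆ closure (interior (hull T)) := by
  rw [(convex_hull T).closure_interior_eq_closure_of_nonempty_interior
    (interior_hull_nonempty hT)]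
  exact subset_closure

/-- The open triangle accumulates at its vertex p, hence meets the open set Ω. So all triangles
around an atom of Ω belong to the domain. -/
theorem mem_TΩ_of_mem {T : Finset Plane} (hT : T ∈ M.mesh) {p : Plane} (hp : p ∈ T)
    (hpΩ : p ∈ D.Ω) : T ∈ D.TΩ := by
  obtain ⟨x, hx, hx'⟩ := mem_closure_iff.1
    (hull_subset_closure_interior hT (mem_hull_of_mem hp)) _ D.isOpen_Ω hpΩ
  exact D.mem_TΩ_of_mem_interior hT hx' hx

theorem exists_mem_TΩ {p : M.Λ} (hp : (p : Plane) ∈ closure D.Ω) :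
    ∃ T ∈ D.TΩ, (p : Plane) ∈ T := by
  obtain ⟨T, hT, hpT⟩ := Set.mem_iUnion₂.1 (D.closure_Ω_subset hp)
  exact ⟨T, hT, M.mesh_nodes T (D.TΩ_subset T hT) p p.2 hpT⟩

theorem norm_le_of_mem_closure {x : Plane} (hx : x ∈ closure D.Ω) : ‖x‖ ≤ 2 * D.R := by
  have := closure_minimal D.Ω_subset_closedBall Metric.isClosed_closedBall hx
  simpa using this

/-- Computational domains cannot be arbitrarily small. -/
theorem _root_.BlendedAC.AtomisticModel.exists_le_radius (M : AtomisticModel) :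
    ∃ r > 0, ∀ D : Discretization M, r ≤ D.R := by
  obtain ⟨r, hr, h⟩ := M.exists_closedBall_subset_hull
  refine ⟨r / 4, by positivity, fun D => ?_⟩
  have h0 : (0 : Plane) ∈ D.Ω := D.ball_subset (Metric.mem_closedBall_self D.R_pos.le)
  obtain ⟨T, hT, -⟩ := Set.mem_iUnion₂.1 (interior_subset h0)
  obtain ⟨x, hx⟩ := h T (D.TΩ_subset T hT)
  -- The domain contains a ball of radius r. Two of its points at distance r have norm at most 2R
  -- each, hence r ≤ 4R.
  have hsub : Metric.ball x r ⊆ Metric.closedBall 0 (2 * D.R) :=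
    (interior_maximal (Metric.ball_subset_closedBall.trans hx) Metric.isOpen_ball).trans
      ((D.interior_hull_subset_Ω hT).trans D.Ω_subset_closedBall)
  set e : Plane := EuclideanSpace.single 0 (r / 2)
  have he : ‖e‖ = r / 2 := by
    rw [PiLp.norm_single, Real.norm_of_nonneg (by positivity)]
  have h1 : ‖x + e‖ ≤ 2 * D.R := mem_closedBall_zero_iff.1 (hsub (by
    rw [mem_ball_iff_norm, add_sub_cancel_left, he]; linarith))
  have h2 : ‖x - e‖ ≤ 2 * D.R := mem_closedBall_zero_iff.1 (hsub (by
    rw [mem_ball_iff_norm, sub_sub_cancel_left, norm_neg, he]; linarith))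
  have h3 := norm_sub_le (x + e) (x - e)
  rw [add_sub_sub_cancel, ← two_smul ℝ e, norm_smul, he] at h3
  norm_num at h3
  linarith

theorem ae_mem_Ω_iff : ∀ᵐ x : Plane, x ∈ D.Ω ↔ x ∈ ⋃ T ∈ D.TΩ, interior (hull T) := by
  filter_upwards [ae_mem_interior_hull (M := M)] with x hx
  obtain ⟨T, hT, hxT⟩ := hx
  constructor
  · intro h
    exact Set.mem_iUnion₂.2 ⟨T, D.mem_TΩ_of_mem_interior hT hxT h, hxT⟩
  · intro h
    obtain ⟨T', hT', hx'⟩ := Set.mem_iUnion₂.1 h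
    exact D.interior_hull_subset_Ω hT' hx'

/-- The Dirichlet form of the interpolants over the computational domain. -/
def dirichlet (u v : M.Λ → Plane) : ℝ :=
  ∑ T ∈ D.TΩ, volume.real (interior (hull T)) * frob (M.grad T u) (M.grad T v)

theorem integral_gradInner (u v : M.Λ → Plane) :
    ∫ x in D.Ω, gradInner (M.interp u) (M.interp v) x = D.dirichlet u v := by
  have h : D.Ω =ᵐ[volume] ⋃ T ∈ D.TΩ, interior (hull T) :=
    Filter.eventuallyEq_set.2 D.ae_mem_Ω_iff
  rw [setIntegral_congr_set h, integral_biUnion_finset D.TΩ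
    (fun T _ => isOpen_interior.measurableSet) ?_
    (fun T hT => integrableOn_gradInner (D.TΩ_subset T hT) u v)]
  · exact Finset.sum_congr rfl fun T hT => setIntegral_gradInner (D.TΩ_subset T hT) u v
  · intro T hT T' hT' hne
    exact pairwiseDisjoint_interior_hull (D.TΩ_subset T hT) (D.TΩ_subset T' hT') hne

theorem dirichlet_self_nonneg (u : M.Λ → Plane) : 0 ≤ D.dirichlet u u :=
  Finset.sum_nonneg fun _ _ => mul_nonneg measureReal_nonneg (frob_self_nonneg _)

theorem gradL2_interp (u : M.Λ → Plane) : gradL2 D.Ω (M.interp u) = √(D.dirichlet u u) := by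
  rw [gradL2, integral_gradInner]

theorem sqrt_dirichlet_le {u : M.Λ → Plane} (hu : M.IsFiniteEnergy u) :
    √(D.dirichlet u u) ≤ M.norm12 u := by
  refine Real.sqrt_le_iff.2 ⟨norm12_nonneg u, ?_⟩
  rw [norm12_sq, ← integral_gradInner]
  exact setIntegral_le_integral hu (ae_of_all _ fun x => gradInner_self_nonneg _ _)

/-- Cauchy–Schwarz over pairs of a triangle and a coordinate direction, weighted with the areas. -/
theorem dirichlet_le (u v : M.Λ → Plane) :
    D.dirichlet u v ≤ √(D.dirichlet u u) * √(D.dirichlet v v) := by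
  have hfrob : ∀ w : M.Λ → Plane, D.dirichlet w w = ∑ x ∈ D.TΩ ×ˢ (Finset.univ : Finset (Fin 2)),
      (√(volume.real (interior (hull x.1))) * ‖M.grad x.1 w (EuclideanSpace.single x.2 1)‖) ^ 2 := by
    intro w
    rw [Finset.sum_product, dirichlet]
    refine Finset.sum_congr rfl fun T _ => ?_
    rw [frob, Finset.mul_sum]
    refine Finset.sum_congr rfl fun i _ => ?_
    rw [mul_pow, Real.sq_sqrt measureReal_nonneg, real_inner_self_eq_norm_sq]
  have h1 : D.dirichlet u v ≤ ∑ x ∈ D.TΩ ×ˢ (Finset.univ : Finset (Fin 2)),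
      (√(volume.real (interior (hull x.1))) * ‖M.grad x.1 u (EuclideanSpace.single x.2 1)‖)
      * (√(volume.real (interior (hull x.1))) * ‖M.grad x.1 v (EuclideanSpace.single x.2 1)‖) := by
    rw [Finset.sum_product, dirichlet]
    refine Finset.sum_le_sum fun T _ => ?_
    rw [frob, Finset.mul_sum]
    refine Finset.sum_le_sum fun i _ => ?_
    rw [mul_mul_mul_comm, Real.mul_self_sqrt measureReal_nonneg]
    exact mul_le_mul_of_nonneg_left (real_inner_le_norm _ _) measureReal_nonneg
  refine h1.trans (sum_mul_le_of_sq _ _ _ (Real.sqrt_nonneg _) (Real.sqrt_nonneg _) ?_ ?_)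
  · rw [Real.sq_sqrt (D.dirichlet_self_nonneg u), hfrob]
  · rw [Real.sq_sqrt (D.dirichlet_self_nonneg v), hfrob]

variable (M) in
/-- Displacements supported in the computational domain are controlled by the Dirichlet form. -/
theorem _root_.BlendedAC.AtomisticModel.exists_triLe_dirichlet (M : AtomisticModel) :
    ∃ C > 0, ∀ (D : Discretization M) (u : M.Λ → Plane), (∀ p : M.Λ, (p : Plane) ∉ D.Ω → u p = 0) →
      M.TriLe u (C * D.dirichlet u u) := by
  classical
  obtain ⟨a, ha, hvol⟩ := M.exists_le_volume_hull
  have hm := M.meshSize_pos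
  refine ⟨9 * M.meshSize ^ 2 / a, by positivity, fun D u hu s => ?_⟩
  rw [← Finset.sum_filter_add_sum_filter_not s fun T : M.mesh => (T : Finset Plane) ∈ D.TΩ]
  have h1 : ∑ T ∈ s.filter (fun T : M.mesh => ¬ (T : Finset Plane) ∈ D.TΩ), M.triEnergy u T = 0 := by
    refine Finset.sum_eq_zero fun T hT => ?_
    have h2 : ∀ p ∈ M.vert T, u p = 0 := fun p hp => hu p fun hpΩ =>
      (Finset.mem_filter.1 hT).2 (D.mem_TΩ_of_mem T.2 (mem_vert.1 hp) hpΩ)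
    refine Finset.sum_eq_zero fun p hp => Finset.sum_eq_zero fun q hq => ?_
    simp [h2 p hp, h2 q hq]
  rw [h1, add_zero]
  rw [← Finset.sum_image (g := (Subtype.val : M.mesh → Finset Plane))
    (f := fun T => M.triEnergy u T) Subtype.val_injective.injOn, dirichlet, Finset.mul_sum]
  refine (Finset.sum_le_sum_of_subset_of_nonneg (t := D.TΩ) ?_
    fun _ _ _ => triEnergy_nonneg _ _).trans (Finset.sum_le_sum fun T hT => ?_)
  · intro T hT
    obtain ⟨T', hT', rfl⟩ := Finset.mem_image.1 hT
    exact (Finset.mem_filter.1 hT').2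
  · have hTm := D.TΩ_subset T hT
    refine (triEnergy_le_frob hTm u).trans ?_
    have h3 := frob_self_nonneg (M.grad T u)
    calc _ = 9 * M.meshSize ^ 2 / a * (a * frob (M.grad T u) (M.grad T u)) := by
          field_simp
      _ ≤ _ := by
          have := hvol T hTm
          gcongr

/-- The discrete Poisson space consists of the interpolants of the displacements that are supported
in the computational domain. -/
theorem mem_poissonSpace_iff {φ : Plane → Plane} : φ ∈ D.poissonSpace ↔
    ∃ u : M.Λ → Plane, (∀ p : M.Λ, (p : Plane) ∉ D.Ω → u p = 0) ∧ φ = M.interp u := by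
  constructor
  · rintro ⟨hc, haff, h0⟩
    refine ⟨M.nodal φ, fun p hp => h0 p hp, funext fun x => ?_⟩
    obtain ⟨T, hT, hx⟩ := M.mesh_cover x
    rw [interp_eq hT hx]
    have hs : ∑ p ∈ M.vert T, M.bary T p x • M.nodal φ p = ∑ p ∈ T, M.bary T p x • φ p :=
      sum_vert hT fun p => M.bary T p x • φ p
    rw [hs]
    by_cases hTΩ : T ∈ D.TΩ
    · obtain ⟨c, L, hL⟩ := haff T hTΩ
      calc φ x = c + L x := hL x hx
        _ = ∑ p ∈ T, M.bary T p x • (c + L p) := by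
            simp only [smul_add, Finset.sum_add_distrib]
            rw [← Finset.sum_smul, sum_bary hT, one_smul]
            congr 1
            conv_lhs => rw [← sum_bary_smul hT x]
            rw [map_sum]
            exact Finset.sum_congr rfl fun p _ => map_smul _ _ _
        _ = _ := Finset.sum_congr rfl fun p hp => by rw [hL p (mem_hull_of_mem hp)]
    -- The interior of a triangle outside the domain misses Ω, so φ vanishes there and by continuity
    -- on the closed triangle.
    · have hz : ∀ y ∈ hull T, φ y = 0 := by
        have : hull T ⊆ φ ⁻¹' {0} := by
          refine (hull_subset_closure_interior hT).trans
            (closure_minimal (fun y hy => ?_) (isClosed_singleton.preimage hc))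
          exact h0 y fun hyΩ => hTΩ (D.mem_TΩ_of_mem_interior hT hy hyΩ)
        exact fun y hy => this hy
      rw [hz x hx]
      exact (Finset.sum_eq_zero fun p hp => by rw [hz p (mem_hull_of_mem hp), smul_zero]).symm
  · rintro ⟨u, hu, rfl⟩
    refine ⟨continuous_interp u, fun T hT => ?_, fun x hx => ?_⟩
    · have hTm := D.TΩ_subset T hT
      obtain ⟨y, hy⟩ := interior_hull_nonempty hTm
      refine ⟨M.interp u y - M.grad T u y, M.grad T u, fun x hx => ?_⟩
      have := interp_sub_interp hTm hx (interior_subset hy) u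
      rw [map_sub] at this
      rw [← sub_eq_zero] at this ⊢
      rw [← this]
      abel
    · obtain ⟨T, hT, hxT⟩ := M.mesh_cover x
      rw [interp_eq hT hxT]
      refine Finset.sum_eq_zero fun p hp => ?_
      by_contra hne
      have hup : u p ≠ 0 := fun h => hne (by rw [h, smul_zero])
      have hbp : hat M.mesh p x ≠ 0 := fun h => hne (by rw [← hat_eq_bary hT hxT, h, zero_smul])
      have hpΩ : (p : Plane) ∈ D.Ω := by
        by_contra h
        exact hup (hu p h)
      -- The set where the hat function of p is nonzero is open and covered by triangles of the
      -- domain, hence contained in Ω.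
      refine hx (interior_maximal (t := {y | hat M.mesh p y ≠ 0}) (fun y hy => ?_) ?_ hbp)
      · obtain ⟨T', hT', hpT', hy'⟩ := exists_of_hat_ne_zero hy
        exact Set.mem_iUnion₂.2 ⟨T', D.mem_TΩ_of_mem hT' hpT' hpΩ, hy'⟩
      · exact isOpen_ne.preimage (continuous_hat (M := M) p)

open Classical in
/-- The atoms in the computational domain. -/
def atoms : Finset M.Λ := (M.nb (2 * D.R) 0).filter fun p => (p : Plane) ∈ D.Ω

theorem mem_atoms {p : M.Λ} : p ∈ D.atoms ↔ (p : Plane) ∈ D.Ω := by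
  simp only [atoms, Finset.mem_filter, mem_nb, dist_zero_left, and_iff_right_iff_imp]
  intro h
  simpa using D.Ω_subset_closedBall h

open Classical in
/-- The atoms in the closure of the computational domain. -/
def closureAtoms : Finset M.Λ := (M.nb (2 * D.R) 0).filter fun p => (p : Plane) ∈ closure D.Ω

theorem mem_closureAtoms {p : M.Λ} : p ∈ D.closureAtoms ↔ (p : Plane) ∈ closure D.Ω := by
  simp only [closureAtoms, Finset.mem_filter, mem_nb, dist_zero_left, and_iff_right_iff_imp]
  exact D.norm_le_of_mem_closure

/-- Displacements supported in the computational domain. -/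
def dispSpace : Submodule ℝ (M.Λ → Plane) where
  carrier := {u | ∀ p : M.Λ, (p : Plane) ∉ D.Ω → u p = 0}
  add_mem' := fun hu hv p hp => by rw [Pi.add_apply, hu p hp, hv p hp, add_zero]
  zero_mem' := fun _ _ => rfl
  smul_mem' := fun t u hu p hp => by rw [Pi.smul_apply, hu p hp, smul_zero]

instance : FiniteDimensional ℝ D.dispSpace := by
  let f : D.dispSpace →ₗ[ℝ] (D.atoms → Plane) :=
    { toFun := fun u p => (u : M.Λ → Plane) p
      map_add' := fun _ _ => rfl
      map_smul' := fun _ _ => rfl }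
  refine FiniteDimensional.of_injective f fun u v h => Subtype.ext (funext fun p => ?_)
  by_cases hp : (p : Plane) ∈ D.Ω
  · exact congrFun h ⟨p, D.mem_atoms.2 hp⟩
  · rw [u.2 p hp, v.2 p hp]

/-- All triangle energies vanish, so u is constant on Λ, and it vanishes at an atom outside the
bounded domain. -/
theorem eq_zero_of_dirichlet_eq_zero {u : M.Λ → Plane} (hu : u ∈ D.dispSpace)
    (h : D.dirichlet u u = 0) : u = 0 := by
  obtain ⟨C, -, hC⟩ := M.exists_triLe_dirichlet
  have hT := hC D u hu
  rw [h, mul_zero] at hT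
  -- Such an atom is a vertex of a triangle through a point of norm 2R + 2 `meshSize`.
  obtain ⟨q, hq⟩ : ∃ q : M.Λ, (q : Plane) ∉ D.Ω := by
    have hm := M.meshSize_pos
    have hR := D.R_pos
    set x : Plane := EuclideanSpace.single 0 (2 * D.R + 2 * M.meshSize)
    have hx : ‖x‖ = 2 * D.R + 2 * M.meshSize := by
      rw [PiLp.norm_single, Real.norm_of_nonneg (by positivity)]
    obtain ⟨T, hT, hxT⟩ := M.mesh_cover x
    obtain ⟨p, hp⟩ : T.Nonempty := by
      rw [← Finset.card_pos, M.mesh_triangulation.card_eq T hT]; norm_num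
    refine ⟨⟨p, M.mesh_vertices T hT p hp⟩, fun hpΩ => ?_⟩
    have h1 : ‖p‖ ≤ 2 * D.R := by simpa using D.Ω_subset_closedBall hpΩ
    have h2 := dist_le_meshSize hT hxT (mem_hull_of_mem hp)
    rw [dist_eq_norm] at h2
    have h3 := norm_sub_le x (x - p)
    have h4 := norm_add_le (x - p) p
    rw [sub_add_cancel] at h4
    linarith
  funext p
  obtain ⟨C', -, hC'⟩ := M.exists_sumLe_locEnergy_of_triLe (dist (p : Plane) q)
  have h1 := (hC' u 0 hT).apply_le p
  rw [mul_zero] at h1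
  have h2 := (sq_le_locEnergy u (p := p) (q := q) le_rfl).trans h1
  rw [hu q hq, zero_sub, norm_neg] at h2
  have : ‖u p‖ = 0 := by nlinarith [norm_nonneg (u p)]
  exact norm_eq_zero.1 this

theorem dirichlet_add_left (u u' v : M.Λ → Plane) :
    D.dirichlet (u + u') v = D.dirichlet u v + D.dirichlet u' v := by
  simp only [dirichlet, frob, grad_add, add_apply, inner_add_left,
    Finset.sum_add_distrib, mul_add]

theorem dirichlet_comm (u v : M.Λ → Plane) : D.dirichlet u v = D.dirichlet v u := by
  simp only [dirichlet, frob]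
  refine Finset.sum_congr rfl fun T _ => congrArg _ (Finset.sum_congr rfl fun i _ => ?_)
  exact real_inner_comm _ _

theorem dirichlet_smul_left (t : ℝ) (u v : M.Λ → Plane) :
    D.dirichlet (t • u) v = t * D.dirichlet u v := by
  simp only [dirichlet, frob, grad_smul, smul_apply, real_inner_smul_left,
    ← Finset.mul_sum]
  rw [Finset.mul_sum]
  exact Finset.sum_congr rfl fun T _ => by ring

/-- The Dirichlet form as a bilinear form on the displacements supported in the domain. -/
def dirichletForm : D.dispSpace →ₗ[ℝ] Module.Dual ℝ D.dispSpace :=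
  LinearMap.mk₂ ℝ (fun u v => D.dirichlet u v)
    (fun u u' v => D.dirichlet_add_left u u' v)
    (fun t u v => D.dirichlet_smul_left t u v)
    (fun u v v' => by
      rw [dirichlet_comm, Submodule.coe_add, dirichlet_add_left, dirichlet_comm,
        D.dirichlet_comm v'])
    (fun t u v => by
      rw [dirichlet_comm, Submodule.coe_smul, dirichlet_smul_left, dirichlet_comm, smul_eq_mul])

/-- Definiteness gives injectivity; the finite-dimensional space and its dual have equal dimension.
-/
theorem bijective_dirichletForm : Function.Bijective D.dirichletForm := by
  have hinj : Function.Injective D.dirichletForm := by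
    rw [← LinearMap.ker_eq_bot, LinearMap.ker_eq_bot']
    intro u hu
    have : D.dirichlet u u = 0 := LinearMap.congr_fun hu u
    exact Subtype.ext (D.eq_zero_of_dirichlet_eq_zero u.2 this)
  exact ⟨hinj, (LinearMap.injective_iff_surjective_of_finrank_eq_finrank
    Subspace.dual_finrank_eq.symm).1 hinj⟩

theorem integrableOn_inner {f g : Plane → Plane} (hf : Continuous f) (hg : Continuous g) :
    IntegrableOn (fun x => ⟪f x, g x⟫) D.Ω :=
  ((hf.inner hg).continuousOn.integrableOn_compact (isCompact_closedBall 0 (2 * D.R))).mono_set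
    D.Ω_subset_closedBall

/-- The load functional of the truncated Poisson problem. -/
def load (f : Plane → Plane) (hf : Continuous f) : Module.Dual ℝ D.dispSpace where
  toFun v := ∫ x in D.Ω, ⟪f x, M.interp v x⟫
  map_add' v w := by
    rw [← integral_add (D.integrableOn_inner hf (continuous_interp _))
      (D.integrableOn_inner hf (continuous_interp _))]
    refine integral_congr_ae (ae_of_all _ fun x => ?_)
    simp only [Submodule.coe_add, interp_add, Pi.add_apply, inner_add_right]
  map_smul' t v := by
    rw [RingHom.id_apply, smul_eq_mul, ← integral_const_mul]
    refine integral_congr_ae (ae_of_all _ fun x => ?_)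
    simp only [Submodule.coe_smul, interp_smul, Pi.smul_apply, real_inner_smul_right]

theorem continuous_forceInterp (u : M.Λ → Plane) : Continuous (M.forceInterp u) := by
  rw [forceInterp_eq]
  exact continuous_interp _

theorem isPoissonSolution_interp_iff (uh : Plane → Plane) {u : M.Λ → Plane}
    (hu : u ∈ D.dispSpace) : D.IsPoissonSolution uh (M.interp u) ↔
      D.dirichletForm ⟨u, hu⟩ = D.load _ (continuous_forceInterp (M.nodal uh)) := by
  constructor
  · rintro ⟨-, h⟩
    refine LinearMap.ext fun v => ?_
    have := h _ (D.mem_poissonSpace_iff.2 ⟨v, v.2, rfl⟩)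
    rw [integral_gradInner] at this
    exact this
  · intro h
    refine ⟨D.mem_poissonSpace_iff.2 ⟨u, hu, rfl⟩, fun v hv => ?_⟩
    obtain ⟨w, hw, rfl⟩ := D.mem_poissonSpace_iff.1 hv
    rw [integral_gradInner]
    exact LinearMap.congr_fun h ⟨w, hw⟩

theorem IsPoissonSolution.exists_eq_interp {D : Discretization M} {uh φ : Plane → Plane}
    (h : D.IsPoissonSolution uh φ) : ∃ u ∈ D.dispSpace, φ = M.interp u ∧ ∀ w ∈ D.dispSpace,
      D.dirichlet u w = ∫ x in D.Ω, ⟪M.forceInterp (M.nodal uh) x, M.interp w x⟫ := by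
  obtain ⟨u, hu, rfl⟩ := D.mem_poissonSpace_iff.1 h.1
  refine ⟨u, hu, rfl, fun w hw => ?_⟩
  exact LinearMap.congr_fun ((D.isPoissonSolution_interp_iff uh hu).1 h) ⟨w, hw⟩

/-- The truncated Poisson problem is uniquely solvable. -/
theorem existsUnique_isPoissonSolution (uh : Plane → Plane) :
    ∃! φ, D.IsPoissonSolution uh φ := by
  obtain ⟨u, hu⟩ := D.bijective_dirichletForm.2 (D.load _ (continuous_forceInterp (M.nodal uh)))
  refine ⟨M.interp u, (D.isPoissonSolution_interp_iff uh u.2).2 hu, fun φ hφ => ?_⟩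
  obtain ⟨w, hw, rfl⟩ := D.mem_poissonSpace_iff.1 hφ.1
  have h := (D.isPoissonSolution_interp_iff uh hw).1 hφ
  have := D.bijective_dirichletForm.1 (h.trans hu.symm)
  rw [← this]

/-- Interpolants of displacements supported in the domain vanish outside. -/
theorem integral_inner_interp (f : Plane → Plane) {w : M.Λ → Plane} (hw : w ∈ D.dispSpace) :
    ∫ x in D.Ω, ⟪f x, M.interp w x⟫ = ∫ x, ⟪f x, M.interp w x⟫ := by
  refine setIntegral_eq_integral_of_forall_compl_eq_zero fun x hx => ?_
  rw [(D.mem_poissonSpace_iff.2 ⟨w, hw, rfl⟩).2.2 x hx, inner_zero_right]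

/-- Solutions of the blended methods have finitely supported nodal values. -/
theorem IsSolution.finite_support {D : Discretization M} {m : BlendedMethod} {uh : Plane → Plane}
    (h : D.IsSolution m uh) : (M.nodal uh).support.Finite := by
  have hsp : ∃ k, uh ∈ D.space k := by
    cases m with
    | bqce => exact ⟨_, h.1⟩
    | bqcf k => exact ⟨k, h.1⟩
    | bgfc k => exact ⟨k, h.1⟩
  have h0 : ∀ x, x ∉ D.Ωh → uh x = 0 := by
    obtain ⟨k, hk⟩ := hsp
    cases k with
    | p1 => exact hk.2.2
    | p2 => exact hk.2.2.2
  refine D.closureAtoms.finite_toSet.subset fun p hp => D.mem_closureAtoms.2 ?_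
  refine D.Th_domain ?_
  by_contra hc
  exact hp (h0 p hc)

end Discretization
end BlendedAC
end

/-! ### The two bounds of the residual norm by the estimator. -/

noncomputable section
namespace BlendedAC
open MeasureTheory
namespace AtomisticModel
variable {M : AtomisticModel}

theorem le_residualNorm (u : M.Λ → Plane) {v : M.Λ → Plane} (hv : M.IsFiniteEnergy v)
    (h : M.norm12 v ≤ 1) : ENNReal.ofReal |M.residual u v| ≤ M.residualNorm u :=
  le_iSup_of_le v (le_iSup_of_le hv (le_iSup_of_le h le_rfl))

theorem residualNorm_le {u : M.Λ → Plane} {B : ℝ}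
    (h : ∀ v, M.IsFiniteEnergy v → M.norm12 v ≤ 1 → |M.residual u v| ≤ B) :
    M.residualNorm u ≤ ENNReal.ofReal B :=
  iSup_le fun v => iSup_le fun hv => iSup_le fun h' => ENNReal.ofReal_le_ofReal (h v hv h')

theorem residual_smul {u v : M.Λ → Plane} (hu : M.IsFiniteEnergy u) (hv : M.IsFiniteEnergy v)
    (t : ℝ) : M.residual u (t • v) = t * M.residual u v := by
  rw [residual_eq hu (hv.smul t), residual_eq hu hv, firstForm_smul]

/-- The residual norm bounds the residual, by scaling. -/
theorem ofReal_le_residualNorm {u v : M.Λ → Plane} (hu : M.IsFiniteEnergy u)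
    (hv : M.IsFiniteEnergy v) {t : ℝ} (ht : 0 < t) (h : M.norm12 v ≤ t) :
    ENNReal.ofReal (|M.residual u v| / t) ≤ M.residualNorm u := by
  have h1 : M.norm12 (t⁻¹ • v) ≤ 1 := by
    rw [norm12_smul, abs_of_pos (inv_pos.2 ht), inv_mul_le_iff₀ ht, mul_one]
    exact h
  have := le_residualNorm u (hv.smul t⁻¹) h1
  rwa [residual_smul hu hv, abs_mul, abs_of_pos (inv_pos.2 ht), inv_mul_eq_div] at this

theorem homothety_mem_interior {T : Finset Plane} {p : Plane} (hp : p ∈ T) {y : Plane}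
    (hy : y ∈ interior (hull T)) {t : ℝ} (ht : 0 < t) (ht1 : t ≤ 1) :
    AffineMap.homothety p t y ∈ interior (hull T) := by
  have := (convex_hull T).add_smul_sub_mem_interior (mem_hull_of_mem hp) hy ⟨ht, ht1⟩
  rwa [AffineMap.homothety_apply, vsub_eq_sub, vadd_eq_add, add_comm]

variable (M) in
/-- An inverse estimate: the energy norm is bounded by the nodal values. -/
theorem exists_norm12_sq_le_sum : ∃ C > 0, ∀ (u : M.Λ → Plane) (W : Finset M.Λ),
    (∀ p ∉ W, u p = 0) → M.IsFiniteEnergy u ∧ M.norm12 u ^ 2 ≤ C * ∑ p ∈ W, ‖u p‖ ^ 2 := by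
  classical
  obtain ⟨C, hC, h⟩ := M.sumLe_nb M.meshSize
  obtain ⟨N, hN⟩ := M.card_nb_le M.meshSize
  obtain ⟨C', hC', h'⟩ := M.exists_norm12_le
  refine ⟨C' * (2 * C + 2 * (N + 1)), by positivity, fun u W hu => ?_⟩
  have h1 : SumLe (fun p => ‖u p‖ ^ 2) (∑ p ∈ W, ‖u p‖ ^ 2) := by
    intro s
    have e : ∑ p ∈ W, ‖u p‖ ^ 2 = ∑ p ∈ s ∪ W, ‖u p‖ ^ 2 :=
      Finset.sum_subset Finset.subset_union_right fun p _ hp => by simp [hu p hp]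
    rw [e]
    exact Finset.sum_le_sum_of_subset_of_nonneg (Finset.subset_union_left (s₂ := W))
      fun _ _ _ => sq_nonneg _
  have h2 := h _ _ (fun p => sq_nonneg ‖u p‖) h1
  have h3 := (h2.const_mul zero_le_two).add (h1.const_mul (c := 2 * (N + 1)) (by positivity))
  rw [mul_assoc]
  refine h' u _ (h3.mono (fun p => ?_) (le_of_eq (by ring)))
  have h4 : ∀ q ∈ M.nb M.meshSize p, ‖u q - u p‖ ^ 2 ≤ 2 * ‖u q‖ ^ 2 + 2 * ‖u p‖ ^ 2 := by
    intro q _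
    have := norm_add_sq_le (u q) (-u p)
    rwa [norm_neg, ← sub_eq_add_neg] at this
  refine (Finset.sum_le_sum h4).trans ?_
  rw [Finset.sum_add_distrib, ← Finset.mul_sum, Finset.sum_const, nsmul_eq_mul]
  have h5 : ((M.nb M.meshSize p).card : ℝ) ≤ N := by exact_mod_cast hN p
  nlinarith [sq_nonneg ‖u p‖]

/-- The radial cut-off between `3R/4` and `R`. -/
def cutoff (R : ℝ) (x : Plane) : ℝ := max 0 (min 1 (4 - 4 / R * ‖x‖))

theorem cutoff_nonneg (R : ℝ) (x : Plane) : 0 ≤ cutoff R x := le_max_left _ _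

theorem cutoff_le_one (R : ℝ) (x : Plane) : cutoff R x ≤ 1 :=
  max_le zero_le_one (min_le_left _ _)

theorem cutoff_eq_zero {R : ℝ} (hR : 0 < R) {x : Plane} (hx : R ≤ ‖x‖) : cutoff R x = 0 := by
  refine max_eq_left ((min_le_right _ _).trans ?_)
  have : 4 ≤ 4 / R * ‖x‖ := by
    rw [div_mul_eq_mul_div, le_div_iff₀ hR]
    linarith
  linarith

theorem cutoff_eq_one {R : ℝ} (hR : 0 < R) {x : Plane} (hx : ‖x‖ ≤ 3 / 4 * R) :
    cutoff R x = 1 := by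
  have : 4 / R * ‖x‖ ≤ 3 := by
    rw [div_mul_eq_mul_div, div_le_iff₀ hR]
    linarith
  rw [cutoff, min_eq_left (by linarith), max_eq_right zero_le_one]

theorem abs_cutoff_sub_le {R : ℝ} (hR : 0 < R) (x y : Plane) :
    |cutoff R x - cutoff R y| ≤ 4 / R * dist x y := by
  have h1 := abs_max_sub_max_le_abs (min 1 (4 - 4 / R * ‖x‖)) (min 1 (4 - 4 / R * ‖y‖)) 0
  have h2 := abs_min_sub_min_le_max (1 : ℝ) (4 - 4 / R * ‖x‖) 1 (4 - 4 / R * ‖y‖)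
  rw [sub_self, abs_zero, max_eq_right (abs_nonneg _)] at h2
  have h3 : |4 - 4 / R * ‖x‖ - (4 - 4 / R * ‖y‖)| ≤ 4 / R * dist x y := by
    rw [show 4 - 4 / R * ‖x‖ - (4 - 4 / R * ‖y‖) = 4 / R * (‖y‖ - ‖x‖) by ring, abs_mul,
      abs_of_pos (by positivity), dist_comm, dist_eq_norm]
    exact mul_le_mul_of_nonneg_left (abs_norm_sub_norm_le _ _) (by positivity)
  rw [cutoff, cutoff, max_comm 0, max_comm 0]
  exact h1.trans (h2.trans h3)

/-- Truncation of displacements: subtracting a suitable constant and cutting off near the radius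
`R` is stable in the energy norm. -/
theorem exists_truncation (M : AtomisticModel) {r₀ : ℝ} (hr₀ : 0 < r₀) : ∃ C > 0, ∀ R ≥ r₀,
    ∀ v : M.Λ → Plane, M.IsFiniteEnergy v → ∃ c : Plane,
      (∀ W : Finset M.Λ, (∀ p ∈ W, ‖(p : Plane)‖ ≤ 2 * R) →
        ∑ p ∈ W, ‖v p - c‖ ^ 2 ≤ C * R ^ 2 * M.norm12 v ^ 2) ∧
      SumLe (M.locEnergy M.meshSize fun p => cutoff R p • (v p - c)) (C * M.norm12 v ^ 2) := by
  classical
  obtain ⟨CP, hCP, r₁, hP⟩ := M.exists_poincare hr₀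
  obtain ⟨C₁, hC₁, h₁⟩ := M.exists_sumLe_locEnergy r₁
  obtain ⟨C₂, hC₂, h₂⟩ := M.exists_sumLe_locEnergy M.meshSize
  obtain ⟨N, hN⟩ := M.card_nb_le M.meshSize
  have hm := M.meshSize_pos
  set h := M.meshSize with hh
  set κ := CP * (2 + h / r₀) ^ 2 * C₁ with hκ
  have hκ0 : 0 < κ := by positivity
  refine ⟨κ + (2 * C₂ + 32 * N * h ^ 2 * κ), by positivity, fun R hR v hv => ?_⟩
  have hR0 : 0 < R := hr₀.trans_le hR
  have hn := sq_nonneg (M.norm12 v)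
  -- One radius serves both claims: atoms within 2R, and those within R + h on which the local
  -- energy of the truncated displacement may be nonzero.
  obtain ⟨c, hc⟩ := hP (2 * R + h) (by linarith) v _ (h₁ v hv)
  have hball : ∀ W : Finset M.Λ, (∀ p ∈ W, ‖(p : Plane)‖ ≤ 2 * R + h) →
      ∑ p ∈ W, ‖v p - c‖ ^ 2 ≤ κ * R ^ 2 * M.norm12 v ^ 2 := by
    intro W hW
    refine (hc W hW).trans ?_
    have : 2 * R + h ≤ (2 + h / r₀) * R := by
      have : h ≤ h / r₀ * R := by
        rw [div_mul_eq_mul_div, le_div_iff₀ hr₀]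
        exact mul_le_mul_of_nonneg_left hR hm.le
      linarith
    calc CP * (2 * R + h) ^ 2 * (C₁ * M.norm12 v ^ 2)
        ≤ CP * ((2 + h / r₀) * R) ^ 2 * (C₁ * M.norm12 v ^ 2) := by gcongr
      _ = _ := by rw [hκ]; ring
  refine ⟨c, fun W hW => (hball W fun p hp => (hW p hp).trans (by linarith)).trans ?_, ?_⟩
  · gcongr
    have : 0 ≤ 2 * C₂ + 32 * N * h ^ 2 * κ := by positivity
    linarith
  set w : M.Λ → Plane := fun p => cutoff R p • (v p - c) with hw
  have hmass : SumLe (fun p : M.Λ => if ‖(p : Plane)‖ ≤ R + h then ‖v p - c‖ ^ 2 else 0)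
      (κ * R ^ 2 * M.norm12 v ^ 2) := by
    intro s
    rw [← Finset.sum_filter]
    exact hball _ fun p hp => (Finset.mem_filter.1 hp).2.trans (by linarith)
  have hsum := ((h₂ v hv).const_mul zero_le_two).add
    (hmass.const_mul (c := N * (2 * (4 / R * h) ^ 2)) (by positivity))
  refine hsum.mono (fun p => ?_) ?_
  · by_cases hp : ‖(p : Plane)‖ ≤ R + h
    · rw [if_pos hp]
      have h1 : ∀ q ∈ M.nb h p, ‖w q - w p‖ ^ 2
          ≤ 2 * ‖v q - v p‖ ^ 2 + 2 * (4 / R * h) ^ 2 * ‖v p - c‖ ^ 2 := by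
        intro q hq
        -- Discrete product rule; the cut-off has slope at most 4/R.
        have e : w q - w p = cutoff R q • (v q - v p)
            + (cutoff R q - cutoff R p) • (v p - c) := by
          simp only [hw]
          module
        rw [e]
        refine (norm_add_sq_le _ _).trans ?_
        rw [norm_smul, norm_smul, mul_pow, mul_pow, mul_assoc]
        have h2 : ‖cutoff R (q : Plane)‖ ^ 2 ≤ 1 := by
          rw [Real.norm_of_nonneg (cutoff_nonneg _ _)]
          exact pow_le_one₀ (cutoff_nonneg _ _) (cutoff_le_one _ _)
        have h3 : ‖cutoff R (q : Plane) - cutoff R (p : Plane)‖ ^ 2 ≤ (4 / R * h) ^ 2 := by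
          refine pow_le_pow_left₀ (norm_nonneg _) ?_ 2
          rw [Real.norm_eq_abs]
          refine (abs_cutoff_sub_le hR0 _ _).trans ?_
          refine mul_le_mul_of_nonneg_left ?_ (by positivity)
          rw [dist_comm]
          exact mem_nb.1 hq
        have h4 := mul_le_mul_of_nonneg_right h2 (sq_nonneg ‖v q - v p‖)
        have h5 := mul_le_mul_of_nonneg_right h3 (sq_nonneg ‖v p - c‖)
        linarith
      refine (Finset.sum_le_sum h1).trans ?_
      rw [Finset.sum_add_distrib, ← Finset.mul_sum, Finset.sum_const, nsmul_eq_mul]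
      have h6 : ((M.nb h p).card : ℝ) ≤ N := by exact_mod_cast hN p
      have h7 : M.locEnergy h v p = ∑ q ∈ M.nb h p, ‖v q - v p‖ ^ 2 := rfl
      rw [← h7]
      have := mul_le_mul_of_nonneg_right h6
        (show 0 ≤ 2 * (4 / R * h) ^ 2 * ‖v p - c‖ ^ 2 by positivity)
      linarith
    · have h1 : M.locEnergy h w p = 0 := by
        have h0 : ∀ q : M.Λ, dist (p : Plane) q ≤ h → w q = 0 := by
          intro q hq
          have : R ≤ ‖(q : Plane)‖ := by
            have := norm_le_norm_add_norm_sub' (p : Plane) q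
            rw [dist_eq_norm] at hq
            linarith
          simp only [hw]
          rw [cutoff_eq_zero hR0 this, zero_smul]
        refine Finset.sum_eq_zero fun q hq => ?_
        rw [h0 q (mem_nb.1 hq), h0 p (by rw [dist_self]; exact hm.le)]
        simp
      rw [h1, if_neg hp]
      have := locEnergy_nonneg h v p
      linarith
  -- The factor R² of the Poincaré inequality cancels the squared slope of the cut-off.
  · have : N * (2 * (4 / R * h) ^ 2) * (κ * R ^ 2 * M.norm12 v ^ 2)
        = 32 * N * h ^ 2 * κ * M.norm12 v ^ 2 := by
      field_simp
      ring
    rw [this]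
    nlinarith

end AtomisticModel

namespace Discretization
open AtomisticModel
variable {M : AtomisticModel}

theorem estimator_eq (D : Discretization M) (u : M.Λ → Plane) :
    D.estimator (M.interp u) = √(D.dirichlet u u) := D.gradL2_interp u

/-- The residual is tested with the quasi-interpolant of the nodal values of φ_a: its value is η²,
while the energy norm of the test function is at most κη. -/
theorem _root_.BlendedAC.AtomisticModel.exists_estimator_le (M : AtomisticModel) :
    ∃ c > 0, ∀ (D : Discretization M) (uh φ : Plane → Plane), (M.nodal uh).support.Finite →
      D.IsPoissonSolution uh φ →
      ENNReal.ofReal (c * D.estimator φ) ≤ M.residualNorm (M.nodal uh) := by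
  obtain ⟨C₁, hC₁, h₁⟩ := M.exists_triLe_dirichlet
  obtain ⟨C₂, hC₂, h₂⟩ := M.exists_sumLe_locEnergy_of_triLe M.meshSize
  obtain ⟨C₃, hC₃, h₃⟩ := M.exists_sumLe_quasiInterp
  obtain ⟨C₄, hC₄, h₄⟩ := M.exists_norm12_le
  set κ := √(C₄ * (C₃ * (C₂ * C₁))) with hκ
  have hκ0 : 0 < κ := Real.sqrt_pos.2 (by positivity)
  refine ⟨1 / κ, by positivity, fun D uh φ hfin hφ => ?_⟩
  obtain ⟨g, hg, rfl, hgw⟩ := hφ.exists_eq_interp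
  obtain ⟨W, hW, -⟩ := exists_residual_eq_sum hfin
  rw [estimator_eq]
  set η := √(D.dirichlet g g) with hη
  -- The case η = 0 is trivial and is split off because κη becomes a divisor.
  rcases (Real.sqrt_nonneg (D.dirichlet g g)).eq_or_lt with h0 | h0
  · rw [hη, ← h0]
    simp
  have hη2 : η ^ 2 = D.dirichlet g g := Real.sq_sqrt (D.dirichlet_self_nonneg g)
  obtain ⟨hfe, hnorm⟩ := h₄ _ _ (h₃ _ _ (h₂ _ _ (h₁ D g hg)))
  have hnorm' : M.norm12 (M.quasiInterp g) ≤ κ * η := by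
    refine (abs_le_of_sq_le_sq' ?_ (by positivity)).2
    rw [mul_pow, hκ, Real.sq_sqrt (by positivity), hη2]
    refine hnorm.trans (le_of_eq ?_)
    ring
  have hres : M.residual (M.nodal uh) (M.quasiInterp g) = η ^ 2 := by
    rw [residual_eq_sum hfin hW hfe, ← integral_forceInterp hW, ← D.integral_inner_interp _ hg,
      ← hgw g hg, hη2]
  refine le_trans (ENNReal.ofReal_le_ofReal (le_of_eq ?_))
    (ofReal_le_residualNorm (isFiniteEnergy_of_support hfin) hfe
      (t := κ * η) (by positivity) hnorm')
  rw [hres, abs_of_nonneg (sq_nonneg _)]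
  field_simp

theorem norm_lt_of_notMem_Ω (D : Discretization M) {x : Plane} (hx : x ∉ D.Ω) : D.R < ‖x‖ := by
  by_contra h
  exact hx (D.ball_subset (mem_closedBall_zero_iff.2 (not_lt.1 h)))

/-- Forces on atoms away from the centre are controlled by the truncation indicator. -/
theorem _root_.BlendedAC.AtomisticModel.exists_outer_force_le (M : AtomisticModel) :
    ∃ C > 0, ∀ (D : Discretization M) (X : M.Λ → Plane) (W : Finset M.Λ),
      (∀ p ∈ W, (p : Plane) ∈ closure D.Ω ∧ 3 / 4 * D.R ≤ ‖(p : Plane)‖) →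
      ∑ p ∈ W, ‖X p‖ ^ 2 ≤
        C * normL2 (D.Ω \ Metric.closedBall 0 (D.R / 2)) (M.interp X) ^ 2 := by
  obtain ⟨r₀, hr₀, hr⟩ := M.exists_le_radius
  have hm := M.meshSize_pos
  -- A triangle shrunk by s towards an atom stays within R/8 of it, so from radius 3R/4 it does not
  -- reach the ball of radius R/2.
  set s := min 1 (r₀ / (8 * M.meshSize)) with hs
  have hs0 : 0 < s := lt_min one_pos (by positivity)
  have hs1 : s ≤ 1 := min_le_left _ _
  obtain ⟨C, hC, h⟩ := M.exists_sum_norm_sq_le hs0 hs1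
  refine ⟨C, hC, fun D X W hW => ?_⟩
  rw [normL2, Real.sq_sqrt (integral_nonneg fun _ => sq_nonneg _)]
  refine h X W _ (2 * D.R) (D.isOpen_Ω.measurableSet.diff Metric.isClosed_closedBall.measurableSet)
    (Set.sdiff_subset.trans D.Ω_subset_closedBall) fun p hp => ?_
  obtain ⟨hp1, hp2⟩ := hW p hp
  obtain ⟨T, hT, hpT⟩ := D.exists_mem_TΩ hp1
  have hTm := D.TΩ_subset T hT
  refine ⟨T, hTm, hpT, ?_⟩
  rintro _ ⟨y, hy, rfl⟩
  have hy' := homothety_mem_interior hpT hy hs0 hs1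
  refine ⟨⟨D.interior_hull_subset_Ω hT hy', fun hball => ?_⟩, hy'⟩
  rw [mem_closedBall_zero_iff] at hball
  have h1 : dist (p : Plane) (AffineMap.homothety (p : Plane) s y) ≤ D.R / 8 := by
    rw [dist_comm, AffineMap.homothety_apply, vsub_eq_sub, vadd_eq_add, dist_eq_norm,
      add_sub_cancel_right, norm_smul, Real.norm_of_nonneg hs0.le, ← dist_eq_norm]
    calc s * dist y p ≤ r₀ / (8 * M.meshSize) * M.meshSize := by
          refine mul_le_mul (min_le_right _ _) ?_ dist_nonneg (by positivity)
          exact dist_le_meshSize hTm (interior_subset hy) (mem_hull_of_mem hpT)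
      _ = r₀ / 8 := by field_simp
      _ ≤ D.R / 8 := by linarith [hr D]
  have h2 := norm_le_norm_add_norm_sub' (p : Plane) (AffineMap.homothety (p : Plane) s y)
  rw [dist_eq_norm] at h1
  have := D.R_pos
  linarith

/-- All forces in the computational domain are controlled by the estimator and the truncation
indicator: test the Poisson problem with the interior part of the force field. -/
theorem _root_.BlendedAC.AtomisticModel.exists_sum_scaledForce_le (M : AtomisticModel) :
    ∃ C > 0, ∀ (D : Discretization M) (X g : M.Λ → Plane), g ∈ D.dispSpace →
      (∀ p : M.Λ, (p : Plane) ∉ closure D.Ω → X p = 0) →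
      (∀ w ∈ D.dispSpace, D.dirichlet g w = ∫ x in D.Ω, ⟪M.interp X x, M.interp w x⟫) →
      ∑ p ∈ D.closureAtoms, ‖X p‖ ^ 2 ≤ C * (D.dirichlet g g +
        normL2 (D.Ω \ Metric.closedBall 0 (D.R / 2)) (M.interp X) ^ 2) := by
  classical
  obtain ⟨C₁, hC₁, h₁⟩ := M.exists_outer_force_le
  obtain ⟨C₂, hC₂, h₂⟩ := M.exists_norm12_sq_le_sum
  obtain ⟨C₃, hC₃, h₃⟩ := M.exists_sum_norm_sq_le one_pos le_rfl
  obtain ⟨C₄, hC₄, h₄⟩ := M.exists_integral_norm_interp_sq_le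
  refine ⟨4 * C₃ ^ 2 * C₂ + (2 * C₃ * C₄ + 1) * C₁, by positivity, fun D X g hg hX hgw => ?_⟩
  set n2 := normL2 (D.Ω \ Metric.closedBall 0 (D.R / 2)) (M.interp X)
  set bd := D.closureAtoms.filter fun p : M.Λ => (p : Plane) ∉ D.Ω with hbd
  -- Only the part on atoms of Ω is an admissible test function. The remaining atoms lie on the
  -- boundary, beyond radius R, and are covered by the outer estimate.
  let Xi : M.Λ → Plane := fun p => if (p : Plane) ∈ D.Ω then X p else 0
  let Xb : M.Λ → Plane := fun p => if (p : Plane) ∈ D.Ω then 0 else X p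
  have hXsum : X = Xi + Xb := by
    funext p
    by_cases hp : (p : Plane) ∈ D.Ω <;> simp [Xi, Xb, hp]
  have hXi : Xi ∈ D.dispSpace := fun p hp => if_neg hp
  have hXi' : ∀ p ∉ D.atoms, Xi p = 0 := fun p hp => hXi p fun h => hp (D.mem_atoms.2 h)
  have hXb : ∀ p ∉ bd, Xb p = 0 := by
    intro p hp
    by_cases hpΩ : (p : Plane) ∈ D.Ω
    · exact if_pos hpΩ
    · have : (p : Plane) ∉ closure D.Ω := fun h =>
        hp (Finset.mem_filter.2 ⟨D.mem_closureAtoms.2 h, hpΩ⟩)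
      simp [Xb, hpΩ, hX p this]
  set a2 := ∑ p ∈ D.atoms, ‖Xi p‖ ^ 2 with ha2
  set b2 := ∑ p ∈ bd, ‖Xb p‖ ^ 2 with hb2
  have ha0 : 0 ≤ a2 := Finset.sum_nonneg fun _ _ => sq_nonneg _
  have hsplit : ∑ p ∈ D.closureAtoms, ‖X p‖ ^ 2 = a2 + b2 := by
    rw [← Finset.sum_filter_add_sum_filter_not D.closureAtoms fun p : M.Λ => (p : Plane) ∈ D.Ω]
    have e : D.closureAtoms.filter (fun p : M.Λ => (p : Plane) ∈ D.Ω) = D.atoms := by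
      ext p
      rw [Finset.mem_filter, D.mem_closureAtoms, D.mem_atoms]
      exact ⟨fun h => h.2, fun h => ⟨subset_closure h, h⟩⟩
    rw [e]
    congr 1
    · refine Finset.sum_congr rfl fun p hp => ?_
      simp only [Xi, if_pos (D.mem_atoms.1 hp)]
    · refine Finset.sum_congr rfl fun p hp => ?_
      simp only [Xb, if_neg (Finset.mem_filter.1 hp).2]
  have hb : b2 ≤ C₁ * n2 ^ 2 := by
    have : b2 = ∑ p ∈ bd, ‖X p‖ ^ 2 := Finset.sum_congr rfl fun p hp => by
      simp only [Xb, if_neg (Finset.mem_filter.1 hp).2]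
    rw [this]
    refine h₁ D X bd fun p hp => ?_
    obtain ⟨hp1, hp2⟩ := Finset.mem_filter.1 hp
    have := D.norm_lt_of_notMem_Ω hp2
    exact ⟨D.mem_closureAtoms.1 hp1, by linarith [D.R_pos]⟩
  obtain ⟨hXife, hXin⟩ := h₂ Xi D.atoms hXi'
  have hmass : a2 ≤ C₃ * ∫ x in D.Ω, ‖M.interp Xi x‖ ^ 2 := by
    refine h₃ Xi D.atoms D.Ω (2 * D.R) D.isOpen_Ω.measurableSet D.Ω_subset_closedBall
      fun p hp => ?_
    obtain ⟨T, hT, hpT⟩ := D.exists_mem_TΩ (subset_closure (D.mem_atoms.1 hp))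
    refine ⟨T, D.TΩ_subset T hT, hpT, ?_⟩
    rintro _ ⟨y, hy, rfl⟩
    have := homothety_mem_interior hpT hy one_pos le_rfl
    exact ⟨D.interior_hull_subset_Ω hT this, this⟩
  have hb' : ∫ x in D.Ω, ‖M.interp Xb x‖ ^ 2 ≤ C₄ * b2 :=
    h₄ Xb bd D.Ω hXb D.isOpen_Ω.measurableSet
  -- Pointwise |Xi|² ≤ 2 X · Xi + |Xb|², which is |Xi + Xb|² ≥ 0 rearranged for X = Xi + Xb; the
  -- middle term is then the load of the Poisson problem.
  have htest : (∫ x in D.Ω, ‖M.interp Xi x‖ ^ 2) ≤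
      2 * D.dirichlet g Xi + ∫ x in D.Ω, ‖M.interp Xb x‖ ^ 2 := by
    have hi := integrableOn_norm_interp_sq Xi D.Ω_subset_closedBall
    have hb := integrableOn_norm_interp_sq Xb D.Ω_subset_closedBall
    have hx := D.integrableOn_inner (continuous_interp X) (continuous_interp Xi)
    rw [hgw Xi hXi, ← integral_const_mul, ← integral_add (hx.const_mul 2) hb]
    refine integral_mono hi ((hx.const_mul 2).add hb) fun x => ?_
    have e : M.interp X x = M.interp Xi x + M.interp Xb x := by
      conv_lhs => rw [hXsum, interp_add]
      rfl
    simp only [e, inner_add_left, real_inner_self_eq_norm_sq]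
    have h5 := real_inner_self_nonneg (x := M.interp Xi x + M.interp Xb x)
    rw [real_inner_self_eq_norm_sq, norm_add_sq_real] at h5
    have h6 := real_inner_comm (M.interp Xi x) (M.interp Xb x)
    linarith
  have hcs : D.dirichlet g Xi ≤ √(D.dirichlet g g) * (√C₂ * √a2) := by
    refine (D.dirichlet_le g Xi).trans (mul_le_mul_of_nonneg_left ?_ (Real.sqrt_nonneg _))
    refine (D.sqrt_dirichlet_le hXife).trans ?_
    rw [← Real.sqrt_mul hC₂.le]
    exact Real.le_sqrt_of_sq_le hXin
  set η := √(D.dirichlet g g)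
  have hη2 : η ^ 2 = D.dirichlet g g := Real.sq_sqrt (D.dirichlet_self_nonneg g)
  have h7 : a2 ≤ 2 * (C₃ * η * √C₂) * √a2 + C₃ * C₄ * b2 := by
    have := mul_le_mul_of_nonneg_left (htest.trans (add_le_add
      (mul_le_mul_of_nonneg_left hcs zero_le_two) hb')) hC₃.le
    refine (hmass.trans this).trans (le_of_eq ?_)
    ring
  -- Young's inequality absorbs half of a2 into the left side.
  have h8 : a2 ≤ 4 * C₃ ^ 2 * C₂ * η ^ 2 + 2 * C₃ * C₄ * b2 := by
    have h9 := Real.sq_sqrt ha0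
    have h10 := Real.sq_sqrt hC₂.le
    have h11 := sq_nonneg (√a2 - 2 * (C₃ * η * √C₂))
    have h12 : (C₃ * η * √C₂) ^ 2 = C₃ ^ 2 * C₂ * η ^ 2 := by
      rw [mul_pow, mul_pow, h10]
      ring
    nlinarith
  rw [hsplit, ← hη2]
  have h13 : (2 * C₃ * C₄ + 1) * b2 ≤ (2 * C₃ * C₄ + 1) * (C₁ * n2 ^ 2) := by gcongr
  have h14 : 0 ≤ (2 * C₃ * C₄ + 1) * C₁ * η ^ 2 := by positivity
  have h15 : 0 ≤ 4 * C₃ ^ 2 * C₂ * n2 ^ 2 := by positivity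
  nlinarith

/-- After subtraction of a constant the test function is split into the quasi-interpolant of its
truncation w, the averaging error of w, and the tail removed by the cut-off. -/
theorem _root_.BlendedAC.AtomisticModel.exists_residualNorm_le (M : AtomisticModel) :
    ∃ C > 0, ∀ (D : Discretization M) (uh φ : Plane → Plane), (M.nodal uh).support.Finite →
      D.CoversForces uh → D.IsPoissonSolution uh φ →
      M.residualNorm (M.nodal uh) ≤
        ENNReal.ofReal (C * (D.estimator φ + D.truncation uh φ)) := by
  classical
  obtain ⟨r₀, hr₀, hr⟩ := M.exists_le_radius
  obtain ⟨m, hm0, hmass⟩ := M.exists_mass_le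
  obtain ⟨C₁, hC₁, h₁⟩ := M.exists_outer_force_le
  obtain ⟨C₂, hC₂, h₂⟩ := M.exists_sum_scaledForce_le
  obtain ⟨C₃, hC₃, h₃⟩ := M.exists_truncation hr₀
  obtain ⟨C₄, hC₄, h₄⟩ := M.exists_norm12_le
  refine ⟨√(C₄ * C₃) + m * √C₂ * √C₃ * (1 + 1 / r₀) + m * √C₁ * √C₃,
    by positivity, fun D uh φ hfin hcov hφ => residualNorm_le fun v hv hv1 => ?_⟩
  have hR := hr D
  have hR0 := D.R_pos
  obtain ⟨g, hg, rfl, hgw⟩ := hφ.exists_eq_interp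
  set u := M.nodal uh with hu
  set X := M.scaledForce u with hX
  set S := D.closureAtoms
  have hF0 : ∀ p ∉ S, M.force u p = 0 := fun p hp =>
    hcov p fun h => hp (D.mem_closureAtoms.2 h)
  have hX0 : ∀ p : M.Λ, (p : Plane) ∉ closure D.Ω → X p = 0 := fun p hp => by
    rw [hX, scaledForce, hcov p hp, smul_zero]
  have hFX : ∀ p, ‖M.force u p‖ ≤ m * ‖X p‖ := by
    intro p
    have hp := mass_pos p
    have : M.force u p = M.mass p • X p := by
      rw [hX, scaledForce, smul_smul, mul_inv_cancel₀ hp.ne', one_smul]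
    rw [this, norm_smul, Real.norm_of_nonneg hp.le]
    exact mul_le_mul_of_nonneg_right (hmass p) (norm_nonneg _)
  have hFX2 : ∀ p, ‖M.force u p‖ ^ 2 ≤ m ^ 2 * ‖X p‖ ^ 2 := fun p => by
    rw [← mul_pow]
    exact pow_le_pow_left₀ (norm_nonneg _) (hFX p) 2
  rw [estimator_eq]
  set η := √(D.dirichlet g g) with hη
  have hη0 : 0 ≤ η := Real.sqrt_nonneg _
  have hη2 : η ^ 2 = D.dirichlet g g := Real.sq_sqrt (D.dirichlet_self_nonneg g)
  set n2 := normL2 (D.Ω \ Metric.closedBall 0 (D.R / 2)) (M.interp X) with hn2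
  have hn0 : 0 ≤ n2 := Real.sqrt_nonneg _
  -- Only the force part of the truncation indicator is used; its gradient part is dropped.
  have htr : D.R * n2 ≤ D.truncation uh (M.interp g) := by
    rw [truncation, forceInterp_eq, ← hu, ← hX, ← hn2]
    exact le_add_of_nonneg_right (Real.sqrt_nonneg _)
  have hall : ∑ p ∈ S, ‖X p‖ ^ 2 ≤ C₂ * (η ^ 2 + n2 ^ 2) := by
    rw [hη2]
    refine h₂ D X g hg hX0 fun w hw => ?_
    rw [hgw w hw, forceInterp_eq]
  have hall' : ∑ p ∈ S, ‖M.force u p‖ ^ 2 ≤ (m * √C₂ * (η + n2)) ^ 2 := by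
    refine (Finset.sum_le_sum fun p _ => hFX2 p).trans ?_
    rw [← Finset.mul_sum, mul_pow, mul_pow, Real.sq_sqrt hC₂.le, mul_assoc]
    refine mul_le_mul_of_nonneg_left (hall.trans ?_) (sq_nonneg m)
    refine mul_le_mul_of_nonneg_left ?_ hC₂.le
    nlinarith [mul_nonneg hη0 hn0]
  obtain ⟨c, hc, hw⟩ := h₃ D.R hR v hv
  set w : M.Λ → Plane := fun p => cutoff D.R p • (v p - c) with hwdef
  have hv2 : M.norm12 v ^ 2 ≤ 1 := pow_le_one₀ (norm12_nonneg v) hv1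
  have hw' : SumLe (M.locEnergy M.meshSize w) C₃ :=
    hw.mono (fun _ => le_rfl) (mul_le_of_le_one_right hC₃.le hv2)
  obtain ⟨hwfe, hwn⟩ := h₄ w C₃ hw'
  have hwD : w ∈ D.dispSpace := fun p hp => by
    simp only [hwdef]
    rw [cutoff_eq_zero hR0 (D.norm_lt_of_notMem_Ω hp).le, zero_smul]
  -- The quasi-interpolant turns the sum of forces into the load of the Poisson problem, hence into
  -- a Dirichlet product with φ_a.
  have hA : ∑ p ∈ S, ⟪M.force u p, M.quasiInterp w p⟫ ≤ √(C₄ * C₃) * η := by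
    rw [← integral_forceInterp hF0, ← D.integral_inner_interp _ hwD, ← hgw w hwD, mul_comm]
    refine (D.dirichlet_le g w).trans (mul_le_mul_of_nonneg_left ?_ hη0)
    exact (D.sqrt_dirichlet_le hwfe).trans (Real.le_sqrt_of_sq_le hwn)
  -- `dirichlet_le` is one-sided; the other sign follows by inserting -w.
  have hA' : -(√(C₄ * C₃) * η) ≤ ∑ p ∈ S, ⟪M.force u p, M.quasiInterp w p⟫ := by
    have hneg : (-1 : ℝ) • w ∈ D.dispSpace := D.dispSpace.smul_mem _ hwD
    have e : D.dirichlet g ((-1 : ℝ) • w) = -D.dirichlet g w := by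
      rw [dirichlet_comm, dirichlet_smul_left, dirichlet_comm]
      ring
    have e2 : D.dirichlet ((-1 : ℝ) • w) ((-1 : ℝ) • w) = D.dirichlet w w := by
      rw [dirichlet_smul_left, dirichlet_comm, dirichlet_smul_left]
      ring
    have h5 := D.dirichlet_le g ((-1 : ℝ) • w)
    rw [e, e2] at h5
    rw [← integral_forceInterp hF0, ← D.integral_inner_interp _ hwD, ← hgw w hwD, neg_le, mul_comm]
    refine h5.trans (mul_le_mul_of_nonneg_left ?_ hη0)
    exact (D.sqrt_dirichlet_le hwfe).trans (Real.le_sqrt_of_sq_le hwn)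
  -- The averaging error is local and needs no factor R, whereas the forces enter through the full
  -- ℓ² bound.
  have hB : |∑ p ∈ S, ⟪M.force u p, w p - M.quasiInterp w p⟫|
      ≤ (m * √C₂ * (η + n2)) * √C₃ := by
    refine (Finset.abs_sum_le_sum_abs _ _).trans ?_
    refine (Finset.sum_le_sum fun p _ => abs_real_inner_le_norm _ _).trans ?_
    refine sum_mul_le_of_sq S _ _ (by positivity) (Real.sqrt_nonneg _) hall' ?_
    rw [Real.sq_sqrt hC₃.le]
    refine (Finset.sum_le_sum fun p _ => ?_).trans (hw' S)
    rw [norm_sub_rev]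
    exact norm_quasiInterp_sub_sq_le w p
  -- The tail vanishes where the cut-off is one, so only atoms beyond 3R/4 remain; the Poincaré
  -- factor R joins the outer norm of the force field.
  have hCc : |∑ p ∈ S, ⟪M.force u p, (v p - c) - w p⟫|
      ≤ (m * √C₁ * n2) * (√C₃ * D.R) := by
    set S' := S.filter fun p : M.Λ => 3 / 4 * D.R ≤ ‖(p : Plane)‖ with hS'
    have h5 : ∑ p ∈ S, ⟪M.force u p, (v p - c) - w p⟫
        = ∑ p ∈ S', ⟪M.force u p, (v p - c) - w p⟫ := by
      refine (Finset.sum_subset (Finset.filter_subset _ _) fun p hp hp' => ?_).symm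
      have h6 : ‖(p : Plane)‖ ≤ 3 / 4 * D.R := by
        by_contra h
        exact hp' (Finset.mem_filter.2 ⟨hp, (not_le.1 h).le⟩)
      simp only [hwdef]
      rw [cutoff_eq_one hR0 h6, one_smul, sub_self, inner_zero_right]
    rw [h5]
    refine (Finset.abs_sum_le_sum_abs _ _).trans ?_
    have h7 : ∀ p ∈ S', |⟪M.force u p, (v p - c) - w p⟫| ≤ ‖M.force u p‖ * ‖v p - c‖ := by
      intro p _
      refine (abs_real_inner_le_norm _ _).trans (mul_le_mul_of_nonneg_left ?_ (norm_nonneg _))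
      have e : (v p - c) - w p = (1 - cutoff D.R (p : Plane)) • (v p - c) := by
        simp only [hwdef]
        module
      rw [e, norm_smul]
      refine mul_le_of_le_one_left (norm_nonneg _) ?_
      have := cutoff_nonneg D.R (p : Plane)
      have := cutoff_le_one D.R (p : Plane)
      rw [Real.norm_of_nonneg (by linarith)]
      linarith
    refine (Finset.sum_le_sum h7).trans ?_
    refine sum_mul_le_of_sq S' _ _ (by positivity) (by positivity) ?_ ?_
    · refine (Finset.sum_le_sum fun p _ => hFX2 p).trans ?_
      rw [← Finset.mul_sum, mul_pow, mul_pow, Real.sq_sqrt hC₁.le, mul_assoc]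
      refine mul_le_mul_of_nonneg_left ?_ (sq_nonneg m)
      refine h₁ D X S' fun p hp => ?_
      obtain ⟨hp1, hp2⟩ := Finset.mem_filter.1 hp
      exact ⟨D.mem_closureAtoms.1 hp1, hp2⟩
    · rw [mul_pow, Real.sq_sqrt hC₃.le]
      refine (hc S' fun p hp => ?_).trans (mul_le_of_le_one_right (by positivity) hv2)
      exact D.norm_le_of_mem_closure (D.mem_closureAtoms.1 (Finset.mem_filter.1 hp).1)
  have hsum : M.residual u v = ∑ p ∈ S, ⟪M.force u p, M.quasiInterp w p⟫
      + ∑ p ∈ S, ⟪M.force u p, w p - M.quasiInterp w p⟫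
      + ∑ p ∈ S, ⟪M.force u p, (v p - c) - w p⟫ := by
    have h5 := sum_force_inner_const hfin hF0 c
    rw [residual_eq_sum hfin hF0 hv, ← sub_zero (∑ p ∈ S, ⟪M.force u p, v p⟫), ← h5,
      ← Finset.sum_sub_distrib, ← Finset.sum_add_distrib, ← Finset.sum_add_distrib]
    refine Finset.sum_congr rfl fun p _ => ?_
    simp only [inner_sub_right]
    ring
  -- The lower bound on R lets the unscaled outer norm be absorbed into the scaled one.
  have hn2R : n2 ≤ 1 / r₀ * (D.R * n2) := by
    rw [one_div, inv_mul_eq_div, le_div_iff₀ hr₀, mul_comm]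
    exact mul_le_mul_of_nonneg_right hR hn0
  set τ := D.truncation uh (M.interp g)
  have hτ0 : 0 ≤ τ := (mul_nonneg hR0.le hn0).trans htr
  have hn2τ : n2 ≤ 1 / r₀ * τ := hn2R.trans (mul_le_mul_of_nonneg_left htr (by positivity))
  have k1 : √(C₄ * C₃) * η ≤ √(C₄ * C₃) * (η + τ) := by gcongr; linarith
  have k2 : (m * √C₂ * (η + n2)) * √C₃ ≤ m * √C₂ * √C₃ * (1 + 1 / r₀) * (η + τ) := by
    have : η + n2 ≤ (1 + 1 / r₀) * (η + τ) := by
      have : 0 ≤ 1 / r₀ * η := by positivity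
      nlinarith
    calc (m * √C₂ * (η + n2)) * √C₃ = m * √C₂ * √C₃ * (η + n2) := by ring
      _ ≤ m * √C₂ * √C₃ * ((1 + 1 / r₀) * (η + τ)) := by gcongr
      _ = _ := by ring
  have k3 : (m * √C₁ * n2) * (√C₃ * D.R) ≤ m * √C₁ * √C₃ * (η + τ) := by
    calc (m * √C₁ * n2) * (√C₃ * D.R) = m * √C₁ * √C₃ * (D.R * n2) := by ring
      _ ≤ _ := by gcongr; linarith
  rw [hsum]
  have hA2 : |∑ p ∈ S, ⟪M.force u p, M.quasiInterp w p⟫| ≤ √(C₄ * C₃) * η :=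
    abs_le.2 ⟨hA', hA⟩
  refine (abs_add_three _ _ _).trans ?_
  linarith

end Discretization
end BlendedAC
end

/-! ### Equivalence of error and residual near a strongly stable solution. -/

noncomputable section
namespace BlendedAC
namespace AtomisticModel
variable {M : AtomisticModel}

theorem IsStronglyStable.firstForm_eq_zero {u : M.Λ → Plane} (hu : M.IsStronglyStable u)
    {v : M.Λ → Plane} (hv : M.IsFiniteEnergy v) : M.firstForm u v = 0 := by
  obtain ⟨ε, hε, h⟩ := hu.local_min
  refine IsLocalMin.hasDerivAt_eq_zero (f := fun t : ℝ => M.energy (u + t • v)) (a := 0) ?_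
    (hasDerivAt_energy hu.finite_energy hv)
  have hc : Filter.Tendsto (fun t : ℝ => |t| * M.norm12 v) (nhds 0) (nhds 0) := by
    have : Continuous fun t : ℝ => |t| * M.norm12 v := by fun_prop
    simpa using this.tendsto 0
  filter_upwards [hc.eventually_lt_const hε] with t ht
  rw [zero_smul, add_zero]
  refine h _ (hu.finite_energy.add (hv.smul t)) ?_
  rwa [add_sub_cancel_left, norm12_smul]

theorem norm_stencil_add_smul_le {C : ℝ} (hC : ∀ u : M.Λ → Plane, M.IsFiniteEnergy u →
    ∀ k, ‖M.lattice.stencil u k‖ ≤ C * M.norm12 u) {u d : M.Λ → Plane} (hu : M.IsFiniteEnergy u)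
    (hd : M.IsFiniteEnergy d) {s : ℝ} (hs : s ∈ Set.Icc (0 : ℝ) 1) (k : M.Λ) :
    ‖M.lattice.stencil (u + s • d) k‖ ≤ C * M.norm12 u + C * M.norm12 d := by
  have h0 := (norm_nonneg _).trans (hC d hd k)
  rw [stencil_add, stencil_smul]
  refine (norm_add_le _ _).trans (add_le_add (hC u hu k) ?_)
  rw [norm_smul, Real.norm_of_nonneg hs.1]
  exact (mul_le_mul hs.2 (hC d hd k) (norm_nonneg _) zero_le_one).trans_eq (one_mul _)

theorem abs_hess_apply_le (k : M.Λ) {L : ℝ} {g : interactionRange M.Λ M.lattice.rcut k → Plane}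
    (h : ‖M.hess k g‖ ≤ L) (a b : interactionRange M.Λ M.lattice.rcut k → Plane) :
    |M.hess k g a b| ≤ L * (‖a‖ * ‖b‖) := by
  refine ((M.hess k g).le_opNorm₂ a b).trans ?_
  rw [mul_assoc]
  exact mul_le_mul_of_nonneg_right h (by positivity)

/-- The second variation is bounded near `u`. -/
theorem exists_abs_secondForm_le {u : M.Λ → Plane} (hu : M.IsFiniteEnergy u) : ∃ C > 0,
    ∀ d w : M.Λ → Plane, M.IsFiniteEnergy d → M.IsFiniteEnergy w → M.norm12 d ≤ 1 →
      ∀ s ∈ Set.Icc (0 : ℝ) 1,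
        |M.secondForm (u + s • d) d w| ≤ C * (M.norm12 d * M.norm12 w) := by
  obtain ⟨C₁, hC₁, h₁⟩ := M.exists_norm_stencil_le
  obtain ⟨C₂, hC₂, h₂⟩ := M.exists_sumLe_stencil
  obtain ⟨C₃, hC₃, h₃⟩ := M.exists_norm_hess_le (C₁ * M.norm12 u + C₁)
  refine ⟨C₃ * C₂, by positivity, fun d w hd hw hd1 s hs => ?_⟩
  have hb : ∀ k, ‖M.hess k (M.lattice.stencil (u + s • d) k) (M.lattice.stencil d k)
      (M.lattice.stencil w k)‖ ≤ C₃ * (‖M.lattice.stencil d k‖ * ‖M.lattice.stencil w k‖) := by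
    intro k
    refine abs_hess_apply_le k (h₃ k _ ?_) _ _
    refine (norm_stencil_add_smul_le h₁ hu hd hs k).trans ?_
    nlinarith
  refine (tsum_of_norm_bounded ((hd.summable_mul hw).mul_left C₃).hasSum hb).trans ?_
  rw [tsum_mul_left, mul_assoc]
  exact mul_le_mul_of_nonneg_left (tsum_mul_le h₂ hC₂.le hd hw) hC₃.le

/-- Coercivity of the second variation persists near `u`. -/
theorem IsStronglyStable.exists_le_secondForm {u : M.Λ → Plane} (hu : M.IsStronglyStable u) :
    ∃ γ > 0, ∃ δ > 0, ∀ d : M.Λ → Plane, M.IsFiniteEnergy d → M.norm12 d ≤ δ →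
      ∀ s ∈ Set.Icc (0 : ℝ) 1, γ * M.norm12 d ^ 2 ≤ M.secondForm (u + s • d) d d := by
  have hfe := hu.finite_energy
  obtain ⟨γ, hγ, hst⟩ := hu.stable
  obtain ⟨C₁, hC₁, h₁⟩ := M.exists_norm_stencil_le
  obtain ⟨C₂, hC₂, h₂⟩ := M.exists_sumLe_stencil
  -- This tolerance for the change of the Hessians costs at most half of the coercivity constant.
  have hε : 0 < γ / (2 * C₂) := by positivity
  obtain ⟨δ, hδ, h₃⟩ := M.exists_hess_sub_le (C₁ * M.norm12 u) hε
  -- The energy norm controls the strain uniformly with constant C₁, so strain perturbations stay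
  -- below δ.
  refine ⟨γ / 2, by positivity, δ / C₁, by positivity, fun d hd hdδ s hs => ?_⟩
  have hsum : ∀ v : M.Λ → Plane, M.IsFiniteEnergy v → Summable fun k =>
      M.hess k (M.lattice.stencil v k) (M.lattice.stencil d k) (M.lattice.stencil d k) := by
    intro v hv
    obtain ⟨C, hC, h⟩ := M.exists_norm_hess_le (C₁ * M.norm12 v)
    exact Summable.of_norm_bounded ((hd.summable_mul hd).mul_left C) fun k =>
      abs_hess_apply_le k (h k _ (h₁ v hv k)) _ _
  have hb : ∀ k, ‖M.hess k (M.lattice.stencil (u + s • d) k) (M.lattice.stencil d k)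
      (M.lattice.stencil d k) - M.hess k (M.lattice.stencil u k) (M.lattice.stencil d k)
      (M.lattice.stencil d k)‖
      ≤ γ / (2 * C₂) * (‖M.lattice.stencil d k‖ * ‖M.lattice.stencil d k‖) := by
    intro k
    have h4 : ‖M.lattice.stencil (s • d) k‖ ≤ δ := by
      refine (h₁ _ (hd.smul s) k).trans ?_
      rw [norm12_smul, abs_of_nonneg hs.1, ← le_div_iff₀' hC₁]
      exact (mul_le_of_le_one_left (norm12_nonneg d) hs.2).trans hdδ
    have h5 := h₃ k (M.lattice.stencil u k) (M.lattice.stencil (s • d) k) (h₁ u hfe k) h4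
    rw [← stencil_add] at h5
    refine ((M.hess k (M.lattice.stencil (u + s • d) k)
      - M.hess k (M.lattice.stencil u k)).le_opNorm₂ _ _).trans ?_
    rw [mul_assoc]
    exact mul_le_mul_of_nonneg_right h5 (by positivity)
  have h6 := tsum_of_norm_bounded ((hd.summable_mul hd).mul_left (γ / (2 * C₂))).hasSum hb
  rw [(hsum _ (hfe.add (hd.smul s))).tsum_sub (hsum u hfe), tsum_mul_left, Real.norm_eq_abs] at h6
  have h7 := mul_le_mul_of_nonneg_left (tsum_mul_le h₂ hC₂.le hd hd) hε.le
  have h8 : γ / (2 * C₂) * (C₂ * (M.norm12 d * M.norm12 d)) = γ / 2 * M.norm12 d ^ 2 := by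
    field_simp
  have h9 := hst d hd
  rw [secondVariation_eq hfe hd hd] at h9
  have h10 := (abs_le.1 (h6.trans h7)).1
  rw [h8] at h10
  change _ ≤ M.secondForm (u + s • d) d d - M.secondForm u d d at h10
  linarith

/-- Near a critical point the residual norm is bounded by the error. -/
theorem exists_residualNorm_le_norm12 {u : M.Λ → Plane} (hu : M.IsFiniteEnergy u)
    (h0 : ∀ v, M.IsFiniteEnergy v → M.firstForm u v = 0) : ∃ C > 0, ∀ d : M.Λ → Plane,
      M.IsFiniteEnergy d → M.norm12 d ≤ 1 →
        M.residualNorm (u + d) ≤ ENNReal.ofReal (C * M.norm12 d) := by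
  obtain ⟨C, hC, h⟩ := exists_abs_secondForm_le hu
  refine ⟨C, hC, fun d hd hd1 => residualNorm_le fun w hw hw1 => ?_⟩
  -- Mean value inequality on the segment from u to u + d, where the first variation starts from
  -- zero.
  have := (convex_Icc (0 : ℝ) 1).norm_image_sub_le_of_norm_hasDerivWithin_le
    (fun s _ => (hasDerivAt_firstForm hu hd hw s).hasDerivWithinAt)
    (fun s hs => h d w hd hw hd1 s hs) (Set.left_mem_Icc.2 zero_le_one)
    (Set.right_mem_Icc.2 zero_le_one)
  rw [one_smul, zero_smul, add_zero, h0 w hw, sub_zero, sub_zero, norm_one, mul_one,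
    Real.norm_eq_abs] at this
  rw [residual_eq (hu.add hd) hw]
  refine this.trans ?_
  rw [← mul_assoc]
  exact mul_le_of_le_one_right (mul_nonneg hC.le (norm12_nonneg d)) hw1

/-- Near a strongly stable solution the error is bounded by the residual norm. -/
theorem IsStronglyStable.exists_norm12_le_residualNorm {u : M.Λ → Plane}
    (hu : M.IsStronglyStable u) : ∃ γ > 0, ∃ δ > 0, ∀ d : M.Λ → Plane,
      M.IsFiniteEnergy d → M.norm12 d ≤ δ →
        ENNReal.ofReal (γ * M.norm12 d) ≤ M.residualNorm (u + d) := by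
  obtain ⟨γ, hγ, δ, hδ, h⟩ := hu.exists_le_secondForm
  refine ⟨γ, hγ, δ, hδ, fun d hd hdδ => ?_⟩
  rcases (norm12_nonneg d).eq_or_lt with h0 | h0
  · simp [← h0]
  have hfe := hu.finite_energy
  -- The residual is tested with the error itself; coercivity along the whole segment bounds the
  -- increment of the first variation from below.
  have hmv : γ * M.norm12 d ^ 2 ≤ M.firstForm (u + d) d := by
    have hd' : ∀ s : ℝ, HasDerivAt (fun s : ℝ => M.firstForm (u + s • d) d)
      (M.secondForm (u + s • d) d d) s := hasDerivAt_firstForm hfe hd hd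
    have := (convex_Icc (0 : ℝ) 1).mul_sub_le_image_sub_of_le_deriv
      (fun s _ => (hd' s).continuousAt.continuousWithinAt)
      (fun s _ => (hd' s).differentiableAt.differentiableWithinAt)
      (fun s hs => (h d hd hdδ s (interior_subset hs)).trans_eq (hd' s).deriv.symm)
      0 (Set.left_mem_Icc.2 zero_le_one) 1 (Set.right_mem_Icc.2 zero_le_one) zero_le_one
    simpa [hu.firstForm_eq_zero hd] using this
  refine le_trans (ENNReal.ofReal_le_ofReal ?_)
    (ofReal_le_residualNorm (hfe.add hd) hd h0 le_rfl)
  rw [residual_eq (hfe.add hd) hd, le_div_iff₀ h0]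
  refine le_trans (le_of_eq ?_) (hmv.trans (le_abs_self _))
  ring

end AtomisticModel

/-- BQCE is the slowest of the methods. -/
theorem BlendedMethod.rate_le (m : BlendedMethod) : m.rate ≤ -(1 / 2) := by
  rcases m with _ | k | k
  · norm_num [rate]
  all_goals cases k <;> norm_num [rate]

theorem exists_mul_rpow_rate_le (K : ℝ) {δ : ℝ} (hδ : 0 < δ) : ∃ N : ℕ,
    ∀ (m : BlendedMethod) (n : ℕ), N ≤ n → K * (n : ℝ) ^ m.rate ≤ δ := by
  have ht : Filter.Tendsto (fun n : ℕ => |K| * (n : ℝ) ^ (-(1 / 2) : ℝ)) Filter.atTop (nhds 0) := by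
    have := ((tendsto_rpow_neg_atTop (y := 1 / 2) (by norm_num)).comp
      tendsto_natCast_atTop_atTop).const_mul |K|
    simpa using this
  obtain ⟨N, hN⟩ := Filter.eventually_atTop.1 (ht.eventually_le_const hδ)
  -- At least one degree of freedom is required for powers to be monotone in the exponent; |K|
  -- covers negative K.
  refine ⟨max N 1, fun m n hn => le_trans ?_ (hN n ((le_max_left _ _).trans hn))⟩
  have hn1 : (1 : ℝ) ≤ n := by exact_mod_cast (le_max_right N 1).trans hn
  calc K * (n : ℝ) ^ m.rate ≤ |K| * (n : ℝ) ^ m.rate :=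
        mul_le_mul_of_nonneg_right (le_abs_self K) (Real.rpow_nonneg (by linarith) _)
    _ ≤ _ := mul_le_mul_of_nonneg_left (Real.rpow_le_rpow_of_exponent_le hn1 m.rate_le)
        (abs_nonneg K)

/-- The residual norm is the intermediary: equivalent to the error near the solution, and bounded on
both sides through the estimator and the truncation indicator. The threshold also includes 1, up to
which the second variation was bounded. -/
theorem AtomisticModel.IsStronglyStable.exists_estimator_bounds {M : AtomisticModel}
    {ua : M.Λ → Plane} (hua : M.IsStronglyStable ua) : ∃ c > 0, ∃ C > 0, ∃ δ > 0,
      ∀ (D : Discretization M) (uh φ : Plane → Plane), (M.nodal uh).support.Finite →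
        D.CoversForces uh → M.norm12 (ua - M.nodal uh) ≤ δ → D.IsPoissonSolution uh φ →
          c * D.estimator φ ≤ M.norm12 (ua - M.nodal uh) ∧
          M.norm12 (ua - M.nodal uh) ≤ C * (D.estimator φ + D.truncation uh φ) := by
  obtain ⟨c₀, hc₀, h₀⟩ := M.exists_estimator_le
  obtain ⟨C₀, hC₀, h₁⟩ := M.exists_residualNorm_le
  obtain ⟨C₁, hC₁, h₂⟩ := exists_residualNorm_le_norm12 hua.finite_energy
    fun _ => hua.firstForm_eq_zero
  obtain ⟨γ, hγ, δ, hδ, h₃⟩ := hua.exists_norm12_le_residualNorm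
  refine ⟨c₀ / C₁, by positivity, C₀ / γ, by positivity, min δ 1, lt_min hδ one_pos,
    fun D uh φ hfin hcov hnear hφ => ?_⟩
  set d := M.nodal uh - ua with hd
  have hdfe : M.IsFiniteEnergy d := (isFiniteEnergy_of_support hfin).sub hua.finite_energy
  have hnorm : M.norm12 (ua - M.nodal uh) = M.norm12 d := by rw [← norm12_neg, neg_sub]
  have hadd : ua + d = M.nodal uh := add_sub_cancel _ _
  rw [hnorm] at hnear ⊢
  have hη : 0 ≤ D.estimator φ := Real.sqrt_nonneg _
  have hρ : 0 ≤ D.truncation uh φ :=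
    add_nonneg (mul_nonneg D.R_pos.le (Real.sqrt_nonneg _)) (Real.sqrt_nonneg _)
  have hlow := (h₀ D uh φ hfin hφ).trans
    (hadd ▸ h₂ d hdfe (hnear.trans (min_le_right _ _)))
  have hup := (hadd ▸ h₃ d hdfe (hnear.trans (min_le_left _ _))).trans
    (h₁ D uh φ hfin hcov hφ)
  rw [ENNReal.ofReal_le_ofReal_iff (mul_nonneg hC₁.le (norm12_nonneg d))] at hlow
  rw [ENNReal.ofReal_le_ofReal_iff (by positivity)] at hup
  constructor
  · rwa [div_mul_eq_mul_div, div_le_iff₀' hC₁]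
  · rwa [div_mul_eq_mul_div, le_div_iff₀' hγ]

end BlendedAC
end

/-! ### The theorem. -/

theorem theorem3p3 (M : BlendedAC.AtomisticModel) :
    (∃ c C : ℝ, 0 < c ∧ 0 < C ∧
      ∀ (D : BlendedAC.Discretization M) (m : BlendedAC.BlendedMethod)
        (uh : BlendedAC.Plane → BlendedAC.Plane),
        D.IsSolution m uh → D.CoversForces uh →
          (∃! φa, D.IsPoissonSolution uh φa) ∧
          ∀ φa, D.IsPoissonSolution uh φa →
            ENNReal.ofReal (c * D.estimator φa) ≤ M.residualNorm (M.nodal uh) ∧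
            M.residualNorm (M.nodal uh) ≤
              ENNReal.ofReal (C * (D.estimator φa + D.truncation uh φa))) ∧
    (∀ ua : M.Λ → BlendedAC.Plane, M.IsStronglyStable ua → ∀ K : ℝ,
      ∃ (c C : ℝ) (N : ℕ), 0 < c ∧ 0 < C ∧
        ∀ (D : BlendedAC.Discretization M) (m : BlendedAC.BlendedMethod)
          (uh : BlendedAC.Plane → BlendedAC.Plane),
          D.IsSolution m uh → D.CoversForces uh →
          M.norm12 (ua - M.nodal uh) ≤ K * (D.dof : ℝ) ^ m.rate → N ≤ D.dof →
          ∀ φa, D.IsPoissonSolution uh φa →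
            c * D.estimator φa ≤ M.norm12 (ua - M.nodal uh) ∧
            M.norm12 (ua - M.nodal uh) ≤ C * (D.estimator φa + D.truncation uh φa)) := by
  obtain ⟨c, hc, hlow⟩ := M.exists_estimator_le
  obtain ⟨C, hC, hup⟩ := M.exists_residualNorm_le
  refine ⟨⟨c, C, hc, hC, fun D m uh hsol hcov => ⟨D.existsUnique_isPoissonSolution uh,
    fun φ hφ => ⟨hlow D uh φ hsol.finite_support hφ,
      hup D uh φ hsol.finite_support hcov hφ⟩⟩⟩, fun ua hua K => ?_⟩
  obtain ⟨c', hc', C', hC', δ, hδ, h⟩ := hua.exists_estimator_bounds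
  obtain ⟨N, hN⟩ := BlendedAC.exists_mul_rpow_rate_le K hδ
  exact ⟨c', C', N, hc', hC', fun D m uh hsol hcov hrate hdof φ hφ =>
    h D uh φ hsol.finite_support hcov (hrate.trans (hN m _ hdof)) hφ⟩
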